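/- Let $k$ be an algebraically closed field, $X$ a smooth projective connected curve over $k$, $x\in X(k)$, $t$ a local coordinate of $X$ at $x$, and $n\ge 1$. **Setup.** Let $Y^n$ be the local model whose $S$-points ($S$ a $k$-scheme) are isomorphism classes of data $(L\xrightarrow{g}E_1\xrightarrow{\varphi}E_2\xrightarrow{h}\mathcal O_{X\times S})$ on $X\times S$, where $E_1,E_2$ are rank $2$ vector bundles with trivialized determinants, $\varphi$ is a morphism which is non-zero on every geometric fiber $X\times\bar s$, $g$ is the inclusion of a line subbundle, $h$ is surjective, and the composite $h\varphi g:L\to\mathcal O_{X\times S}$ is, on every geometric fiber $X\times\bar s$, generically an isomorphism whose divisor of zeros has degree $n$. Let $\pi:Y^n\to X^{(n)}$ remember only $h\varphi g:L\to\mathcal O$, let $v:Y^n\to\mathbb A^1$ be $\det\varphi$, and let ${}_0Y^n\subset Y^n$ be the defect-free locus, where $\varphi$ vanishes at no point of $X\times\bar s$, for every geometric point $\bar s$ of $S$. Let $\mathbb G_m$ act on $Y^n$ by the contracting action $c\cdot(g,\varphi,h)=(c^{-1}g,\,c^2\varphi,\,c^{-1}h)$. Let $\mathbb Y^n=\pi^{-1}(nx)$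 and ${}_0\mathbb Y^n=\mathbb Y^n\cap{}_0Y^n$. **Coordinates.** Given an $S$-point of $\mathbb Y^n$, so that $L\cong\mathcal O(-n(x\times S))$ via $h\varphi g$, put (away from $x\times S$) $u_1=g(1)$ and $u_2=\varphi(u_1)$, and let $v_1\in\ker(h\varphi)$, $w\in\ker h$ be the generators such that $(u_1,v_1)$ and $(u_2,w)$ have determinant $1$. In these bases, the bundles $E_2$ and $E_1$ have near $x\times S$ local frames given by the columns of the matrices $$\begin{pmatrix}1&0\\ \sum_{i=-n}^{-1}a_it^i&1\end{pmatrix}\quad\text{and}\quad\begin{pmatrix}t^n&\sum_{j=0}^{n-1}b_jt^j\\0&t^{-n}\end{pmatrix}$$ respectively, with uniquely determined functions $a_{-n},\dots,a_{-1},b_0,\dots,b_{n-1}\in\Gamma(S,\mathcal O_S)$. **Claim.** 1. The functions $(a_i,b_j)$ identify $\mathbb Y^n$ with the closed subscheme of $\mathbb A^n\times\mathbb A^n$ defined by the $n-1$ equations $$\sum_{i+j=m}a_ib_j=0,\qquad m=-n+1,\dots,-1.$$ 2. Under this identification, ${}_0\mathbb Y^n$ is the complement in $\mathbb Y^n$ of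 the closed subscheme defined by $a_{-n}=0$, $b_0=0$ and $a_{-n+1}b_{n-1}+\dots+a_{-2}b_2+a_{-1}b_1=0$. 3. The composite $\mathbb Y^n\to Y^n\xrightarrow{v}\mathbb A^1$ is $(a_i,b_j)\mapsto a_{-n}b_0$. 4. The action of $\mathbb G_m$ is $c\cdot(a_i,b_j)=(c^2a_i,c^2b_j)$. 5. In particular, $\mathbb Y^1$ is identified with the affine plane $\mathbb A^2$ with coordinates $(a_{-1},b_0)$, and $\mathbb Y^1\to\mathbb A^1$ is $(a_{-1},b_0)\mapsto a_{-1}b_0$, i.e. the classical Picard-Lefschetz family of hyperbolas $xy=s$ over $s\in\mathbb A^1$ degenerating to a node. -/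

import Mathlib

open CategoryTheory Limits AlgebraicGeometry

universe u

namespace PicardLefschetz

noncomputable section

/-! ### Sheaves of modules in terms of sections -/

/-- The structure sheaf of `X`, as a module over itself. -/
abbrev OMod (X : Scheme.{u}) : X.Modules := SheafOfModules.unit X.ringCatSheaf

/-- Restriction of a section of a sheaf of modules to a smaller open set. -/
def res {X : Scheme.{u}} (M : X.Modules) {U V : X.Opens} (h : V ≤ U) (s : Γ(M, U)) : Γ(M, V) :=
  M.presheaf.map (homOfLE h).op s

/-- Restriction of a function to a smaller open set. -/
def fres {X : Scheme.{u}} {U V : X.Opens} (h : V ≤ U) (f : Γ(X, U)) : Γ(X, V) :=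
  X.presheaf.map (homOfLE h).op f

/-- A morphism `M ⟶ 𝒪_X` as a linear map from sections to functions. -/
def toFn {X : Scheme.{u}} {M : X.Modules} (c : M ⟶ OMod X) (U : X.Opens) :
    Γ(M, U) →ₗ[Γ(X, U)] Γ(X, U) where
  toFun s := c.app U s
  map_add' s t := map_add (c.app U).hom s t
  map_smul' f s := Scheme.Modules.Hom.app_smul c f s

/-- The sections `e 0, …, e (r - 1)` over `U` trivialise `M` over `U`. -/
def IsFrame {X : Scheme.{u}} (M : X.Modules) {r : ℕ} (U : X.Opens) (e : Fin r → Γ(M, U)) : Prop :=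
  ∀ (V : X.Opens) (hV : V ≤ U),
    Function.Bijective fun c : Fin r → Γ(X, V) => ∑ i, c i • res M hV (e i)

/-- `M` is a vector bundle of rank `r`: locally isomorphic to `𝒪_X^r`. -/
def IsVectorBundle {X : Scheme.{u}} (M : X.Modules) (r : ℕ) : Prop :=
  ∀ z : X, ∃ (U : X.Opens) (_ : z ∈ U) (e : Fin r → Γ(M, U)), IsFrame M U e

/-- The ideal of those functions on `U` that vanish at the point `z`. -/
def idealAt {X : Scheme.{u}} (U : X.Opens) (z : X) (hz : z ∈ U) : Ideal Γ(X, U) :=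
  (IsLocalRing.maximalIdeal (X.presheaf.stalk z)).comap (X.presheaf.germ U z hz).hom

/-- The morphism `φ : M ⟶ N` vanishes at the point `z`, i.e. it induces the zero map
`M ⊗ κ(z) ⟶ N ⊗ κ(z)` on fibres: locally near `z`, every value of `φ` is a combination of sections
of `N` with coefficients vanishing at `z`. -/
def VanishesAt {X : Scheme.{u}} {M N : X.Modules} (φ : M ⟶ N) (z : X) : Prop :=
  ∀ (U : X.Opens) (_ : z ∈ U) (s : Γ(M, U)), ∃ (V : X.Opens) (hV : V ≤ U) (hz : z ∈ V),
    res N hV (φ.app U s) ∈ (idealAt V z hz • ⊤ : Submodule Γ(X, V) Γ(N, V))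

/-- A module `E` that is a rank two vector bundle together with a trivialisation of `det E`.
A trivialisation `Λ² E ≅ 𝒪_X` is the same thing as an alternating `𝒪_X`-bilinear form `E × E → 𝒪_X`
which takes the value `1` on a suitable local frame around every point. -/
structure SL2Structure {X : Scheme.{u}} (E : X.Modules) where
  form (U : X.Opens) : Γ(E, U) →ₗ[Γ(X, U)] Γ(E, U) →ₗ[Γ(X, U)] Γ(X, U)
  form_self (U : X.Opens) (s : Γ(E, U)) : form U s s = 0
  form_res {U V : X.Opens} (h : V ≤ U) (s t : Γ(E, U)) :
    fres h (form U s t) = form V (res E h s) (res E h t)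
  exists_frame (z : X) : ∃ (U : X.Opens) (_ : z ∈ U) (e : Fin 2 → Γ(E, U)),
    IsFrame E U e ∧ form U (e 0) (e 1) = 1

/-- The ideal sheaf of the zero scheme of `c : L ⟶ 𝒪_X`, i.e. the image of `c`. (For a line bundle
`L`, or any quasi-coherent `L`, the images over the affine open sets do form an ideal sheaf.) -/
def zeroIdeal {X : Scheme.{u}} {L : X.Modules} (c : L ⟶ OMod X) : X.IdealSheafData :=
  Scheme.IdealSheafData.ofIdeals fun U => LinearMap.range (toFn c U.1)

/-- The dimension over `K` of the ring of global functions of a `K`-scheme. (For a finite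
`K`-scheme, this is its degree over `K`.) -/
def degOver {K : Type u} [Field K] {D : Scheme.{u}} (f : D ⟶ Spec (.of K)) : ℕ :=
  letI : Module K Γ(D, ⊤) := Module.compHom _ ((Scheme.ΓSpecIso (.of K)).inv ≫ f.appTop).hom
  Module.finrank K Γ(D, ⊤)

/-! ### Multiplication by a global function -/

/-- Multiplication by a global function, as an endomorphism of a sheaf of modules. -/
def scalar {X : Scheme.{u}} (M : X.Modules) (r : Γ(X, ⊤)) : M ⟶ M :=
  SheafOfModules.Hom.mk (PresheafOfModules.homMk (M₁ := M.val) (M₂ := M.val)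
    { app := fun U => M.smul (fres (V := U.unop) le_top r)
      naturality := by
        intro U V f
        have h := M.map_comp_smul f.unop (fres (V := U.unop) le_top r)
        have h' : X.presheaf.map f.unop.op (fres (V := U.unop) le_top r) =
            fres (V := V.unop) le_top r := by
          simp only [fres, ← CategoryTheory.comp_apply, ← Functor.map_comp]
          rfl
        rw [h'] at h
        exact h.symm }
    (fun U f s => smul_comm (M := Γ(X, U.unop)) (N := Γ(X, U.unop)) (α := Γ(M, U.unop))
      (fres (X := X) (V := U.unop) le_top r) f s))

theorem scalar_app {X : Scheme.{u}} (M : X.Modules) (r : Γ(X, ⊤)) (U : X.Opens) (s : Γ(M, U)) :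
    (scalar M r).app U s = fres (V := U) le_top r • s := rfl

theorem fres_mul {X : Scheme.{u}} {U V : X.Opens} (h : V ≤ U) (f g : Γ(X, U)) :
    fres h (f * g) = fres h f * fres h g := map_mul (X.presheaf.map (homOfLE h).op).hom f g

theorem fres_one {X : Scheme.{u}} {U V : X.Opens} (h : V ≤ U) :
    fres h (1 : Γ(X, U)) = 1 := map_one (X.presheaf.map (homOfLE h).op).hom

theorem scalar_one {X : Scheme.{u}} (M : X.Modules) : scalar M 1 = 𝟙 M := by
  ext U s
  change (scalar M 1).app U s = s
  rw [scalar_app, fres_one, one_smul]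

theorem scalar_comp_scalar {X : Scheme.{u}} (M : X.Modules) (r r' : Γ(X, ⊤)) :
    scalar M r ≫ scalar M r' = scalar M (r' * r) := by
  ext U s
  change (scalar M r').app U ((scalar M r).app U s) = (scalar M (r' * r)).app U s
  rw [scalar_app, scalar_app, scalar_app, fres_mul, mul_smul]

theorem comp_scalar {X : Scheme.{u}} {M N : X.Modules} (φ : M ⟶ N) (r : Γ(X, ⊤)) :
    φ ≫ scalar N r = scalar M r ≫ φ := by
  ext U s
  change (scalar N r).app U (φ.app U s) = φ.app U ((scalar M r).app U s)
  rw [scalar_app, scalar_app, Scheme.Modules.Hom.app_smul]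

theorem isIso_scalar {X : Scheme.{u}} (M : X.Modules) (r : Γ(X, ⊤)ˣ) :
    IsIso (scalar M (r : Γ(X, ⊤))) :=
  ⟨scalar M ((r⁻¹ : Γ(X, ⊤)ˣ) : Γ(X, ⊤)), by
    rw [scalar_comp_scalar, Units.inv_mul, scalar_one], by
    rw [scalar_comp_scalar, Units.mul_inv, scalar_one]⟩

theorem vanishesAt_scalar_comp {X : Scheme.{u}} {M N : X.Modules} {φ : M ⟶ N} {z : X}
    (r : Γ(X, ⊤)) (h : VanishesAt φ z) : VanishesAt (scalar M r ≫ φ) z :=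
  fun U hz s => h U hz ((scalar M r).app U s)

theorem vanishesAt_of_comp_scalar {X : Scheme.{u}} {M N : X.Modules} {φ : M ⟶ N} {z : X}
    (r : Γ(X, ⊤)ˣ) (h : VanishesAt (φ ≫ scalar N (r : Γ(X, ⊤))) z) : VanishesAt φ z := by
  have h' := vanishesAt_scalar_comp ((r⁻¹ : Γ(X, ⊤)ˣ) : Γ(X, ⊤)) h
  rwa [comp_scalar, ← Category.assoc, scalar_comp_scalar, Units.mul_inv, scalar_one,
    Category.id_comp] at h'

/-! ### The local models -/

/-- The product `X × S` over the base scheme `B`. -/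
abbrev prod {B : Scheme.{u}} (X S : Over B) : Scheme.{u} := pullback X.hom S.hom

/-- The projection `X × S ⟶ X`. -/
abbrev pr₁ {B : Scheme.{u}} (X S : Over B) : prod X S ⟶ X.left := pullback.fst X.hom S.hom

/-- The projection `X × S ⟶ S`. -/
abbrev pr₂ {B : Scheme.{u}} (X S : Over B) : prod X S ⟶ S.left := pullback.snd X.hom S.hom

/-- The morphism `id × f : X × S' ⟶ X × S`. -/
def prodMap {B : Scheme.{u}} (X : Over B) {S' S : Over B} (f : S' ⟶ S) : prod X S' ⟶ prod X S :=
  pullback.map X.hom S'.hom X.hom S.hom (𝟙 _) f.left (𝟙 _) (by simp) (by simp)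

/-- The pullback of functions on `S` to functions on `X × S`. -/
def constFn {B : Scheme.{u}} (X S : Over B) (V : (prod X S).Opens) : Γ(S.left, ⊤) →+* Γ(prod X S, V) :=
  ((pr₂ X S).appTop ≫ (prod X S).presheaf.map (homOfLE le_top).op).hom

/-- A geometric point of the `B`-scheme `S`. -/
structure GeomPt {B : Scheme.{u}} (S : Over B) where
  K : Type u
  [field : Field K]
  [isAlgClosed : IsAlgClosed K]
  pt : Spec (.of K) ⟶ S.left

attribute [instance] GeomPt.field GeomPt.isAlgClosed

/-- The spectrum of the field of a geometric point of `S`, as a `B`-scheme. -/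
def GeomPt.over {B : Scheme.{u}} {S : Over B} (s : GeomPt S) : Over B := Over.mk (s.pt ≫ S.hom)

/-- The morphism from the geometric fibre `X × s̄` to `X × S`. -/
def GeomPt.fib {B : Scheme.{u}} {S : Over B} (s : GeomPt S) (X : Over B) :
    prod X s.over ⟶ prod X S :=
  prodMap X (Over.homMk s.pt rfl : s.over ⟶ S)

/-- An `S`-point of the absolute local model `Y^n` of a curve `X`: two `SL₂`-bundles `E₁`, `E₂` on
`X × S`, and maps `L ⟶ E₁ ⟶ E₂ ⟶ 𝒪` with `L` a line subbundle of `E₁` and `E₂ ⟶ 𝒪` surjective. -/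
structure LocalModel {B : Scheme.{u}} (n : ℕ) (X S : Over B) where
  L : (prod X S).Modules
  E₁ : (prod X S).Modules
  E₂ : (prod X S).Modules
  vol₁ : SL2Structure E₁
  vol₂ : SL2Structure E₂
  g : L ⟶ E₁
  φ : E₁ ⟶ E₂
  h : E₂ ⟶ OMod (prod X S)
  isLineBundle : IsVectorBundle L 1
  /-- `g` is injective on all fibres, i.e. `L` is a subbundle. -/
  subbundle : ∀ z, ¬ VanishesAt g z
  quotient : Epi h
  /-- `φ` is not zero on any geometric fibre. -/
  φ_nonzero : ∀ s : GeomPt S, ∃ z : prod X s.over, ¬ VanishesAt φ (s.fib X z)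
  /-- The composite map `L ⟶ 𝒪` of line bundles is generically an isomorphism on every geometric
  fibre, i.e. it does not vanish everywhere on the (integral) curve `X × s̄`. -/
  generic_iso : ∀ s : GeomPt S, ∃ z : prod X s.over, ¬ VanishesAt (g ≫ φ ≫ h) (s.fib X z)
  /-- On every geometric fibre, the divisor of zeros of the composite map has degree `n`. -/
  degree : ∀ s : GeomPt S,
    degOver (((zeroIdeal (g ≫ φ ≫ h)).comap (s.fib X)).subschemeι ≫ pr₂ X s.over) = n

namespace LocalModel

variable {B : Scheme.{u}} {n : ℕ} {X S S' : Over B}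

/-- The composite map `L ⟶ E₁ ⟶ E₂ ⟶ 𝒪`. The pair `(L, comp)` is the image of the `S`-point of `Y^n`
under the projection `π : Y^n ⟶ X^(n)`. -/
def comp (ξ : LocalModel n X S) : ξ.L ⟶ OMod (prod X S) := ξ.g ≫ ξ.φ ≫ ξ.h

/-- The `S`-point lies over the point `n x` of `X^(n)`: the map `comp : L ⟶ 𝒪` is injective, with
image the pullback to `X × S` of the ideal sheaf `𝒪_X(-n x)` (on all affine open sets). In other
words, `(L, comp)` is isomorphic to the pullback of `𝒪_X(-n x) ⟶ 𝒪_X`. -/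
def LiesOver (ξ : LocalModel n X S) (x : Over.mk (𝟙 B) ⟶ X) : Prop :=
  ∀ U : (prod X S).affineOpens, Function.Injective (toFn ξ.comp U.1) ∧
    LinearMap.range (toFn ξ.comp U.1) = ((x.left.ker ^ n).comap (pr₁ X S)).ideal U

/-- Two `S`-points of `Y^n` agree: there are isomorphisms of the bundles that are compatible with
all the structure. -/
def Isomorphic (ξ ξ' : LocalModel n X S) : Prop :=
  ∃ (eL : ξ.L ≅ ξ'.L) (e₁ : ξ.E₁ ≅ ξ'.E₁) (e₂ : ξ.E₂ ≅ ξ'.E₂),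
    ξ.g ≫ e₁.hom = eL.hom ≫ ξ'.g ∧ ξ.φ ≫ e₂.hom = e₁.hom ≫ ξ'.φ ∧ ξ.h = e₂.hom ≫ ξ'.h ∧
    (∀ U s t, ξ'.vol₁.form U (e₁.hom.app U s) (e₁.hom.app U t) = ξ.vol₁.form U s t) ∧
    (∀ U s t, ξ'.vol₂.form U (e₂.hom.app U s) (e₂.hom.app U t) = ξ.vol₂.form U s t)

/-- The `S'`-point `ξ'` is the pullback of the `S`-point `ξ` along `f : S' ⟶ S`: there are maps from
the bundles of `ξ` to the direct images of those of `ξ'`, compatible with all the structure.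
(As the maps respect the trivialisations of the determinants, they send local frames with
determinant `1` to such frames, and nowhere vanishing sections of `L` to such sections of `L'`;
hence the adjoint maps from the inverse images are automatically isomorphisms.) -/
def IsPullback (f : S' ⟶ S) (ξ : LocalModel n X S) (ξ' : LocalModel n X S') : Prop :=
  ∃ (θL : ξ.L ⟶ (Scheme.Modules.pushforward (prodMap X f)).obj ξ'.L)
    (θ₁ : ξ.E₁ ⟶ (Scheme.Modules.pushforward (prodMap X f)).obj ξ'.E₁)
    (θ₂ : ξ.E₂ ⟶ (Scheme.Modules.pushforward (prodMap X f)).obj ξ'.E₂),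
    ξ.g ≫ θ₁ = θL ≫ (Scheme.Modules.pushforward (prodMap X f)).map ξ'.g ∧
    ξ.φ ≫ θ₂ = θ₁ ≫ (Scheme.Modules.pushforward (prodMap X f)).map ξ'.φ ∧
    (∀ U s, toFn ξ'.h (prodMap X f ⁻¹ᵁ U) (θ₂.app U s) = (prodMap X f).app U (toFn ξ.h U s)) ∧
    (∀ U s t, ξ'.vol₁.form (prodMap X f ⁻¹ᵁ U) (θ₁.app U s) (θ₁.app U t) =
      (prodMap X f).app U (ξ.vol₁.form U s t)) ∧
    (∀ U s t, ξ'.vol₂.form (prodMap X f ⁻¹ᵁ U) (θ₂.app U s) (θ₂.app U t) =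
      (prodMap X f).app U (ξ.vol₂.form U s t))

/-- The function `d` on `S` is the determinant of `φ`, i.e. the value of the map `v : Y^n ⟶ 𝔸¹`. -/
def IsDet (ξ : LocalModel n X S) (d : Γ(S.left, ⊤)) : Prop :=
  ∀ U s t, ξ.vol₂.form U (ξ.φ.app U s) (ξ.φ.app U t) = constFn X S U d * ξ.vol₁.form U s t

/-- The `S`-point lies in the defect-free locus: on every geometric fibre, `φ` vanishes at no
point. -/
def DefectFree (ξ : LocalModel n X S) : Prop :=
  ∀ (s : GeomPt S) (z : prod X s.over), ¬ VanishesAt ξ.φ (s.fib X z)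

theorem act_comp {ξ : LocalModel n X S} (c : Γ(prod X S, ⊤)ˣ) :
    (ξ.g ≫ scalar _ ((c⁻¹ : Γ(prod X S, ⊤)ˣ) : Γ(prod X S, ⊤))) ≫
      (ξ.φ ≫ scalar _ ((c ^ 2 : Γ(prod X S, ⊤)ˣ) : Γ(prod X S, ⊤))) ≫
      (ξ.h ≫ scalar _ ((c⁻¹ : Γ(prod X S, ⊤)ˣ) : Γ(prod X S, ⊤))) = ξ.g ≫ ξ.φ ≫ ξ.h := by
  rw [comp_scalar ξ.h, comp_scalar ξ.φ, comp_scalar ξ.g, Category.assoc (scalar _ _),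
    Category.assoc (scalar _ _), ← Category.assoc ξ.φ, comp_scalar ξ.φ, Category.assoc,
    ← Category.assoc (scalar _ _) (scalar _ _), scalar_comp_scalar, ← Category.assoc ξ.g,
    comp_scalar ξ.g, Category.assoc, ← Category.assoc (scalar _ _) (scalar _ _),
    scalar_comp_scalar, ← Units.val_mul, ← Units.val_mul]
  have : c⁻¹ * c ^ 2 * c⁻¹ = 1 := by group
  rw [this, Units.val_one, scalar_one, Category.id_comp]

/-- The function `c` on `S`, as a function on `X × S`. -/
def constUnit {B : Scheme.{u}} (X S : Over B) (c : Γ(S.left, ⊤)ˣ) : Γ(prod X S, ⊤)ˣ :=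
  Units.map (constFn X S ⊤ : Γ(S.left, ⊤) →* Γ(prod X S, ⊤)) c

/-- The contracting action of `𝔾_m` on `Y^n`: the function `c ∈ 𝔾_m(S)` sends the `S`-point
`(g, φ, h)` to `(c⁻¹ g, c² φ, c⁻¹ h)`. -/
def act (c : Γ(S.left, ⊤)ˣ) (ξ : LocalModel n X S) : LocalModel n X S where
  L := ξ.L
  E₁ := ξ.E₁
  E₂ := ξ.E₂
  vol₁ := ξ.vol₁
  vol₂ := ξ.vol₂
  g := ξ.g ≫ scalar _ (((constUnit X S c)⁻¹ : Γ(prod X S, ⊤)ˣ) : Γ(prod X S, ⊤))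
  φ := ξ.φ ≫ scalar _ (((constUnit X S c) ^ 2 : Γ(prod X S, ⊤)ˣ) : Γ(prod X S, ⊤))
  h := ξ.h ≫ scalar _ (((constUnit X S c)⁻¹ : Γ(prod X S, ⊤)ˣ) : Γ(prod X S, ⊤))
  isLineBundle := ξ.isLineBundle
  subbundle z hz := ξ.subbundle z (vanishesAt_of_comp_scalar _ hz)
  quotient := by
    have := ξ.quotient
    have := isIso_scalar (OMod (prod X S)) (constUnit X S c)⁻¹
    exact epi_comp _ _
  φ_nonzero s := (ξ.φ_nonzero s).imp fun z hz h => hz (vanishesAt_of_comp_scalar _ h)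
  generic_iso s := by rw [act_comp]; exact ξ.generic_iso s
  degree s := by rw [act_comp]; exact ξ.degree s

/-- Let `t` be a function on the open set `U ⊆ X`, a local coordinate at the point `p ∈ U`. The
`S`-point `ξ` over `n p` has the coordinates `a = (a_{-n}, …, a_{-1})`, `b = (b_0, …, b_{n-1})`
(where `a i` is `a_{i-n}`) if locally around `p × S` the following holds. Away from `p × S`, the
bundle `E₁` has the unimodular frame `u₁, v₁` with `comp`-normalised `u₁ = g(l)/tⁿ ∈ L` and
`v₁ ∈ ker (h ∘ φ)`, and `E₂` has the unimodular frame `u₂ = φ(u₁)`, `w ∈ ker h`. In these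
trivialisations, `E₁` and `E₂` are the lattices with frames `(g(l), q)` and `(e, w)` given by the
columns of the matrices
`(tⁿ, ∑ b_j t^j ; 0, t⁻ⁿ)` and `(1, 0 ; ∑ a_i t^i, 1)`,
that is, `q = (∑ b_j t^j) u₁ + t⁻ⁿ v₁` and `e = u₂ + (∑ a_i t^i) w`. -/
def HasCoordinates (ξ : LocalModel n X S) (p : X.left) (U : X.left.Opens) (t : Γ(X.left, U))
    (a b : Fin n → Γ(S.left, ⊤)) : Prop :=
  ∀ z : prod X S, pr₁ X S z = p → ∃ (V : (prod X S).Opens) (hV : V ≤ pr₁ X S ⁻¹ᵁ U) (_ : z ∈ V)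
    (l : Γ(ξ.L, V)) (q : Γ(ξ.E₁, V)) (e w : Γ(ξ.E₂, V)),
    letI T : Γ(prod X S, V) := fres hV ((pr₁ X S).app U t)
    toFn ξ.comp V l = T ^ n ∧
    ξ.vol₁.form V (ξ.g.app V l) q = 1 ∧
    toFn ξ.h V (ξ.φ.app V q) = ∑ j, constFn X S V (b j) * T ^ (j : ℕ) ∧
    toFn ξ.h V e = 1 ∧ toFn ξ.h V w = 0 ∧ ξ.vol₂.form V e w = 1 ∧
    T ^ n • e = ξ.φ.app V (ξ.g.app V l) + (∑ i, constFn X S V (a i) * T ^ (i : ℕ)) • w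

end LocalModel

/-- The `S`-points of the fibre of `π : Y^n ⟶ X^(n)` over `n x`. -/
def Fiber {B : Scheme.{u}} (n : ℕ) (X : Over B) (x : Over.mk (𝟙 B) ⟶ X) (S : Over B) :=
  { ξ : LocalModel n X S // ξ.LiesOver x }

/-- The action of `𝔾_m` on the fibre over `n x`. -/
def Fiber.act {B : Scheme.{u}} {n : ℕ} {X : Over B} {x : Over.mk (𝟙 B) ⟶ X} {S : Over B}
    (c : Γ(S.left, ⊤)ˣ) (ξ : Fiber n X x S) : Fiber n X x S :=
  ⟨ξ.1.act c, by
    have h : (ξ.1.act c).comp = ξ.1.comp := LocalModel.act_comp _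
    intro U
    rw [h]
    exact ξ.2 U⟩

/-- The natural transformation `Φ` identifies the functor of isomorphism classes of `S`-points of
the fibre of `Y^n` over `n x` with the functor of points of the `B`-scheme `Z`. -/
structure Represents {B : Scheme.{u}} {n : ℕ} {X : Over B} {x : Over.mk (𝟙 B) ⟶ X} {Z : Over B}
    (Φ : ∀ S : Over B, Fiber n X x S → (S ⟶ Z)) : Prop where
  eq_iff : ∀ {S} (ξ ξ' : Fiber n X x S), Φ S ξ = Φ S ξ' ↔ ξ.1.Isomorphic ξ'.1
  surjective : ∀ S, Function.Surjective (Φ S)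
  exists_pullback : ∀ {S S'} (f : S' ⟶ S) (ξ : Fiber n X x S),
    ∃ ξ' : Fiber n X x S', LocalModel.IsPullback f ξ.1 ξ'.1
  naturality : ∀ {S S'} (f : S' ⟶ S) (ξ : Fiber n X x S) (ξ' : Fiber n X x S'),
    LocalModel.IsPullback f ξ.1 ξ'.1 → Φ S' ξ' = f ≫ Φ S ξ

/-- The function `t` on the open neighbourhood `U` of `p` is a local coordinate at `p`. -/
def IsUniformizer {X : Scheme.{u}} (p : X) (U : X.Opens) (hp : p ∈ U) (t : Γ(X, U)) : Prop :=
  Ideal.span {X.presheaf.germ U p hp t} = IsLocalRing.maximalIdeal (X.presheaf.stalk p)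

/-! ### The explicit equations -/

/-- For `a = (a_{-n}, …, a_{-1})` (where `a i` stands for `a_{i-n}`) and `b = (b_0, …, b_{n-1})`,
the sum of the products `a_i b_j` over all `i`, `j` with `i + j = m`. -/
def convSum {R : Type*} [CommRing R] {n : ℕ} (a b : Fin n → R) (m : ℤ) : R :=
  ∑ i : Fin n, ∑ j : Fin n, if ((i : ℤ) - n) + j = m then a i * b j else 0

/-- The coordinate ring of `𝔸ⁿ × 𝔸ⁿ`; the coordinate `a_{i-n}` is `X (.inl i)` and the
coordinate `b_j` is `X (.inr j)`. -/
abbrev Coord (k : Type u) [Field k] (n : ℕ) : Type u := MvPolynomial (Fin n ⊕ Fin n) k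

/-- The ideal generated by the `n - 1` equations `∑_{i + j = m} a_i b_j = 0`, `-n + 1 ≤ m ≤ -1`. -/
def eqIdeal (k : Type u) [Field k] (n : ℕ) : Ideal (Coord k n) :=
  Ideal.span ((fun m : ℤ => convSum (fun i => MvPolynomial.X (.inl i))
    (fun j => MvPolynomial.X (.inr j)) m) '' Set.Icc (-n + 1) (-1))

/-- The closed subscheme of `𝔸ⁿ × 𝔸ⁿ` defined by these equations, as a scheme over `k`. -/
def eqScheme (k : Type u) [Field k] (n : ℕ) : Over (Spec (.of k)) :=
  Over.mk (Spec.map (CommRingCat.ofHom (algebraMap k (Coord k n ⧸ eqIdeal k n))))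

/-- The closed subset of `eqScheme k n` given by
`a_{-n} = 0`, `b_0 = 0` and `a_{-n+1} b_{n-1} + ⋯ + a_{-1} b_1 = 0`. -/
def defectLocus (k : Type u) [Field k] (n : ℕ) [NeZero n] : Set (eqScheme k n).left :=
  PrimeSpectrum.zeroLocus (Ideal.Quotient.mk (eqIdeal k n) ''
    {MvPolynomial.X (.inl 0), MvPolynomial.X (.inr 0),
      convSum (fun i => MvPolynomial.X (.inl i)) (fun j => MvPolynomial.X (.inr j)) 0})

/-- The function on `S` obtained from a function `r` on `Spec R` by pulling back along
a morphism `P : S ⟶ Spec R`. -/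
def evalAt {R : CommRingCat.{u}} {S : Scheme.{u}} (P : S ⟶ Spec R) (r : R) : Γ(S, ⊤) :=
  P.appTop ((Scheme.ΓSpecIso R).inv r)

/-- The coordinate functions `a` of an `S`-point of `eqScheme k n`. -/
def coordA {k : Type u} [Field k] {n : ℕ} {S : Over (Spec (.of k))} (P : S ⟶ eqScheme k n)
    (i : Fin n) : Γ(S.left, ⊤) :=
  evalAt (R := .of (Coord k n ⧸ eqIdeal k n)) P.left
    (Ideal.Quotient.mk (eqIdeal k n) (MvPolynomial.X (.inl i)))

/-- The coordinate functions `b` of an `S`-point of `eqScheme k n`. -/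
def coordB {k : Type u} [Field k] {n : ℕ} {S : Over (Spec (.of k))} (P : S ⟶ eqScheme k n)
    (j : Fin n) : Γ(S.left, ⊤) :=
  evalAt (R := .of (Coord k n ⧸ eqIdeal k n)) P.left
    (Ideal.Quotient.mk (eqIdeal k n) (MvPolynomial.X (.inr j)))

/-- The affine plane over `k`. -/
def plane (k : Type u) [Field k] : Over (Spec (.of k)) :=
  Over.mk (Spec.map (CommRingCat.ofHom (algebraMap k (MvPolynomial (Fin 2) k))))

/-- The coordinate functions of an `S`-point of the affine plane. -/
def planeCoord {k : Type u} [Field k] {S : Over (Spec (.of k))} (P : S ⟶ plane k)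
    (i : Fin 2) : Γ(S.left, ⊤) :=
  evalAt (R := .of (MvPolynomial (Fin 2) k)) P.left (MvPolynomial.X i)

end

end PicardLefschetz

/-! Away from the section `x × S` the data are rigid. There `hφg` is invertible, so `u₁, v₁`
trivialise `E₁`, `u₂, w` trivialise `E₂`, and `φ` becomes `diag(1, d)` with `d = det φ`. Since `X`
is proper and integral over an algebraically closed field, every global function on `X × S` comes
from `S`; hence `d` is a function on `S`. What remains is the position of the two lattices `E₁` and
`E₂` along the section.

Write `T` for the pullback of `t`. Near the section let `l` generate `L` with `hφg(l) = Tⁿ`,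
complete `g l` to a unimodular frame `(g l, q)` of `E₁`, and choose a unimodular frame `(e, w)` of
`E₂` with `h e = 1` and `h w = 0`. In such an `AdaptedFrame`, `φ(g l) = Tⁿ e - α w` and `φ q = β e +
δ w`. Here `w` is forced, while `q` may be changed by multiples of `g l` and `e` by multiples of
`w`; this changes `β` and `α` by arbitrary multiples of `Tⁿ`. Taylor expansion along the section
(`SectionCoord.exists_poly`, `SectionCoord.poly_unique`) singles out the representatives `∑ a_{i-n}
Tⁱ` and `∑ b_j Tʲ` with fewer than `n` powers of `T`. These are the coordinates
(`Normalized.exists_isCoord`, `Normalized.isCoord_unique`).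

All equations come from the determinant `Tⁿ δ + α β = d`, where `d` is constant along `X`
(`AdaptedFrame.conv_eq`). The coefficient of `T⁰` gives `d = a_{-n} b_0`, those of `T, …, T^{n-1}`
give the `n - 1` equations of the claim, and the higher ones determine `δ`, whose value on the
section is `-∑ a_{-j} b_j`. On the section the matrix of `φ` has the entries `0`, `-a_{-n}`, `b_0`
and this value, which yields the defect locus (`vanishesAt_iff`).

Conversely, a solution of the equations yields bundles glued from trivial ones by the matrices of
the claim, and the equations are exactly what makes the two local matrices of `φ` compatible
(`SectionCoord.mat_comm`, `CurveCoord.std`). Reading off coordinates of sections maps any `S`-point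
isomorphically to the standard one with the same coordinates (`CurveCoord.isomorphic_std`). As
coordinates and standard models are compatible with base change, the solution space represents the
functor (`represents_of_isCoord`). For `n = 1` there are no equations, and the solution space is the
plane.

The geometry of the curve enters only through `LocalCoord.curveCoord`: flatness of `X × S ⟶ X`,
constancy of global functions, and the degree of `n x` on geometric fibres. -/

namespace PicardLefschetz
noncomputable section

/-! ### Restriction of sections -/

section Restriction

variable {X : Scheme.{u}} {M N : X.Modules} {U V W : X.Opens}

theorem res_res (h : V ≤ U) (h' : W ≤ V) (s : Γ(M, U)) :
    res M h' (res M h s) = res M (h'.trans h) s := by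
  simp only [res, ← CategoryTheory.comp_apply, ← Functor.map_comp]
  rfl

theorem res_self (s : Γ(M, U)) : res M le_rfl s = s := by
  simp [res]

theorem res_add (h : V ≤ U) (s t : Γ(M, U)) : res M h (s + t) = res M h s + res M h t :=
  map_add (M.presheaf.map (homOfLE h).op).hom s t

theorem res_sub (h : V ≤ U) (s t : Γ(M, U)) : res M h (s - t) = res M h s - res M h t :=
  map_sub (M.presheaf.map (homOfLE h).op).hom s t

theorem res_smul (h : V ≤ U) (f : Γ(X, U)) (s : Γ(M, U)) :
    res M h (f • s) = fres h f • res M h s :=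
  Scheme.Modules.map_smul M (homOfLE h) f s

theorem res_app (φ : M ⟶ N) (h : V ≤ U) (s : Γ(M, U)) :
    res N h (φ.app U s) = φ.app V (res M h s) :=
  (ConcreteCategory.congr_hom (φ.mapPresheaf.naturality (homOfLE h).op) s).symm

/-- Restriction of functions as a ring homomorphism. -/
def fresHom (h : V ≤ U) : Γ(X, U) →+* Γ(X, V) := (X.presheaf.map (homOfLE h).op).hom

theorem fresHom_apply (h : V ≤ U) (f : Γ(X, U)) : fresHom h f = fres h f := rfl

theorem fres_fres (h : V ≤ U) (h' : W ≤ V) (f : Γ(X, U)) :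
    fres h' (fres h f) = fres (h'.trans h) f := by
  simp only [fres, ← CategoryTheory.comp_apply, ← Functor.map_comp]
  rfl

theorem fres_self (f : Γ(X, U)) : fres le_rfl f = f := by
  simp [fres]

theorem fres_add (h : V ≤ U) (f g : Γ(X, U)) : fres h (f + g) = fres h f + fres h g :=
  map_add (fresHom h) f g

theorem fres_sub (h : V ≤ U) (f g : Γ(X, U)) : fres h (f - g) = fres h f - fres h g :=
  map_sub (fresHom h) f g

theorem fres_neg (h : V ≤ U) (f : Γ(X, U)) : fres h (-f) = -fres h f :=
  map_neg (fresHom h) f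

theorem fres_zero (h : V ≤ U) : fres h (0 : Γ(X, U)) = 0 := map_zero (fresHom h)

theorem fres_pow (h : V ≤ U) (f : Γ(X, U)) (n : ℕ) : fres h (f ^ n) = fres h f ^ n :=
  map_pow (fresHom h) f n

theorem fres_sum {ι : Type*} (s : Finset ι) (h : V ≤ U) (f : ι → Γ(X, U)) :
    fres h (∑ i ∈ s, f i) = ∑ i ∈ s, fres h (f i) :=
  map_sum (fresHom h) f s

theorem fres_toFn (c : M ⟶ OMod X) (h : V ≤ U) (s : Γ(M, U)) :
    fres h (toFn c U s) = toFn c V (res M h s) :=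
  res_app c h s

theorem toFn_comp (φ : M ⟶ N) (c : N ⟶ OMod X) (U : X.Opens) (s : Γ(M, U)) :
    toFn (φ ≫ c) U s = toFn c U (φ.app U s) := rfl

theorem app_add (φ : M ⟶ N) (s t : Γ(M, U)) : φ.app U (s + t) = φ.app U s + φ.app U t :=
  map_add (φ.app U).hom s t

theorem app_sub (φ : M ⟶ N) (s t : Γ(M, U)) : φ.app U (s - t) = φ.app U s - φ.app U t :=
  map_sub (φ.app U).hom s t

theorem app_smul (φ : M ⟶ N) (f : Γ(X, U)) (s : Γ(M, U)) :
    φ.app U (f • s) = f • φ.app U s := Scheme.Modules.Hom.app_smul φ f s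

theorem app_comp {K : X.Modules} (φ : M ⟶ N) (ψ : N ⟶ K) (s : Γ(M, U)) :
    (φ ≫ ψ).app U s = ψ.app U (φ.app U s) := rfl

theorem modules_hom_ext {φ ψ : M ⟶ N} (h : ∀ (U : X.Opens) (s : Γ(M, U)), φ.app U s = ψ.app U s) :
    φ = ψ := by
  refine Scheme.Modules.hom_ext _ _ fun U => ?_
  ext s
  exact h U s

end Restriction

/-! ### Gluing -/

section Gluing

variable {X : Scheme.{u}} {M : X.Modules} {U : X.Opens}

theorem sec_ext {s t : Γ(M, U)}
    (h : ∀ z ∈ U, ∃ (V : X.Opens) (hV : V ≤ U), z ∈ V ∧ res M hV s = res M hV t) : s = t := by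
  choose! V hV hz hst using h
  refine TopCat.Sheaf.eq_of_locally_eq' ⟨M.presheaf, M.isSheaf⟩ (fun z : U => V z.1) U
    (fun z => homOfLE (hV z.1 z.2)) ?_ s t fun z => hst z.1 z.2
  intro z hzU
  exact TopologicalSpace.Opens.mem_iSup.mpr ⟨⟨z, hzU⟩, hz z hzU⟩

theorem fn_ext {f g : Γ(X, U)}
    (h : ∀ z ∈ U, ∃ (V : X.Opens) (hV : V ≤ U), z ∈ V ∧ fres hV f = fres hV g) : f = g :=
  sec_ext (M := OMod X) h

theorem sec_ext₂ {A B : X.Opens} (hA : A ≤ U) (hB : B ≤ U) (hU : U ≤ A ⊔ B) {s t : Γ(M, U)}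
    (h : res M hA s = res M hA t) (h' : res M hB s = res M hB t) : s = t :=
  sec_ext fun z hz => (hU hz).elim (fun hz => ⟨A, hA, hz, h⟩) fun hz => ⟨B, hB, hz, h'⟩

theorem fn_ext₂ {A B : X.Opens} (hA : A ≤ U) (hB : B ≤ U) (hU : U ≤ A ⊔ B) {s t : Γ(X, U)}
    (h : fres hA s = fres hA t) (h' : fres hB s = fres hB t) : s = t :=
  sec_ext₂ (M := OMod X) hA hB hU h h'

/-- Sections with a property that determines them, that is stable under restriction and that
locally can be satisfied, glue. -/
theorem exists_section_of_locally (P : ∀ V : X.Opens, V ≤ U → Γ(M, V) → Prop)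
    (hres : ∀ {V V' : X.Opens} (hV : V ≤ U) (h : V' ≤ V) (s : Γ(M, V)), P V hV s →
      P V' (h.trans hV) (res M h s))
    (huniq : ∀ {V : X.Opens} (hV : V ≤ U) (s t : Γ(M, V)), P V hV s → P V hV t → s = t)
    (hex : ∀ z ∈ U, ∃ (V : X.Opens) (hV : V ≤ U), z ∈ V ∧ ∃ s : Γ(M, V), P V hV s) :
    ∃ s : Γ(M, U), ∀ z ∈ U, ∃ (V : X.Opens) (hV : V ≤ U), z ∈ V ∧ P V hV (res M hV s) := by
  choose! V hV hz s hs using hex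
  obtain ⟨t, ht, -⟩ := TopCat.Sheaf.existsUnique_gluing' ⟨M.presheaf, M.isSheaf⟩
    (fun z : U => V z.1) U (fun z => homOfLE (hV z.1 z.2))
    (fun z hzU => TopologicalSpace.Opens.mem_iSup.mpr ⟨⟨z, hzU⟩, hz z hzU⟩)
    (fun z => s z.1) (by
      intro z z'
      exact huniq (inf_le_left.trans (hV z.1 z.2)) _ _
        (hres (hV z.1 z.2) inf_le_left _ (hs z.1 z.2))
        (hres (hV z'.1 z'.2) inf_le_right _ (hs z'.1 z'.2)))
  refine ⟨t, fun z hzU => ⟨V z, hV z hzU, hz z hzU, ?_⟩⟩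
  have := ht ⟨z, hzU⟩
  change res M _ t = _ at this
  rw [this]
  exact hs z hzU

theorem exists_function_of_locally (P : ∀ V : X.Opens, V ≤ U → Γ(X, V) → Prop)
    (hres : ∀ {V V' : X.Opens} (hV : V ≤ U) (h : V' ≤ V) (s : Γ(X, V)), P V hV s →
      P V' (h.trans hV) (fres h s))
    (huniq : ∀ {V : X.Opens} (hV : V ≤ U) (s t : Γ(X, V)), P V hV s → P V hV t → s = t)
    (hex : ∀ z ∈ U, ∃ (V : X.Opens) (hV : V ≤ U), z ∈ V ∧ ∃ s : Γ(X, V), P V hV s) :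
    ∃ s : Γ(X, U), ∀ z ∈ U, ∃ (V : X.Opens) (hV : V ≤ U), z ∈ V ∧ P V hV (fres hV s) :=
  exists_section_of_locally (M := OMod X) P hres huniq hex

theorem exists_section₂ {A B : X.Opens} (hA : A ≤ U) (hB : B ≤ U) (hU : U ≤ A ⊔ B)
    (s : Γ(M, A)) (t : Γ(M, B))
    (h : res M (inf_le_left : A ⊓ B ≤ A) s = res M (inf_le_right : A ⊓ B ≤ B) t) :
    ∃ r : Γ(M, U), res M hA r = s ∧ res M hB r = t := by
  -- The property quantifies over all smaller open sets, so that it is visibly stable under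
  -- restriction.
  obtain ⟨r, hr⟩ := exists_section_of_locally (M := M) (U := U)
    (fun V hV r => (∀ (V' : X.Opens) (h : V' ≤ V) (h' : V' ≤ A), res M h r = res M h' s) ∧
      ∀ (V' : X.Opens) (h : V' ≤ V) (h' : V' ≤ B), res M h r = res M h' t)
    (fun hV h r hr => ⟨fun V' h₁ h' => by rw [res_res, hr.1], fun V' h₁ h' => by
      rw [res_res, hr.2]⟩)
    (fun {V} hV r r' hr hr' => sec_ext₂ (A := V ⊓ A) (B := V ⊓ B) inf_le_left inf_le_left
      (by rw [← inf_sup_left]; exact le_inf le_rfl (hV.trans hU))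
      (by rw [hr.1 _ _ inf_le_right, hr'.1]) (by rw [hr.2 _ _ inf_le_right, hr'.2]))
    (fun z hz => (hU hz).elim
      (fun hz => ⟨A, hA, hz, s, fun V' h₁ h' => rfl, fun V' h₁ h' => by
        have := congrArg (res M (le_inf h₁ h')) h
        rwa [res_res, res_res] at this⟩)
      (fun hz => ⟨B, hB, hz, t, fun V' h₁ h' => by
        have := congrArg (res M (le_inf h' h₁)) h
        rw [res_res, res_res] at this
        exact this.symm, fun V' h₁ h' => rfl⟩))
  refine ⟨r, sec_ext fun z hz => ?_, sec_ext fun z hz => ?_⟩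
  · obtain ⟨V, hV, hzV, h₁, h₂⟩ := hr z (hA hz)
    refine ⟨V ⊓ A, inf_le_right, ⟨hzV, hz⟩, ?_⟩
    rw [← h₁ (V ⊓ A) inf_le_left inf_le_right, res_res, res_res]
  · obtain ⟨V, hV, hzV, h₁, h₂⟩ := hr z (hB hz)
    refine ⟨V ⊓ B, inf_le_right, ⟨hzV, hz⟩, ?_⟩
    rw [← h₂ (V ⊓ B) inf_le_left inf_le_right, res_res, res_res]

theorem exists_function₂ {A B : X.Opens} (hA : A ≤ U) (hB : B ≤ U) (hU : U ≤ A ⊔ B)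
    (s : Γ(X, A)) (t : Γ(X, B))
    (h : fres (inf_le_left : A ⊓ B ≤ A) s = fres (inf_le_right : A ⊓ B ≤ B) t) :
    ∃ r : Γ(X, U), fres hA r = s ∧ fres hB r = t :=
  exists_section₂ (M := OMod X) hA hB hU s t h

/-- Inverses are unique, so the local ones glue. -/
theorem isUnit_of_locally {f : Γ(X, U)}
    (h : ∀ z ∈ U, ∃ (V : X.Opens) (hV : V ≤ U), z ∈ V ∧ IsUnit (fres hV f)) : IsUnit f := by
  obtain ⟨g, hg⟩ := exists_function_of_locally (U := U) (fun V hV g => fres hV f * g = 1)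
    (fun hV h g hg => by
      have := congrArg (fres h) hg
      rwa [fres_mul, fres_fres, fres_one] at this)
    (fun hV s t hs ht => by
      rw [← mul_one t, ← hs, ← mul_assoc, mul_comm t, ht, one_mul])
    (fun z hz => by
      obtain ⟨V, hV, hzV, hu⟩ := h z hz
      exact ⟨V, hV, hzV, hu.exists_right_inv⟩)
  refine IsUnit.of_mul_eq_one g (fn_ext fun z hz => ?_)
  obtain ⟨V, hV, hzV, e⟩ := hg z hz
  exact ⟨V, hV, hzV, by rw [fres_mul, e, fres_one]⟩

end Gluing

/-! ### Values of functions -/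

section IdealAt

variable {X : Scheme.{u}} {U V : X.Opens} {z : X}

theorem mem_idealAt_iff (hz : z ∈ U) {f : Γ(X, U)} : f ∈ idealAt U z hz ↔ z ∉ X.basicOpen f := by
  rw [idealAt, Ideal.mem_comap, IsLocalRing.mem_maximalIdeal, mem_nonunits_iff,
    Scheme.mem_basicOpen _ _ _ hz]

theorem fres_mem_idealAt_iff (h : V ≤ U) (hz : z ∈ V) {f : Γ(X, U)} :
    fres h f ∈ idealAt V z hz ↔ f ∈ idealAt U z (h hz) := by
  rw [mem_idealAt_iff, mem_idealAt_iff, fres, Scheme.basicOpen_res]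
  simp [hz]

theorem exists_isUnit_fres (hz : z ∈ U) {f : Γ(X, U)} (hf : f ∉ idealAt U z hz) :
    ∃ (V : X.Opens) (hV : V ≤ U), z ∈ V ∧ IsUnit (fres hV f) := by
  rw [mem_idealAt_iff, not_not] at hf
  exact ⟨X.basicOpen f, X.basicOpen_le f, hf, RingedSpace.isUnit_res_basicOpen X.toRingedSpace f⟩

theorem one_notMem_idealAt (hz : z ∈ U) : (1 : Γ(X, U)) ∉ idealAt U z hz := by
  rw [mem_idealAt_iff, not_not]
  exact (X.basicOpen_of_isUnit isUnit_one).symm ▸ hz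

/-- A linear functional maps sections that vanish at `z` to functions that vanish at `z`. -/
theorem map_mem_of_mem_smul_top {N : X.Modules} (l : Γ(N, U) →ₗ[Γ(X, U)] Γ(X, U))
    {I : Ideal Γ(X, U)} {s : Γ(N, U)} (hs : s ∈ (I • ⊤ : Submodule Γ(X, U) Γ(N, U))) :
    l s ∈ I := by
  refine Submodule.smul_induction_on hs (fun r hr n _ => ?_) fun x y hx hy => ?_
  · rw [map_smul]
    exact I.mul_mem_right _ hr
  · rw [map_add]
    exact I.add_mem hx hy

theorem VanishesAt.comp {L M N : X.Modules} {φ : L ⟶ M} (h : VanishesAt φ z) (ψ : M ⟶ N) :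
    VanishesAt (φ ≫ ψ) z := by
  intro U hz s
  obtain ⟨V, hV, hzV, hs⟩ := h U hz s
  refine ⟨V, hV, hzV, ?_⟩
  rw [app_comp, res_app]
  refine Submodule.smul_induction_on hs (fun r hr n _ => ?_) fun x y hx hy => ?_
  · rw [app_smul]
    exact Submodule.smul_mem_smul hr trivial
  · rw [app_add]
    exact add_mem hx hy

theorem VanishesAt.precomp {L M N : X.Modules} {ψ : M ⟶ N} (h : VanishesAt ψ z) (φ : L ⟶ M) :
    VanishesAt (φ ≫ ψ) z :=
  fun U hz s => h U hz (φ.app U s)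

theorem VanishesAt.toFn_mem {M : X.Modules} {c : M ⟶ OMod X} (h : VanishesAt c z) (hz : z ∈ U)
    (s : Γ(M, U)) : toFn c U s ∈ idealAt U z hz := by
  obtain ⟨V, hV, hzV, hs⟩ := h U hz s
  rw [← fres_mem_idealAt_iff hV hzV]
  exact map_mem_of_mem_smul_top (N := OMod X) LinearMap.id hs

end IdealAt

end

end PicardLefschetz

namespace PicardLefschetz
noncomputable section

/-! ### Morphisms of sheaves of modules -/

section Morphisms

variable {X : Scheme.{u}} {M N : X.Modules}

/-- A morphism of sheaves of modules from linear maps on sections. -/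
def homMk (f : ∀ U : X.Opens, Γ(M, U) →ₗ[Γ(X, U)] Γ(N, U))
    (hf : ∀ {U V : X.Opens} (h : V ≤ U) (s : Γ(M, U)), res N h (f U s) = f V (res M h s)) :
    M ⟶ N :=
  SheafOfModules.Hom.mk (PresheafOfModules.homMk (M₁ := M.val) (M₂ := N.val)
    { app := fun U => AddCommGrpCat.ofHom (f U.unop).toAddMonoidHom
      naturality := by
        intro U V i
        ext s
        exact (hf i.unop.le s).symm }
    (fun U r s => (f U.unop).map_smul r s))

/-- A morphism to a direct image from semilinear maps on sections. -/
def homMkPushforward {X' : Scheme.{u}} (F : X' ⟶ X) {N : X'.Modules}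
    (f : ∀ U : X.Opens, Γ(M, U) →+ Γ(N, F ⁻¹ᵁ U))
    (hsmul : ∀ (U : X.Opens) (r : Γ(X, U)) (s : Γ(M, U)), f U (r • s) = F.app U r • f U s)
    (hf : ∀ {U V : X.Opens} (h : V ≤ U) (s : Γ(M, U)),
      res N (F.preimage_mono h) (f U s) = f V (res M h s)) :
    M ⟶ (Scheme.Modules.pushforward F).obj N :=
  homMk (N := (Scheme.Modules.pushforward F).obj N)
    (fun U => { f U with map_smul' := fun r s => hsmul U r s }) (fun h s => hf h s)

theorem isIso_of_bijective {φ : M ⟶ N} (h : ∀ U, Function.Bijective (φ.app U)) : IsIso φ := by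
  rw [Scheme.Modules.Hom.isIso_iff_isIso_app]
  exact fun U => (ConcreteCategory.isIso_iff_bijective _).mpr (h U)

theorem isIso_of_locally_bijective {φ : M ⟶ N}
    (h : ∀ z : X, ∃ U : X.Opens, z ∈ U ∧ ∀ V ≤ U, Function.Bijective (φ.app V)) : IsIso φ := by
  -- Injectivity over every open set comes first: it makes the local preimages unique, so that they
  -- glue.
  have inj : ∀ U, Function.Injective (φ.app U) := by
    intro U s t hst
    refine sec_ext fun z hz => ?_
    obtain ⟨V, hzV, hV⟩ := h z
    refine ⟨U ⊓ V, inf_le_left, ⟨hz, hzV⟩, (hV _ inf_le_right).1 ?_⟩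
    rw [← res_app, ← res_app, hst]
  refine isIso_of_bijective fun U => ⟨inj U, fun t => ?_⟩
  obtain ⟨s, hs⟩ := exists_section_of_locally (M := M) (U := U)
    (fun V hV s => φ.app V s = res N hV t)
    (fun hV h s hs => by rw [← res_app, hs, res_res])
    (fun {V} hV s s' hs hs' => inj V (hs.trans hs'.symm))
    (fun z hz => by
      obtain ⟨V, hzV, hV⟩ := h z
      exact ⟨U ⊓ V, inf_le_left, ⟨hz, hzV⟩, (hV _ inf_le_right).2 _⟩)
  refine ⟨s, sec_ext fun z hz => ?_⟩
  obtain ⟨V, hV, hzV, e⟩ := hs z hz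
  exact ⟨V, hV, hzV, by rw [res_app, e]⟩

/-- A morphism to the structure sheaf is an epimorphism if it locally takes the value `1`. -/
theorem epi_of_locally_one {h : M ⟶ OMod X}
    (H : ∀ z : X, ∃ (U : X.Opens) (_ : z ∈ U) (e : Γ(M, U)), toFn h U e = 1) : Epi h := by
  refine ⟨fun {K} a b hab => modules_hom_ext fun U f => sec_ext fun z hz => ?_⟩
  obtain ⟨V, hzV, e, he⟩ := H z
  refine ⟨U ⊓ V, inf_le_left, ⟨hz, hzV⟩, ?_⟩
  -- Locally `f = f · h(e)`, so a morphism `c` out of the structure sheaf is determined by `h ≫ c`.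
  have key : ∀ c : OMod X ⟶ K, res K inf_le_left (c.app U f) =
      (show Γ(X, U ⊓ V) from res (OMod X) inf_le_left f) •
        res K inf_le_right ((h ≫ c).app V e) := by
    intro c
    have h1 : res (OMod X) (inf_le_right : U ⊓ V ≤ V) (h.app V e) = (1 : Γ(X, U ⊓ V)) :=
      (congrArg (fres (inf_le_right : U ⊓ V ≤ V)) he).trans (fres_one _)
    have h2 : res (OMod X) (inf_le_left : U ⊓ V ≤ U) f =
        (show Γ(X, U ⊓ V) from res (OMod X) inf_le_left f) •
          (show Γ(OMod X, U ⊓ V) from (1 : Γ(X, U ⊓ V))) :=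
      (mul_one (show Γ(X, U ⊓ V) from res (OMod X) inf_le_left f)).symm
    rw [app_comp, res_app, res_app, h1]
    exact (congrArg (c.app (U ⊓ V)) h2).trans (app_smul c _ _)
  rw [key, key, hab]

/-- An epimorphism to the structure sheaf does not vanish at any point. -/
theorem exists_toFn_notMem_of_epi {h : M ⟶ OMod X} [Epi h] (z : X) :
    ∃ (U : X.Opens) (hz : z ∈ U) (e : Γ(M, U)), toFn h U e ∉ idealAt U z hz := by
  by_contra! H
  let ι := X.fromSpecResidueField z
  -- Here `q` is evaluation at `z`, with values in a skyscraper sheaf. If all values of `h` vanish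
  -- at `z`, then `h ≫ q = 0`, hence `q = 0` because `h` is an epimorphism; but `q` sends `1` to `1
  -- ≠ 0`.
  let q : OMod X ⟶ (Scheme.Modules.pushforward ι).obj (OMod _) :=
    homMkPushforward (M := OMod X) (N := OMod _) ι (fun U => (ι.app U).hom.toAddMonoidHom)
      (fun U r s => map_mul (ι.app U).hom r s)
      (fun {U V} h s => by
        have := ConcreteCategory.congr_hom (ι.naturality (homOfLE h).op) s
        exact this.symm)
  have hq : ∀ (U : X.Opens) (f : Γ(X, U)), q.app U f = ι.app U f := fun U f => rfl
  have h0 : h ≫ q = h ≫ 0 := by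
    refine modules_hom_ext fun U s => ?_
    have e1 : (h ≫ q).app U s = ι.app U (toFn h U s) := rfl
    have e2 : (h ≫ (0 : OMod X ⟶ (Scheme.Modules.pushforward ι).obj (OMod _))).app U s = 0 := rfl
    rw [e1, e2]
    refine fn_ext fun y hy => ⟨ι ⁻¹ᵁ U, le_rfl, hy, ?_⟩
    have hy' : ι y = z := X.fromSpecResidueField_apply z y
    have hz : z ∈ U := hy' ▸ hy
    have hb := H U hz s
    rw [mem_idealAt_iff] at hb
    have hb' : ((Spec (X.residueField z)).basicOpen (ι.app U (toFn h U s))) = ⊥ := by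
      rw [← Scheme.preimage_basicOpen]
      refine eq_bot_iff.mpr fun y' hy' => hb ?_
      have := X.fromSpecResidueField_apply z y'
      rw [← this]
      exact hy'
    rw [basicOpen_eq_bot_iff] at hb'
    rw [hb']
    rfl
  have hq0 : q = 0 := (cancel_epi h).mp h0
  have h1 : ι.app ⊤ (1 : Γ(X, ⊤)) = 0 := by
    rw [← hq ⊤, hq0]
    rfl
  rw [map_one] at h1
  have : Subsingleton Γ(Spec (X.residueField z), ⊤) := subsingleton_of_zero_eq_one h1.symm
  have h2 : (Spec (X.residueField z)).basicOpen (1 : Γ(Spec (X.residueField z), ⊤)) = ⊥ := by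
    rw [Subsingleton.elim 1 (0 : Γ(Spec (X.residueField z), ⊤)), Scheme.basicOpen_zero]
  rw [Scheme.basicOpen_of_isUnit _ isUnit_one] at h2
  have y : Spec (X.residueField z) := IsLocalRing.closedPoint _
  have hy : y ∈ (⊤ : (Spec (X.residueField z)).Opens) := trivial
  rw [h2] at hy
  exact hy

theorem exists_toFn_eq_one_of_epi {h : M ⟶ OMod X} [Epi h] (z : X) :
    ∃ (U : X.Opens) (_ : z ∈ U) (e : Γ(M, U)), toFn h U e = 1 := by
  obtain ⟨U, hz, e, he⟩ := exists_toFn_notMem_of_epi (h := h) z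
  obtain ⟨V, hV, hzV, u, hu⟩ := exists_isUnit_fres hz he
  refine ⟨V, hzV, (u⁻¹ : Γ(X, V)ˣ).1 • res M hV e, ?_⟩
  rw [map_smul, ← fres_toFn, ← hu, smul_eq_mul, Units.inv_mul]

end Morphisms

/-! ### Rank two bundles with trivialised determinant -/

namespace SL2Structure

variable {X : Scheme.{u}} {E : X.Modules} (v : SL2Structure E) {U : X.Opens}

theorem form_swap (s t : Γ(E, U)) : v.form U s t = -v.form U t s := by
  have h := v.form_self U (s + t)
  simp only [map_add, LinearMap.add_apply, v.form_self, zero_add, add_zero] at h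
  exact eq_neg_of_add_eq_zero_right h

theorem exists_pair {z : X} (hz : z ∈ U) :
    ∃ (V : X.Opens) (_ : V ≤ U) (_ : z ∈ V) (c d : Γ(E, V)), v.form V c d = 1 ∧
      ∀ {V' : X.Opens} (h : V' ≤ V) (s : Γ(E, V')),
        ∃ x y : Γ(X, V'), s = x • res E h c + y • res E h d := by
  obtain ⟨V, hzV, e, he, h1⟩ := v.exists_frame z
  refine ⟨U ⊓ V, inf_le_left, ⟨hz, hzV⟩, res E inf_le_right (e 0), res E inf_le_right (e 1), ?_, ?_⟩
  · rw [← v.form_res, h1, fres_one]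
  · intro V' h s
    obtain ⟨c, hc⟩ := (he V' (h.trans inf_le_right)).2 s
    refine ⟨c 0, c 1, ?_⟩
    rw [← hc]
    simp only [Fin.sum_univ_two, res_res]

/-- Any three vectors in rank two are dependent, with the `2 × 2` minors as coefficients. In a local
frame this is a polynomial identity in the coordinates. -/
theorem plucker (c d s : Γ(E, U)) : v.form U c d • s = v.form U s d • c + v.form U c s • d := by
  refine sec_ext fun z hz => ?_
  obtain ⟨V, hV, hzV, a, b, hab, H⟩ := v.exists_pair hz
  refine ⟨V, hV, hzV, ?_⟩
  simp only [res_add, res_smul, v.form_res]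
  obtain ⟨c₀, c₁, hc⟩ := H le_rfl (res E hV c)
  obtain ⟨d₀, d₁, hd⟩ := H le_rfl (res E hV d)
  obtain ⟨s₀, s₁, hs⟩ := H le_rfl (res E hV s)
  simp only [res_self] at hc hd hs
  rw [hc, hd, hs]
  simp only [map_add, map_smul, LinearMap.add_apply, LinearMap.smul_apply, v.form_self, hab,
    v.form_swap b a, smul_eq_mul]
  module

/-- Cramer's rule: a pair of determinant `1` is automatically a basis, and the form computes the
coordinates. -/
theorem eq_of_form_eq_one {c d : Γ(E, U)} (h : v.form U c d = 1) (s : Γ(E, U)) :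
    s = v.form U s d • c + v.form U c s • d := by
  rw [← v.plucker, h, one_smul]

/-- Functionals on `E` are represented by sections of `E`. -/
theorem exists_dual (l : E ⟶ OMod X) :
    ∃ w : Γ(E, ⊤), ∀ (U : X.Opens) (s : Γ(E, U)), v.form U s (res E le_top w) = toFn l U s := by
  obtain ⟨w, hw⟩ := exists_section_of_locally (M := E) (U := ⊤)
    (fun V hV w => ∀ (U : X.Opens) (h : U ≤ V) (s : Γ(E, U)),
      v.form U s (res E h w) = toFn l U s)
    (fun hV h w hw U h' s => by rw [res_res, hw])
    (fun {V} hV w w' hw hw' => sec_ext fun z hz => by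
      obtain ⟨V', hV', hzV', a, b, hab, -⟩ := v.exists_pair hz
      refine ⟨V', hV', hzV', ?_⟩
      rw [v.eq_of_form_eq_one hab (res E hV' w), v.eq_of_form_eq_one hab (res E hV' w'), hw, hw',
        v.form_swap _ b, v.form_swap _ b, hw, hw'])
    (fun z hz => by
      obtain ⟨V, hV, hzV, a, b, hab, -⟩ := v.exists_pair hz
      -- With `vol(a, b) = 1`, this combination pairs with `a` and `b` to `l(a)` and `l(b)`.
      refine ⟨V, hV, hzV, toFn l V a • b - toFn l V b • a, fun U h s => ?_⟩
      have hab' : v.form U (res E h a) (res E h b) = 1 := by rw [← v.form_res, hab, fres_one]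
      conv_rhs => rw [v.eq_of_form_eq_one hab' s]
      simp only [res_sub, res_smul, map_sub, map_smul, map_add, fres_toFn, smul_eq_mul]
      rw [v.form_swap s (res E h a)]
      ring)
  refine ⟨w, fun U s => fn_ext fun z hz => ?_⟩
  obtain ⟨V, hV, hzV, h⟩ := hw z trivial
  refine ⟨U ⊓ V, inf_le_left, ⟨hz, hzV⟩, ?_⟩
  rw [v.form_res, fres_toFn, ← h _ inf_le_right, res_res, res_res]

/-- The determinant of a morphism between rank two bundles with trivialised determinants. -/
theorem exists_det {E' : X.Modules} (v' : SL2Structure E') (φ : E ⟶ E') :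
    ∃ d : Γ(X, ⊤), ∀ (U : X.Opens) (s t : Γ(E, U)),
      v'.form U (φ.app U s) (φ.app U t) = fres le_top d * v.form U s t := by
  obtain ⟨d, hd⟩ := exists_function_of_locally (X := X) (U := ⊤)
    (fun V hV d => ∀ (U : X.Opens) (h : U ≤ V) (s t : Γ(E, U)),
      v'.form U (φ.app U s) (φ.app U t) = fres h d * v.form U s t)
    (fun hV h d hd U h' s t => by rw [fres_fres, hd])
    (fun {V} hV d d' hd hd' => fn_ext fun z hz => by
      obtain ⟨V', hV', hzV', a, b, hab, -⟩ := v.exists_pair hz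
      refine ⟨V', hV', hzV', ?_⟩
      have := (hd V' hV' a b).symm.trans (hd' V' hV' a b)
      rwa [hab, mul_one, mul_one] at this)
    (fun z hz => by
      obtain ⟨V, hV, hzV, a, b, hab, -⟩ := v.exists_pair hz
      refine ⟨V, hV, hzV, v'.form V (φ.app V a) (φ.app V b), fun U h s t => ?_⟩
      have hab' : v.form U (res E h a) (res E h b) = 1 := by rw [← v.form_res, hab, fres_one]
      rw [v'.form_res, res_app, res_app]
      obtain ⟨x, y, hs⟩ : ∃ x y : Γ(X, U), s = x • res E h a + y • res E h b :=
        ⟨_, _, v.eq_of_form_eq_one hab' s⟩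
      obtain ⟨x', y', ht⟩ : ∃ x y : Γ(X, U), t = x • res E h a + y • res E h b :=
        ⟨_, _, v.eq_of_form_eq_one hab' t⟩
      rw [hs, ht]
      simp only [app_smul, map_add, map_smul, LinearMap.add_apply, LinearMap.smul_apply,
        v.form_self, v'.form_self, hab', v.form_swap (res E h b) (res E h a),
        v'.form_swap (φ.app U (res E h b)) (φ.app U (res E h a)), smul_eq_mul]
      ring)
  refine ⟨d, fun U s t => fn_ext fun z hz => ?_⟩
  obtain ⟨V, hV, hzV, h⟩ := hd z trivial
  refine ⟨U ⊓ V, inf_le_left, ⟨hz, hzV⟩, ?_⟩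
  rw [v'.form_res, res_app, res_app, h _ inf_le_right, fres_mul, v.form_res, fres_fres, fres_fres]

end SL2Structure

/-- A morphism does not vanish at `z` if one of its values is part of a frame with determinant `1`
near `z`. -/
theorem not_vanishesAt_of_form_eq_one {X : Scheme.{u}} {M E : X.Modules} (v : SL2Structure E)
    {φ : M ⟶ E} {U : X.Opens} {z : X} (hz : z ∈ U) {s : Γ(M, U)} {d : Γ(E, U)}
    (h : v.form U (φ.app U s) d = 1) : ¬ VanishesAt φ z := by
  intro H
  obtain ⟨V, hV, hzV, hs⟩ := H U hz s
  have := map_mem_of_mem_smul_top ((v.form V).flip (res E hV d)) hs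
  rw [LinearMap.flip_apply, ← v.form_res, h, fres_one] at this
  exact one_notMem_idealAt hzV this

theorem not_vanishesAt_of_toFn_eq_one {X : Scheme.{u}} {M : X.Modules}
    {c : M ⟶ OMod X} {U : X.Opens} {z : X} (hz : z ∈ U) {s : Γ(M, U)}
    (h : toFn c U s = 1) : ¬ VanishesAt c z := fun H => by
  have := H.toFn_mem hz s
  rw [h] at this
  exact one_notMem_idealAt hz this

end

end PicardLefschetz

namespace PicardLefschetz
noncomputable section

/-! ### Bundles glued from two trivial ones -/

section Glue

variable {X : Scheme.{u}} {A B : X.Opens} {r : ℕ}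

/-- Pairs of tuples of functions on `V ∩ A` and on `V ∩ B` which correspond to each other under
the transition matrix `M` on `A ∩ B`. -/
def glueSec (M : Matrix (Fin r) (Fin r) Γ(X, A ⊓ B)) (V : X.Opens) :
    AddSubgroup ((Fin r → Γ(X, V ⊓ A)) × (Fin r → Γ(X, V ⊓ B))) where
  carrier := { p | ∀ i, fres (le_inf inf_le_left (inf_le_right.trans inf_le_left) :
      V ⊓ (A ⊓ B) ≤ V ⊓ A) (p.1 i) = ∑ j, fres (inf_le_right : V ⊓ (A ⊓ B) ≤ A ⊓ B) (M i j) *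
        fres (le_inf inf_le_left (inf_le_right.trans inf_le_right)) (p.2 j) }
  add_mem' := by
    intro p q hp hq i
    simp only [Prod.fst_add, Prod.snd_add, Pi.add_apply, fres_add, mul_add, Finset.sum_add_distrib,
      hp i, hq i]
  zero_mem' := by
    intro i
    simp [fres_zero]
  neg_mem' := by
    intro p hp i
    simp only [Prod.fst_neg, Prod.snd_neg, Pi.neg_apply, fres_neg, mul_neg, Finset.sum_neg_distrib,
      hp i]

instance (M : Matrix (Fin r) (Fin r) Γ(X, A ⊓ B)) (V : X.Opens) :
    SMul Γ(X, V) (glueSec M V) where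
  smul f p := ⟨(fun i => fres inf_le_left f * p.1.1 i, fun i => fres inf_le_left f * p.1.2 i), by
    intro i
    simp only [fres_mul, fres_fres, p.2 i, Finset.mul_sum]
    exact Finset.sum_congr rfl fun j _ => by ring⟩

theorem glueSec_smul_fst (M : Matrix (Fin r) (Fin r) Γ(X, A ⊓ B)) {V : X.Opens} (f : Γ(X, V))
    (p : glueSec M V) (i : Fin r) : (f • p).1.1 i = fres inf_le_left f * p.1.1 i := rfl

theorem glueSec_smul_snd (M : Matrix (Fin r) (Fin r) Γ(X, A ⊓ B)) {V : X.Opens} (f : Γ(X, V))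
    (p : glueSec M V) (i : Fin r) : (f • p).1.2 i = fres inf_le_left f * p.1.2 i := rfl

theorem glueSec_ext {M : Matrix (Fin r) (Fin r) Γ(X, A ⊓ B)} {V : X.Opens} {p q : glueSec M V}
    (h : ∀ i, p.1.1 i = q.1.1 i) (h' : ∀ i, p.1.2 i = q.1.2 i) : p = q :=
  Subtype.ext (Prod.ext (funext h) (funext h'))

instance (M : Matrix (Fin r) (Fin r) Γ(X, A ⊓ B)) (V : X.Opens) :
    Module Γ(X, V) (glueSec M V) where
  one_smul p := glueSec_ext (fun i => by rw [glueSec_smul_fst, fres_one, one_mul])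
    fun i => by rw [glueSec_smul_snd, fres_one, one_mul]
  mul_smul f g p := glueSec_ext (fun i => by simp only [glueSec_smul_fst, fres_mul, mul_assoc])
    fun i => by simp only [glueSec_smul_snd, fres_mul, mul_assoc]
  smul_zero f := glueSec_ext (fun i => mul_zero _) fun i => mul_zero _
  smul_add f p q := glueSec_ext (fun i => mul_add _ _ _) fun i => mul_add _ _ _
  add_smul f g p := glueSec_ext
    (fun i => by
      change fres _ (f + g) * p.1.1 i = fres _ f * p.1.1 i + fres _ g * p.1.1 i
      rw [fres_add, add_mul])
    fun i => by
      change fres _ (f + g) * p.1.2 i = fres _ f * p.1.2 i + fres _ g * p.1.2 i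
      rw [fres_add, add_mul]
  zero_smul p := glueSec_ext
    (fun i => by
      change fres _ 0 * p.1.1 i = 0
      rw [fres_zero, zero_mul])
    fun i => by
      change fres _ 0 * p.1.2 i = 0
      rw [fres_zero, zero_mul]

/-- Restriction of glued sections. -/
def glueRes (M : Matrix (Fin r) (Fin r) Γ(X, A ⊓ B)) {V V' : X.Opens} (h : V' ≤ V) :
    glueSec M V →+ glueSec M V' where
  toFun p := ⟨(fun i => fres (inf_le_inf_right A h) (p.1.1 i),
    fun i => fres (inf_le_inf_right B h) (p.1.2 i)), by
      intro i
      have := congrArg (fres (inf_le_inf_right (A ⊓ B) h)) (p.2 i)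
      simpa only [fres_fres, fres_sum, fres_mul] using this⟩
  map_zero' := glueSec_ext (fun i => fres_zero _) fun i => fres_zero _
  map_add' p q := glueSec_ext (fun i => fres_add _ _ _) fun i => fres_add _ _ _

theorem glueRes_self (M : Matrix (Fin r) (Fin r) Γ(X, A ⊓ B)) {V : X.Opens} (p : glueSec M V) :
    glueRes M le_rfl p = p :=
  glueSec_ext (fun _ => fres_self _) fun _ => fres_self _

theorem glueRes_glueRes (M : Matrix (Fin r) (Fin r) Γ(X, A ⊓ B)) {V V' V'' : X.Opens} (h : V' ≤ V)
    (h' : V'' ≤ V') (p : glueSec M V) :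
    glueRes M h' (glueRes M h p) = glueRes M (h'.trans h) p :=
  glueSec_ext (fun _ => fres_fres _ _ _) fun _ => fres_fres _ _ _

theorem glueRes_smul (M : Matrix (Fin r) (Fin r) Γ(X, A ⊓ B)) {V V' : X.Opens} (h : V' ≤ V)
    (f : Γ(X, V)) (p : glueSec M V) : glueRes M h (f • p) = fres h f • glueRes M h p :=
  glueSec_ext
    (fun i => by
      change fres _ (fres _ f * p.1.1 i) = fres _ (fres h f) * fres _ (p.1.1 i)
      rw [fres_mul, fres_fres, fres_fres])
    fun i => by
      change fres _ (fres _ f * p.1.2 i) = fres _ (fres h f) * fres _ (p.1.2 i)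
      rw [fres_mul, fres_fres, fres_fres]

/-- The presheaf of glued sections. -/
def gluePresheaf (M : Matrix (Fin r) (Fin r) Γ(X, A ⊓ B)) : TopCat.Presheaf Ab.{u} X where
  obj V := AddCommGrpCat.of (glueSec M V.unop)
  map i := AddCommGrpCat.ofHom (glueRes M i.unop.le)
  map_id V := by
    refine ConcreteCategory.hom_ext _ _ fun p => ?_
    exact glueRes_self M p
  map_comp i j := by
    refine ConcreteCategory.hom_ext _ _ fun p => ?_
    exact (glueRes_glueRes M i.unop.le j.unop.le p).symm

/-- The coordinates glue one by one, and the transition relation is an equality of functions, which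
can be checked locally. -/
theorem gluePresheaf_isSheaf (M : Matrix (Fin r) (Fin r) Γ(X, A ⊓ B)) :
    (gluePresheaf M).IsSheaf := by
  rw [TopCat.Presheaf.isSheaf_iff_isSheafUniqueGluing]
  intro ι U sf hsf
  have hsf' : ∀ k l, glueRes M (inf_le_left : U k ⊓ U l ≤ U k) (sf k) =
      glueRes M (inf_le_right : U k ⊓ U l ≤ U l) (sf l) := hsf
  have hA : ∀ i, ∃! s : Γ(X, iSup U ⊓ A), ∀ k,
      fres (inf_le_inf_right A (le_iSup U k)) s = (sf k).1.1 i := by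
    intro i
    refine TopCat.Sheaf.existsUnique_gluing' X.sheaf (fun k => U k ⊓ A) (iSup U ⊓ A)
      (fun k => homOfLE (inf_le_inf_right A (le_iSup U k))) (by rw [iSup_inf_eq])
      (fun k => (sf k).1.1 i) fun k l => ?_
    have := congrArg (fun p => fres (by
      refine le_inf (le_inf (inf_le_left.trans inf_le_left) (inf_le_right.trans inf_le_left)) ?_
      exact inf_le_left.trans inf_le_right : (U k ⊓ A) ⊓ (U l ⊓ A) ≤ (U k ⊓ U l) ⊓ A) (p.1.1 i))
      (hsf' k l)
    exact (fres_fres _ _ _).symm.trans (this.trans (fres_fres _ _ _))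
  have hB : ∀ i, ∃! s : Γ(X, iSup U ⊓ B), ∀ k,
      fres (inf_le_inf_right B (le_iSup U k)) s = (sf k).1.2 i := by
    intro i
    refine TopCat.Sheaf.existsUnique_gluing' X.sheaf (fun k => U k ⊓ B) (iSup U ⊓ B)
      (fun k => homOfLE (inf_le_inf_right B (le_iSup U k))) (by rw [iSup_inf_eq])
      (fun k => (sf k).1.2 i) fun k l => ?_
    have := congrArg (fun p => fres (by
      refine le_inf (le_inf (inf_le_left.trans inf_le_left) (inf_le_right.trans inf_le_left)) ?_
      exact inf_le_left.trans inf_le_right : (U k ⊓ B) ⊓ (U l ⊓ B) ≤ (U k ⊓ U l) ⊓ B) (p.1.2 i))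
      (hsf' k l)
    exact (fres_fres _ _ _).symm.trans (this.trans (fres_fres _ _ _))
  choose a ha ha' using hA
  choose b hb hb' using hB
  have hab : (a, b) ∈ glueSec M (iSup U) := by
    intro i
    refine fn_ext fun z hz => ?_
    obtain ⟨k, hk⟩ := TopologicalSpace.Opens.mem_iSup.mp hz.1
    refine ⟨U k ⊓ (A ⊓ B), inf_le_inf_right _ (le_iSup U k), ⟨hk, hz.2⟩, ?_⟩
    have h1 := (sf k).2 i
    rw [← ha] at h1
    simp only [← hb] at h1
    simpa only [fres_fres, fres_sum, fres_mul] using h1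
  refine ⟨(⟨(a, b), hab⟩ : glueSec M (iSup U)), fun k => glueSec_ext (fun i => ha i k)
    fun i => hb i k, fun p hp => glueSec_ext (fun i => ha' i _ fun k => ?_)
    fun i => hb' i _ fun k => ?_⟩
  · exact congrArg (fun q : glueSec M (U k) => q.1.1 i) (hp k)
  · exact congrArg (fun q : glueSec M (U k) => q.1.2 i) (hp k)

/-- The bundle glued from the trivial bundles on `A` and on `B` by means of the transition matrix
`M` on `A ∩ B`. -/
def glue (M : Matrix (Fin r) (Fin r) Γ(X, A ⊓ B)) : X.Modules where
  val :=
    letI (V : X.Opensᵒᵖ) : Module (X.ringCatSheaf.obj.obj V) ((gluePresheaf M).obj V) :=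
      inferInstanceAs (Module Γ(X, V.unop) (glueSec M V.unop))
    PresheafOfModules.ofPresheaf (R := X.ringCatSheaf.obj) (gluePresheaf M) (fun _ _ i f p =>
      glueRes_smul M i.unop.le f p)
  isSheaf := gluePresheaf_isSheaf M

variable {M : Matrix (Fin r) (Fin r) Γ(X, A ⊓ B)} {V V' : X.Opens}

/-- The coordinates on an open subset of `A` of a section of a glued bundle. -/
def glueA (s : Γ(glue M, V)) (h : V' ≤ V) (h' : V' ≤ A) (i : Fin r) : Γ(X, V') :=
  fres (le_inf h h') ((show glueSec M V from s).1.1 i)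

/-- The coordinates on an open subset of `B` of a section of a glued bundle. -/
def glueB (s : Γ(glue M, V)) (h : V' ≤ V) (h' : V' ≤ B) (i : Fin r) : Γ(X, V') :=
  fres (le_inf h h') ((show glueSec M V from s).1.2 i)

/-- The section of a glued bundle with given coordinates. -/
def glueMk (a : Fin r → Γ(X, V ⊓ A)) (b : Fin r → Γ(X, V ⊓ B))
    (h : ∀ i, fres (le_inf inf_le_left (inf_le_right.trans inf_le_left) :
      V ⊓ (A ⊓ B) ≤ V ⊓ A) (a i) = ∑ j, fres (inf_le_right : V ⊓ (A ⊓ B) ≤ A ⊓ B) (M i j) *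
        fres (le_inf inf_le_left (inf_le_right.trans inf_le_right)) (b j)) : Γ(glue M, V) :=
  (⟨(a, b), h⟩ : glueSec M V)

theorem glueA_glueMk (a : Fin r → Γ(X, V ⊓ A)) (b : Fin r → Γ(X, V ⊓ B)) (H) (h : V' ≤ V)
    (h' : V' ≤ A) (i : Fin r) :
    glueA (glueMk (M := M) a b H) h h' i = fres (le_inf h h') (a i) := rfl

theorem glueB_glueMk (a : Fin r → Γ(X, V ⊓ A)) (b : Fin r → Γ(X, V ⊓ B)) (H) (h : V' ≤ V)
    (h' : V' ≤ B) (i : Fin r) :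
    glueB (glueMk (M := M) a b H) h h' i = fres (le_inf h h') (b i) := rfl

theorem glue_ext {s t : Γ(glue M, V)}
    (h : ∀ i, glueA s (inf_le_left : V ⊓ A ≤ V) inf_le_right i = glueA t inf_le_left inf_le_right i)
    (h' : ∀ i, glueB s (inf_le_left : V ⊓ B ≤ V) inf_le_right i =
      glueB t inf_le_left inf_le_right i) : s = t := by
  refine glueSec_ext (M := M) (fun i => ?_) fun i => ?_
  · have := h i
    rwa [glueA, glueA, fres_self, fres_self] at this
  · have := h' i
    rwa [glueB, glueB, fres_self, fres_self] at this

theorem fres_glueA (s : Γ(glue M, V)) (h : V' ≤ V) (h' : V' ≤ A) {V'' : X.Opens} (k : V'' ≤ V')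
    (i : Fin r) : fres k (glueA s h h' i) = glueA s (k.trans h) (k.trans h') i :=
  fres_fres _ _ _

theorem fres_glueB (s : Γ(glue M, V)) (h : V' ≤ V) (h' : V' ≤ B) {V'' : X.Opens} (k : V'' ≤ V')
    (i : Fin r) : fres k (glueB s h h' i) = glueB s (k.trans h) (k.trans h') i :=
  fres_fres _ _ _

theorem glueA_res (s : Γ(glue M, V)) {V'' : X.Opens} (k : V'' ≤ V) (h : V' ≤ V'') (h' : V' ≤ A)
    (i : Fin r) : glueA (res (glue M) k s) h h' i = glueA s (h.trans k) h' i :=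
  fres_fres _ _ _

theorem glueB_res (s : Γ(glue M, V)) {V'' : X.Opens} (k : V'' ≤ V) (h : V' ≤ V'') (h' : V' ≤ B)
    (i : Fin r) : glueB (res (glue M) k s) h h' i = glueB s (h.trans k) h' i :=
  fres_fres _ _ _

theorem glueA_add (s t : Γ(glue M, V)) (h : V' ≤ V) (h' : V' ≤ A) (i : Fin r) :
    glueA (s + t) h h' i = glueA s h h' i + glueA t h h' i := fres_add _ _ _

theorem glueB_add (s t : Γ(glue M, V)) (h : V' ≤ V) (h' : V' ≤ B) (i : Fin r) :
    glueB (s + t) h h' i = glueB s h h' i + glueB t h h' i := fres_add _ _ _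

theorem glueA_smul (f : Γ(X, V)) (s : Γ(glue M, V)) (h : V' ≤ V) (h' : V' ≤ A) (i : Fin r) :
    glueA (f • s) h h' i = fres h f * glueA s h h' i := by
  refine (fres_mul _ _ _).trans ?_
  rw [fres_fres]
  rfl

theorem glueB_smul (f : Γ(X, V)) (s : Γ(glue M, V)) (h : V' ≤ V) (h' : V' ≤ B) (i : Fin r) :
    glueB (f • s) h h' i = fres h f * glueB s h h' i := by
  refine (fres_mul _ _ _).trans ?_
  rw [fres_fres]
  rfl

theorem glueA_eq (s : Γ(glue M, V)) (h : V' ≤ V) (hA : V' ≤ A) (hB : V' ≤ B) (i : Fin r) :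
    glueA s h hA i = ∑ j, fres (le_inf hA hB) (M i j) * glueB s h hB j := by
  have := congrArg (fres (le_inf h (le_inf hA hB))) ((show glueSec M V from s).2 i)
  simp only [fres_fres, fres_sum, fres_mul] at this
  exact this

/-- A section of a glued bundle over an open subset of `B` is determined by its coordinates
over `B`, which are arbitrary. -/
theorem bijective_glueB (hV : V ≤ B) :
    Function.Bijective fun s : Γ(glue M, V) => glueB s le_rfl hV := by
  refine ⟨fun s t hst => glue_ext (fun i => ?_) fun i => ?_, fun b => ?_⟩
  · have hst' : ∀ j, glueB s le_rfl hV j = glueB t le_rfl hV j := fun j => congrFun hst j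
    rw [glueA_eq s _ _ (inf_le_left.trans hV), glueA_eq t _ _ (inf_le_left.trans hV)]
    refine Finset.sum_congr rfl fun j _ => ?_
    rw [← fres_glueB s le_rfl hV inf_le_left, hst', fres_glueB]
  · have hst' : ∀ j, glueB s le_rfl hV j = glueB t le_rfl hV j := fun j => congrFun hst j
    rw [← fres_glueB s le_rfl hV inf_le_left, hst', fres_glueB]
  · refine ⟨glueMk (fun i => ∑ j, fres (le_inf inf_le_right (inf_le_left.trans hV)) (M i j) *
      fres inf_le_left (b j)) (fun i => fres inf_le_left (b i)) ?_, funext fun i => ?_⟩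
    · intro i
      simp only [fres_fres, fres_sum, fres_mul]
    · dsimp only
      rw [glueB_glueMk, fres_fres, fres_self]

/-- A section of a glued bundle over an open subset of `A` is determined by its coordinates
over `A`, which are arbitrary. -/
theorem bijective_glueA {M' : Matrix (Fin r) (Fin r) Γ(X, A ⊓ B)} (hM : M * M' = 1) (hV : V ≤ A) :
    Function.Bijective fun s : Γ(glue M, V) => glueA s le_rfl hV := by
  have hM' : M' * M = 1 := mul_eq_one_comm.mp hM
  have hB : ∀ (s : Γ(glue M, V)) {V'} (h : V' ≤ V) (k : V' ≤ B) i, glueB s h k i =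
      ∑ j, fres (le_inf (h.trans hV) k) (M' i j) * glueA s h (h.trans hV) j := by
    intro s V' h k i
    have e : ((M'.map (fresHom (le_inf (h.trans hV) k))) * (M.map (fresHom (le_inf (h.trans hV) k))))
        = 1 := by
      rw [← Matrix.map_mul, hM']
      exact Matrix.map_one _ (map_zero _) (map_one _)
    have h2 : (fun i => glueA s h (h.trans hV) i) =
        (M.map (fresHom (le_inf (h.trans hV) k))).mulVec (glueB s h k) :=
      funext fun i => glueA_eq s h (h.trans hV) k i
    have h3 := congrArg (fun v => (M'.map (fresHom (le_inf (h.trans hV) k))).mulVec v i) h2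
    beta_reduce at h3
    rw [Matrix.mulVec_mulVec, e, Matrix.one_mulVec] at h3
    exact h3.symm
  refine ⟨fun s t hst => glue_ext (fun i => ?_) fun i => ?_, fun a => ?_⟩
  · have hst' : ∀ j, glueA s le_rfl hV j = glueA t le_rfl hV j := fun j => congrFun hst j
    rw [← fres_glueA s le_rfl hV inf_le_left, hst', fres_glueA]
  · have hst' : ∀ j, glueA s le_rfl hV j = glueA t le_rfl hV j := fun j => congrFun hst j
    rw [hB, hB]
    refine Finset.sum_congr rfl fun j _ => ?_
    rw [← fres_glueA s le_rfl hV inf_le_left, hst', fres_glueA]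
  · refine ⟨glueMk (fun i => fres inf_le_left (a i)) (fun i => ∑ j, fres (le_inf
      (inf_le_left.trans hV) inf_le_right) (M' i j) * fres inf_le_left (a j)) ?_, funext fun i => ?_⟩
    · intro i
      have e : ((M.map (fresHom (inf_le_right : V ⊓ (A ⊓ B) ≤ A ⊓ B))) *
          (M'.map (fresHom (inf_le_right : V ⊓ (A ⊓ B) ≤ A ⊓ B)))) = 1 := by
        rw [← Matrix.map_mul, hM]
        exact Matrix.map_one _ (map_zero _) (map_one _)
      have h3 := congrArg (fun N : Matrix (Fin r) (Fin r) Γ(X, V ⊓ (A ⊓ B)) =>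
        N.mulVec (fun j => fres inf_le_left (a j)) i) e
      beta_reduce at h3
      rw [← Matrix.mulVec_mulVec, Matrix.one_mulVec] at h3
      simp only [fres_fres, fres_sum, fres_mul]
      exact h3.symm
    · dsimp only
      rw [glueA_glueMk, fres_fres, fres_self]

/-- A section over `B` of a glued bundle whose coordinates are the `i`-th basis vector. -/
theorem exists_frame_glueB :
    ∃ e : Fin r → Γ(glue M, B), IsFrame (glue M) B e ∧
      ∀ i j, glueB (e i) le_rfl le_rfl j = if j = i then 1 else 0 := by
  choose e he using fun i : Fin r => (bijective_glueB (M := M) (le_refl B)).2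
    (fun j => if j = i then 1 else 0)
  refine ⟨e, fun V hV => ?_, fun i j => congrFun (he i) j⟩
  -- Taking coordinates undoes forming combinations of the `e i`; as the former is bijective, so is
  -- the latter.
  have key : (fun s : Γ(glue M, V) => glueB s le_rfl hV) ∘
      (fun c : Fin r → Γ(X, V) => ∑ i, c i • res (glue M) hV (e i)) = id := by
    funext c j
    have hsum : ∀ t : Finset (Fin r), glueB (∑ i ∈ t, c i • res (glue M) hV (e i)) le_rfl hV j =
        ∑ i ∈ t, glueB (c i • res (glue M) hV (e i)) le_rfl hV j := by
      intro t
      induction t using Finset.induction_on with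
      | empty => exact fres_zero _
      | insert i t hi ih => rw [Finset.sum_insert hi, Finset.sum_insert hi, glueB_add, ih]
    simp only [Function.comp_apply, id]
    rw [hsum]
    have : ∀ i, glueB (c i • res (glue M) hV (e i)) le_rfl hV j = if j = i then c i else 0 := by
      intro i
      rw [glueB_smul, glueB_res, ← fres_glueB (e i) le_rfl le_rfl hV,
        show glueB (e i) le_rfl le_rfl j = _ from congrFun (he i) j, fres_self]
      split_ifs <;> simp [fres_one, fres_zero]
    simp [this]
  have hb := bijective_glueB (M := M) hV
  refine (Function.Bijective.of_comp_iff' hb _).mp ?_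
  rw [key]
  exact Function.bijective_id

theorem exists_frame_glueA {M' : Matrix (Fin r) (Fin r) Γ(X, A ⊓ B)} (hM : M * M' = 1) :
    ∃ e : Fin r → Γ(glue M, A), IsFrame (glue M) A e ∧
      ∀ i j, glueA (e i) le_rfl le_rfl j = if j = i then 1 else 0 := by
  choose e he using fun i : Fin r => (bijective_glueA hM (le_refl A)).2
    (fun j => if j = i then 1 else 0)
  refine ⟨e, fun V hV => ?_, fun i j => congrFun (he i) j⟩
  have key : (fun s : Γ(glue M, V) => glueA s le_rfl hV) ∘
      (fun c : Fin r → Γ(X, V) => ∑ i, c i • res (glue M) hV (e i)) = id := by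
    funext c j
    have hsum : ∀ t : Finset (Fin r), glueA (∑ i ∈ t, c i • res (glue M) hV (e i)) le_rfl hV j =
        ∑ i ∈ t, glueA (c i • res (glue M) hV (e i)) le_rfl hV j := by
      intro t
      induction t using Finset.induction_on with
      | empty => exact fres_zero _
      | insert i t hi ih => rw [Finset.sum_insert hi, Finset.sum_insert hi, glueA_add, ih]
    simp only [Function.comp_apply, id]
    rw [hsum]
    have : ∀ i, glueA (c i • res (glue M) hV (e i)) le_rfl hV j = if j = i then c i else 0 := by
      intro i
      rw [glueA_smul, glueA_res, ← fres_glueA (e i) le_rfl le_rfl hV,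
        show glueA (e i) le_rfl le_rfl j = _ from congrFun (he i) j, fres_self]
      split_ifs <;> simp [fres_one, fres_zero]
    simp [this]
  have hb := bijective_glueA hM hV
  refine (Function.Bijective.of_comp_iff' hb _).mp ?_
  rw [key]
  exact Function.bijective_id

theorem isVectorBundle_glue {M' : Matrix (Fin r) (Fin r) Γ(X, A ⊓ B)} (hM : M * M' = 1)
    (hAB : A ⊔ B = ⊤) : IsVectorBundle (glue M) r := by
  intro z
  have hz : z ∈ A ⊔ B := hAB ▸ TopologicalSpace.Opens.mem_top z
  rcases hz with hz | hz
  · obtain ⟨e, he, -⟩ := exists_frame_glueA hM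
    exact ⟨A, hz, e, he⟩
  · obtain ⟨e, he, -⟩ := exists_frame_glueB (M := M)
    exact ⟨B, hz, e, he⟩

theorem le_inf_sup_inf (hAB : A ⊔ B = ⊤) (V : X.Opens) : V ≤ (V ⊓ A) ⊔ (V ⊓ B) := by
  rw [← inf_sup_left, hAB, inf_top_eq]

end Glue

end

end PicardLefschetz

namespace PicardLefschetz
noncomputable section

/-! ### Pullback of functions -/

section Pull

variable {X X' : Scheme.{u}} (F : X' ⟶ X) {U V : X.Opens} {U' V' : X'.Opens}

/-- The pullback of functions along a morphism, restricted to a smaller open set. -/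
def pull (h : U' ≤ F ⁻¹ᵁ U) : Γ(X, U) →+* Γ(X', U') := (F.appLE U U' h).hom

theorem fres_pull (h : U' ≤ F ⁻¹ᵁ U) (h' : V' ≤ U') (f : Γ(X, U)) :
    fres h' (pull F h f) = pull F (h'.trans h) f :=
  ConcreteCategory.congr_hom (F.appLE_map h (homOfLE h').op) f

theorem pull_fres (h : U' ≤ F ⁻¹ᵁ V) (h' : V ≤ U) (f : Γ(X, U)) :
    pull F h (fres h' f) = pull F (h.trans (F.preimage_mono h')) f :=
  ConcreteCategory.congr_hom (F.map_appLE h (homOfLE h').op) f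

theorem pull_eq_app (f : Γ(X, U)) : pull F (le_refl (F ⁻¹ᵁ U)) f = F.app U f := by
  rw [pull, Scheme.Hom.appLE_eq_app]

theorem pull_eq_fres_app (h : U' ≤ F ⁻¹ᵁ U) (f : Γ(X, U)) : pull F h f = fres h (F.app U f) := by
  rw [← pull_eq_app, fres_pull]

theorem pull_pull {X'' : Scheme.{u}} (G : X'' ⟶ X') {U'' : X''.Opens} (h : U' ≤ F ⁻¹ᵁ U)
    (h' : U'' ≤ G ⁻¹ᵁ U') (f : Γ(X, U)) : pull G h' (pull F h f) =
      pull (G ≫ F) (h'.trans (G.preimage_mono h)) f :=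
  ConcreteCategory.congr_hom (Scheme.Hom.appLE_comp_appLE G F U U' U'' h h') f

theorem pull_congr {F G : X' ⟶ X} (e : F = G) (h : U' ≤ F ⁻¹ᵁ U) (h' : U' ≤ G ⁻¹ᵁ U)
    (f : Γ(X, U)) : pull F h f = pull G h' f := by
  subst e
  rfl

theorem pull_id (h : U' ≤ (𝟙 X' : X' ⟶ X') ⁻¹ᵁ V') (f : Γ(X', V')) :
    pull (𝟙 X') h f = fres h f := by
  rw [pull_eq_fres_app, Scheme.Hom.id_app]
  rfl

end Pull

/-! ### Morphisms, determinant forms and pullbacks of glued bundles -/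

section GlueMaps

variable {X : Scheme.{u}} {A B : X.Opens}

theorem glueFn_aux {V : X.Opens} {a : Γ(X, V ⊓ A)} {b : Γ(X, V ⊓ B)}
    (h : fres (le_inf inf_le_left (inf_le_right.trans inf_le_left) : V ⊓ (A ⊓ B) ≤ V ⊓ A) a =
      fres (le_inf inf_le_left (inf_le_right.trans inf_le_right)) b) :
    fres (inf_le_left : (V ⊓ A) ⊓ (V ⊓ B) ≤ V ⊓ A) a = fres inf_le_right b := by
  have k : (V ⊓ A) ⊓ (V ⊓ B) ≤ V ⊓ (A ⊓ B) := le_inf (inf_le_left.trans inf_le_left)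
    (le_inf (inf_le_left.trans inf_le_right) (inf_le_right.trans inf_le_right))
  have := congrArg (fres k) h
  rwa [fres_fres, fres_fres] at this

/-- The function with given restrictions to `V ∩ A` and to `V ∩ B`. -/
def glueFn (hAB : A ⊔ B = ⊤) {V : X.Opens} (a : Γ(X, V ⊓ A)) (b : Γ(X, V ⊓ B))
    (h : fres (le_inf inf_le_left (inf_le_right.trans inf_le_left) : V ⊓ (A ⊓ B) ≤ V ⊓ A) a =
      fres (le_inf inf_le_left (inf_le_right.trans inf_le_right)) b) : Γ(X, V) :=
  (exists_function₂ (inf_le_left : V ⊓ A ≤ V) (inf_le_left : V ⊓ B ≤ V) (le_inf_sup_inf hAB V)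
    a b (glueFn_aux h)).choose

variable (hAB : A ⊔ B = ⊤)

theorem fres_glueFn_left {V V' : X.Opens} (a : Γ(X, V ⊓ A)) (b : Γ(X, V ⊓ B)) (H) (h : V' ≤ V)
    (h' : V' ≤ A) : fres h (glueFn hAB a b H) = fres (le_inf h h') a := by
  have := (exists_function₂ (inf_le_left : V ⊓ A ≤ V) (inf_le_left : V ⊓ B ≤ V)
    (le_inf_sup_inf hAB V) a b (glueFn_aux H)).choose_spec.1
  exact (fres_fres _ _ _).symm.trans (congrArg (fres (le_inf h h')) this)

theorem fres_glueFn_right {V V' : X.Opens} (a : Γ(X, V ⊓ A)) (b : Γ(X, V ⊓ B)) (H) (h : V' ≤ V)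
    (h' : V' ≤ B) : fres h (glueFn hAB a b H) = fres (le_inf h h') b := by
  have := (exists_function₂ (inf_le_left : V ⊓ A ≤ V) (inf_le_left : V ⊓ B ≤ V)
    (le_inf_sup_inf hAB V) a b (glueFn_aux H)).choose_spec.2
  exact (fres_fres _ _ _).symm.trans (congrArg (fres (le_inf h h')) this)

include hAB in
theorem fn_ext_cover {V : X.Opens} {f g : Γ(X, V)}
    (h : fres (inf_le_left : V ⊓ A ≤ V) f = fres inf_le_left g)
    (h' : fres (inf_le_left : V ⊓ B ≤ V) f = fres inf_le_left g) : f = g :=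
  fn_ext₂ inf_le_left inf_le_left (le_inf_sup_inf hAB V) h h'

variable {r : ℕ} {N : X.Modules} {M : Matrix (Fin r) (Fin r) Γ(X, A ⊓ B)}

/-- A morphism to a glued bundle from its coordinates over `A` and over `B`. -/
def homToGlue (M : Matrix (Fin r) (Fin r) Γ(X, A ⊓ B))
    (fA : ∀ V : X.Opens, V ≤ A → Γ(N, V) →ₗ[Γ(X, V)] Fin r → Γ(X, V))
    (fB : ∀ V : X.Opens, V ≤ B → Γ(N, V) →ₗ[Γ(X, V)] Fin r → Γ(X, V))
    (hA : ∀ {V V' : X.Opens} (hV : V ≤ A) (h : V' ≤ V) (s : Γ(N, V)) (i : Fin r),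
      fres h (fA V hV s i) = fA V' (h.trans hV) (res N h s) i)
    (hB : ∀ {V V' : X.Opens} (hV : V ≤ B) (h : V' ≤ V) (s : Γ(N, V)) (i : Fin r),
      fres h (fB V hV s i) = fB V' (h.trans hV) (res N h s) i)
    (hM : ∀ {V : X.Opens} (hV : V ≤ A) (hV' : V ≤ B) (s : Γ(N, V)) (i : Fin r),
      fA V hV s i = ∑ j, fres (le_inf hV hV') (M i j) * fB V hV' s j) : N ⟶ glue M :=
  homMk
    (fun V =>
      { toFun := fun s => glueMk (fA (V ⊓ A) inf_le_right (res N inf_le_left s))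
          (fB (V ⊓ B) inf_le_right (res N inf_le_left s)) (fun i => by
            simp only [hA, hB, res_res]
            exact hM _ _ _ i)
        map_add' := fun s t => glue_ext
          (fun i => by
            rw [glueA_add, glueA_glueMk, glueA_glueMk, glueA_glueMk, res_add, map_add, Pi.add_apply,
              fres_add])
          (fun i => by
            rw [glueB_add, glueB_glueMk, glueB_glueMk, glueB_glueMk, res_add, map_add, Pi.add_apply,
              fres_add])
        map_smul' := fun f s => glue_ext
          (fun i => by
            rw [RingHom.id_apply, glueA_smul, glueA_glueMk, glueA_glueMk, res_smul, map_smul,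
              Pi.smul_apply, smul_eq_mul, fres_mul, fres_fres])
          (fun i => by
            rw [RingHom.id_apply, glueB_smul, glueB_glueMk, glueB_glueMk, res_smul, map_smul,
              Pi.smul_apply, smul_eq_mul, fres_mul, fres_fres]) })
    (fun h s => glue_ext
      (fun i => by
        change glueA (res _ _ (glueMk _ _ _)) _ _ _ = glueA (glueMk _ _ _) _ _ _
        rw [glueA_res, glueA_glueMk, glueA_glueMk, hA, hA, res_res, res_res, res_res])
      (fun i => by
        change glueB (res _ _ (glueMk _ _ _)) _ _ _ = glueB (glueMk _ _ _) _ _ _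
        rw [glueB_res, glueB_glueMk, glueB_glueMk, hB, hB, res_res, res_res, res_res]))

section

variable {fA : ∀ V : X.Opens, V ≤ A → Γ(N, V) →ₗ[Γ(X, V)] Fin r → Γ(X, V)}
  {fB : ∀ V : X.Opens, V ≤ B → Γ(N, V) →ₗ[Γ(X, V)] Fin r → Γ(X, V)}
  {hA : ∀ {V V' : X.Opens} (hV : V ≤ A) (h : V' ≤ V) (s : Γ(N, V)) (i : Fin r),
      fres h (fA V hV s i) = fA V' (h.trans hV) (res N h s) i}
  {hB : ∀ {V V' : X.Opens} (hV : V ≤ B) (h : V' ≤ V) (s : Γ(N, V)) (i : Fin r),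
      fres h (fB V hV s i) = fB V' (h.trans hV) (res N h s) i}
  {hM : ∀ {V : X.Opens} (hV : V ≤ A) (hV' : V ≤ B) (s : Γ(N, V)) (i : Fin r),
      fA V hV s i = ∑ j, fres (le_inf hV hV') (M i j) * fB V hV' s j}

theorem glueA_homToGlue {V V' : X.Opens} (s : Γ(N, V)) (h : V' ≤ V) (h' : V' ≤ A) (i : Fin r) :
    glueA ((homToGlue M fA fB hA hB hM).app V s) h h' i = fA V' h' (res N h s) i := by
  change glueA (glueMk _ _ _) _ _ _ = _
  rw [glueA_glueMk, hA, res_res]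

theorem glueB_homToGlue {V V' : X.Opens} (s : Γ(N, V)) (h : V' ≤ V) (h' : V' ≤ B) (i : Fin r) :
    glueB ((homToGlue M fA fB hA hB hM).app V s) h h' i = fB V' h' (res N h s) i := by
  change glueB (glueMk _ _ _) _ _ _ = _
  rw [glueB_glueMk, hB, res_res]

theorem bijective_homToGlue_left {M' : Matrix (Fin r) (Fin r) Γ(X, A ⊓ B)} (hMM : M * M' = 1)
    {V : X.Opens} (hV : V ≤ A) (h : Function.Bijective (fA V hV)) :
    Function.Bijective ((homToGlue M fA fB hA hB hM).app V) := by
  refine (Function.Bijective.of_comp_iff' (bijective_glueA hMM hV) _).mp ?_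
  convert h using 1
  funext s i
  exact (glueA_homToGlue s le_rfl hV i).trans (by rw [res_self])

theorem bijective_homToGlue_right {V : X.Opens} (hV : V ≤ B) (h : Function.Bijective (fB V hV)) :
    Function.Bijective ((homToGlue M fA fB hA hB hM).app V) := by
  refine (Function.Bijective.of_comp_iff' (bijective_glueB hV) _).mp ?_
  convert h using 1
  funext s i
  exact (glueB_homToGlue s le_rfl hV i).trans (by rw [res_self])

end

section

variable {r' : ℕ}

/-- The `A`-coordinates of a section of a glued bundle, multiplied by a matrix. -/
def mulA (M : Matrix (Fin r) (Fin r) Γ(X, A ⊓ B)) (P : Matrix (Fin r') (Fin r) Γ(X, A))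
    (V : X.Opens) (hV : V ≤ A) : Γ(glue M, V) →ₗ[Γ(X, V)] Fin r' → Γ(X, V) where
  toFun := fun s => (P.map (fresHom hV)).mulVec (glueA s le_rfl hV)
  map_add' := fun s t => by
    rw [← Matrix.mulVec_add]
    congr 1
    exact funext fun i => glueA_add s t _ _ i
  map_smul' := fun f s => by
    rw [RingHom.id_apply, ← Matrix.mulVec_smul]
    congr 1
    exact funext fun i => by rw [glueA_smul, fres_self]; rfl

/-- The `B`-coordinates of a section of a glued bundle, multiplied by a matrix. -/
def mulB (M : Matrix (Fin r) (Fin r) Γ(X, A ⊓ B)) (Q : Matrix (Fin r') (Fin r) Γ(X, B))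
    (V : X.Opens) (hV : V ≤ B) : Γ(glue M, V) →ₗ[Γ(X, V)] Fin r' → Γ(X, V) where
  toFun := fun s => (Q.map (fresHom hV)).mulVec (glueB s le_rfl hV)
  map_add' := fun s t => by
    rw [← Matrix.mulVec_add]
    congr 1
    exact funext fun i => glueB_add s t _ _ i
  map_smul' := fun f s => by
    rw [RingHom.id_apply, ← Matrix.mulVec_smul]
    congr 1
    exact funext fun i => by rw [glueB_smul, fres_self]; rfl

variable {M : Matrix (Fin r) (Fin r) Γ(X, A ⊓ B)} {M' : Matrix (Fin r') (Fin r') Γ(X, A ⊓ B)}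
  {P : Matrix (Fin r') (Fin r) Γ(X, A)} {Q : Matrix (Fin r') (Fin r) Γ(X, B)}

theorem mulA_apply {V : X.Opens} (hV : V ≤ A) (s : Γ(glue M, V)) (i : Fin r') :
    mulA M P V hV s i = ∑ j, fres hV (P i j) * glueA s le_rfl hV j := rfl

theorem mulB_apply {V : X.Opens} (hV : V ≤ B) (s : Γ(glue M, V)) (i : Fin r') :
    mulB M Q V hV s i = ∑ j, fres hV (Q i j) * glueB s le_rfl hV j := rfl

theorem fres_mulA {V V' : X.Opens} (hV : V ≤ A) (h : V' ≤ V) (s : Γ(glue M, V)) (i : Fin r') :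
    fres h (mulA M P V hV s i) = mulA M P V' (h.trans hV) (res (glue M) h s) i := by
  simp only [mulA_apply, fres_sum, fres_mul, fres_fres, fres_glueA, glueA_res]

theorem fres_mulB {V V' : X.Opens} (hV : V ≤ B) (h : V' ≤ V) (s : Γ(glue M, V)) (i : Fin r') :
    fres h (mulB M Q V hV s i) = mulB M Q V' (h.trans hV) (res (glue M) h s) i := by
  simp only [mulB_apply, fres_sum, fres_mul, fres_fres, fres_glueB, glueB_res]

/-- The coordinates of a section satisfy `s_A = M s_B`, and `H` says `P M = M' Q`; hence `P s_A = M'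
(Q s_B)`. -/
theorem mulA_eq
    (H : ∀ i k, ∑ j, fres inf_le_left (P i j) * M j k = ∑ j, M' i j * fres inf_le_right (Q j k))
    {V : X.Opens} (hV : V ≤ A) (hV' : V ≤ B) (s : Γ(glue M, V)) (i : Fin r') :
    mulA M P V hV s i = ∑ j, fres (le_inf hV hV') (M' i j) * mulB M Q V hV' s j := by
  change (P.map (fresHom hV)).mulVec (glueA s le_rfl hV) i =
    ((M'.map (fresHom (le_inf hV hV'))).mulVec
      ((Q.map (fresHom hV')).mulVec (glueB s le_rfl hV'))) i
  have e : glueA s le_rfl hV =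
      (M.map (fresHom (le_inf hV hV'))).mulVec (glueB s le_rfl hV') :=
    funext fun i => glueA_eq s le_rfl hV hV' i
  have h' : P.map (fresHom hV) * M.map (fresHom (le_inf hV hV')) =
      M'.map (fresHom (le_inf hV hV')) * Q.map (fresHom hV') := by
    ext i k
    have := congrArg (fres (le_inf hV hV')) (H i k)
    simpa only [Matrix.mul_apply, Matrix.map_apply, fres_sum, fres_mul, fresHom_apply,
      fres_fres] using this
  rw [e, Matrix.mulVec_mulVec, Matrix.mulVec_mulVec, h']

/-- The morphism of glued bundles given by matrices over `A` and over `B`. -/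
def glueMap (M : Matrix (Fin r) (Fin r) Γ(X, A ⊓ B))
    (M' : Matrix (Fin r') (Fin r') Γ(X, A ⊓ B)) (P : Matrix (Fin r') (Fin r) Γ(X, A))
    (Q : Matrix (Fin r') (Fin r) Γ(X, B))
    (H : ∀ i k, ∑ j, fres inf_le_left (P i j) * M j k = ∑ j, M' i j * fres inf_le_right (Q j k)) :
    glue M ⟶ glue M' :=
  homToGlue M' (mulA M P) (mulB M Q) fres_mulA fres_mulB (mulA_eq H)

variable
  {H : ∀ i k, ∑ j, fres inf_le_left (P i j) * M j k = ∑ j, M' i j * fres inf_le_right (Q j k)}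

theorem glueA_glueMap {V V' : X.Opens} (s : Γ(glue M, V)) (h : V' ≤ V) (h' : V' ≤ A)
    (i : Fin r') : glueA ((glueMap M M' P Q H).app V s) h h' i =
      ∑ j, fres h' (P i j) * glueA s h h' j := by
  rw [glueMap, glueA_homToGlue (hA := fres_mulA) (hB := fres_mulB) (hM := mulA_eq H), mulA_apply]
  simp only [glueA_res]

theorem glueB_glueMap {V V' : X.Opens} (s : Γ(glue M, V)) (h : V' ≤ V) (h' : V' ≤ B)
    (i : Fin r') : glueB ((glueMap M M' P Q H).app V s) h h' i =
      ∑ j, fres h' (Q i j) * glueB s h h' j := by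
  rw [glueMap, glueB_homToGlue (hA := fres_mulA) (hB := fres_mulB) (hM := mulA_eq H), mulB_apply]
  simp only [glueB_res]

end

/-- The first coordinate of a section of a bundle glued by a matrix whose first row is
`(1, 0)`. -/
def glueFstFn {M : Matrix (Fin 2) (Fin 2) Γ(X, A ⊓ B)} (h0 : M 0 0 = 1) (h1 : M 0 1 = 0)
    {V : X.Opens} (s : Γ(glue M, V)) : Γ(X, V) :=
  glueFn hAB (glueA s inf_le_left inf_le_right 0) (glueB s inf_le_left inf_le_right 0) (by
    rw [fres_glueA, fres_glueB, glueA_eq _ _ _ (inf_le_right.trans inf_le_right),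
      Fin.sum_univ_two, h0, h1, fres_one, fres_zero, one_mul, zero_mul, add_zero])

section

variable {M : Matrix (Fin 2) (Fin 2) Γ(X, A ⊓ B)} {h0 : M 0 0 = 1} {h1 : M 0 1 = 0}
  {V V' : X.Opens}

theorem fres_glueFstFn_left (s : Γ(glue M, V)) (h : V' ≤ V) (h' : V' ≤ A) :
    fres h (glueFstFn hAB h0 h1 s) = glueA s h h' 0 := by
  rw [glueFstFn, fres_glueFn_left _ _ _ _ _ h', fres_glueA]

theorem fres_glueFstFn_right (s : Γ(glue M, V)) (h : V' ≤ V) (h' : V' ≤ B) :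
    fres h (glueFstFn hAB h0 h1 s) = glueB s h h' 0 := by
  rw [glueFstFn, fres_glueFn_right _ _ _ _ _ h', fres_glueB]

theorem glueFstFn_ext {s : Γ(glue M, V)} {f : Γ(X, V)}
    (h : glueA s (inf_le_left : V ⊓ A ≤ V) inf_le_right 0 = fres inf_le_left f)
    (h' : glueB s (inf_le_left : V ⊓ B ≤ V) inf_le_right 0 = fres inf_le_left f) :
    glueFstFn hAB h0 h1 s = f :=
  fn_ext_cover hAB (by rw [fres_glueFstFn_left hAB _ _ inf_le_right, h])
    (by rw [fres_glueFstFn_right hAB _ _ inf_le_right, h'])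

theorem glueFstFn_add (s t : Γ(glue M, V)) :
    glueFstFn hAB h0 h1 (s + t) = glueFstFn hAB h0 h1 s + glueFstFn hAB h0 h1 t :=
  glueFstFn_ext hAB
    (by rw [fres_add, fres_glueFstFn_left hAB _ _ inf_le_right,
      fres_glueFstFn_left hAB _ _ inf_le_right, glueA_add])
    (by rw [fres_add, fres_glueFstFn_right hAB _ _ inf_le_right,
      fres_glueFstFn_right hAB _ _ inf_le_right, glueB_add])

theorem glueFstFn_smul (f : Γ(X, V)) (s : Γ(glue M, V)) :
    glueFstFn hAB h0 h1 (f • s) = f * glueFstFn hAB h0 h1 s :=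
  glueFstFn_ext hAB
    (by rw [fres_mul, fres_glueFstFn_left hAB _ _ inf_le_right, glueA_smul])
    (by rw [fres_mul, fres_glueFstFn_right hAB _ _ inf_le_right, glueB_smul])

theorem fres_glueFstFn (h : V' ≤ V) (s : Γ(glue M, V)) :
    fres h (glueFstFn hAB h0 h1 s) = glueFstFn hAB h0 h1 (res (glue M) h s) :=
  (glueFstFn_ext hAB
    (by rw [fres_fres, fres_glueFstFn_left hAB _ _ inf_le_right, glueA_res])
    (by rw [fres_fres, fres_glueFstFn_right hAB _ _ inf_le_right, glueB_res])).symm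

variable (M h0 h1) in
/-- The first coordinate on a bundle glued by a matrix whose first row is `(1, 0)`. -/
def glueFst : glue M ⟶ OMod X :=
  homMk (N := OMod X)
    (fun _ =>
      { toFun := fun s => glueFstFn hAB h0 h1 s
        map_add' := fun s t => glueFstFn_add hAB s t
        map_smul' := fun f s => glueFstFn_smul hAB f s })
    (fun h s => fres_glueFstFn (h0 := h0) (h1 := h1) hAB h s)

theorem fres_glueFst_left (s : Γ(glue M, V)) (h : V' ≤ V) (h' : V' ≤ A) :
    fres h (toFn (glueFst hAB M h0 h1) V s) = glueA s h h' 0 :=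
  fres_glueFstFn_left (h0 := h0) (h1 := h1) hAB s h h'

theorem fres_glueFst_right (s : Γ(glue M, V)) (h : V' ≤ V) (h' : V' ≤ B) :
    fres h (toFn (glueFst hAB M h0 h1) V s) = glueB s h h' 0 :=
  fres_glueFstFn_right (h0 := h0) (h1 := h1) hAB s h h'

end

/-- The determinant form on a bundle glued by a matrix with determinant `1`. -/
def glueForm (M : Matrix (Fin 2) (Fin 2) Γ(X, A ⊓ B)) (hM : M 0 0 * M 1 1 - M 0 1 * M 1 0 = 1)
    {V : X.Opens} (s t : Γ(glue M, V)) : Γ(X, V) :=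
  glueFn hAB
    (glueA s inf_le_left inf_le_right 0 * glueA t inf_le_left inf_le_right 1 -
      glueA s inf_le_left inf_le_right 1 * glueA t inf_le_left inf_le_right 0)
    (glueB s inf_le_left inf_le_right 0 * glueB t inf_le_left inf_le_right 1 -
      glueB s inf_le_left inf_le_right 1 * glueB t inf_le_left inf_le_right 0) (by
    simp only [fres_sub, fres_mul, fres_glueA, fres_glueB]
    simp only [glueA_eq _ _ _ (inf_le_right.trans inf_le_right), Fin.sum_univ_two]
    -- The determinant in `A`-coordinates is `det M` times the one in `B`-coordinates.
    have := congrArg (fres (inf_le_right : V ⊓ (A ⊓ B) ≤ A ⊓ B)) hM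
    simp only [fres_sub, fres_mul, fres_one] at this
    linear_combination (glueB s (inf_le_left : V ⊓ (A ⊓ B) ≤ V) (inf_le_right.trans inf_le_right) 0 *
      glueB t inf_le_left (inf_le_right.trans inf_le_right) 1 -
        glueB s inf_le_left (inf_le_right.trans inf_le_right) 1 *
          glueB t inf_le_left (inf_le_right.trans inf_le_right) 0) * this)

theorem fres_glueForm_left {M : Matrix (Fin 2) (Fin 2) Γ(X, A ⊓ B)} {hM} {V V' : X.Opens}
    (s t : Γ(glue M, V)) (h : V' ≤ V) (h' : V' ≤ A) : fres h (glueForm hAB M hM s t) =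
      glueA s h h' 0 * glueA t h h' 1 - glueA s h h' 1 * glueA t h h' 0 := by
  rw [glueForm, fres_glueFn_left _ _ _ _ _ h']
  simp only [fres_sub, fres_mul, fres_glueA]

theorem fres_glueForm_right {M : Matrix (Fin 2) (Fin 2) Γ(X, A ⊓ B)} {hM} {V V' : X.Opens}
    (s t : Γ(glue M, V)) (h : V' ≤ V) (h' : V' ≤ B) : fres h (glueForm hAB M hM s t) =
      glueB s h h' 0 * glueB t h h' 1 - glueB s h h' 1 * glueB t h h' 0 := by
  rw [glueForm, fres_glueFn_right _ _ _ _ _ h']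
  simp only [fres_sub, fres_mul, fres_glueB]

theorem glueForm_ext {M : Matrix (Fin 2) (Fin 2) Γ(X, A ⊓ B)} {hM} {V : X.Opens}
    {s t : Γ(glue M, V)} {f : Γ(X, V)}
    (h : glueA s (inf_le_left : V ⊓ A ≤ V) inf_le_right 0 * glueA t inf_le_left inf_le_right 1 -
      glueA s inf_le_left inf_le_right 1 * glueA t inf_le_left inf_le_right 0 = fres inf_le_left f)
    (h' : glueB s (inf_le_left : V ⊓ B ≤ V) inf_le_right 0 * glueB t inf_le_left inf_le_right 1 -
      glueB s inf_le_left inf_le_right 1 * glueB t inf_le_left inf_le_right 0 =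
        fres inf_le_left f) : glueForm hAB M hM s t = f :=
  fn_ext_cover hAB (by rw [fres_glueForm_left hAB _ _ _ inf_le_right, h])
    (by rw [fres_glueForm_right hAB _ _ _ inf_le_right, h'])

section

variable {M : Matrix (Fin 2) (Fin 2) Γ(X, A ⊓ B)} {hM : M 0 0 * M 1 1 - M 0 1 * M 1 0 = 1}
  {V V' : X.Opens}

theorem glueForm_swap (s t : Γ(glue M, V)) : glueForm hAB M hM s t = -glueForm hAB M hM t s :=
  glueForm_ext hAB
    (by
      rw [fres_neg, fres_glueForm_left hAB _ _ _ inf_le_right]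
      ring)
    (by
      rw [fres_neg, fres_glueForm_right hAB _ _ _ inf_le_right]
      ring)

theorem glueForm_add_left (s s' t : Γ(glue M, V)) :
    glueForm hAB M hM (s + s') t = glueForm hAB M hM s t + glueForm hAB M hM s' t :=
  glueForm_ext hAB
    (by
      rw [fres_add, fres_glueForm_left hAB _ _ _ inf_le_right,
        fres_glueForm_left hAB _ _ _ inf_le_right, glueA_add, glueA_add]
      ring)
    (by
      rw [fres_add, fres_glueForm_right hAB _ _ _ inf_le_right,
        fres_glueForm_right hAB _ _ _ inf_le_right, glueB_add, glueB_add]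
      ring)

theorem glueForm_smul_left (f : Γ(X, V)) (s t : Γ(glue M, V)) :
    glueForm hAB M hM (f • s) t = f * glueForm hAB M hM s t :=
  glueForm_ext hAB
    (by
      rw [fres_mul, fres_glueForm_left hAB _ _ _ inf_le_right, glueA_smul, glueA_smul]
      ring)
    (by
      rw [fres_mul, fres_glueForm_right hAB _ _ _ inf_le_right, glueB_smul, glueB_smul]
      ring)

theorem fres_glueForm (h : V' ≤ V) (s t : Γ(glue M, V)) :
    fres h (glueForm hAB M hM s t) =
      glueForm hAB M hM (res (glue M) h s) (res (glue M) h t) :=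
  (glueForm_ext hAB
    (by rw [fres_fres, fres_glueForm_left hAB _ _ _ inf_le_right]; simp only [glueA_res])
    (by rw [fres_fres, fres_glueForm_right hAB _ _ _ inf_le_right]; simp only [glueB_res])).symm

theorem glueForm_eq_left (s t : Γ(glue M, V)) (h : V ≤ A) : glueForm hAB M hM s t =
    glueA s le_rfl h 0 * glueA t le_rfl h 1 - glueA s le_rfl h 1 * glueA t le_rfl h 0 := by
  rw [← fres_glueForm_left hAB, fres_self]

theorem glueForm_eq_right (s t : Γ(glue M, V)) (h : V ≤ B) : glueForm hAB M hM s t =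
    glueB s le_rfl h 0 * glueB t le_rfl h 1 - glueB s le_rfl h 1 * glueB t le_rfl h 0 := by
  rw [← fres_glueForm_right hAB, fres_self]

end

/-- A bundle glued by a matrix with determinant `1` has a trivialised determinant. -/
def glueSL2 (M M' : Matrix (Fin 2) (Fin 2) Γ(X, A ⊓ B)) (hMM : M * M' = 1)
    (hM : M 0 0 * M 1 1 - M 0 1 * M 1 0 = 1) : SL2Structure (glue M) where
  form V := LinearMap.mk₂ _ (fun s t => glueForm hAB M hM s t)
    (fun s s' t => glueForm_add_left hAB s s' t)
    (fun f s t => glueForm_smul_left hAB f s t)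
    (fun s t t' => by
      rw [glueForm_swap, glueForm_add_left, glueForm_swap hAB s t, glueForm_swap hAB s t', neg_add])
    (fun f s t => by
      rw [glueForm_swap, glueForm_smul_left, glueForm_swap hAB s t, smul_eq_mul, mul_neg])
  form_self _ s := glueForm_ext (hM := hM) hAB (by rw [fres_zero]; ring) (by rw [fres_zero]; ring)
  form_res h s t := fres_glueForm (hM := hM) hAB h s t
  exists_frame z := by
    have hz : z ∈ A ⊔ B := hAB ▸ TopologicalSpace.Opens.mem_top z
    rcases hz with hz | hz
    · obtain ⟨e, he, hc⟩ := exists_frame_glueA hMM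
      refine ⟨A, hz, e, he, (glueForm_eq_left (hM := hM) hAB (e 0) (e 1) le_rfl).trans ?_⟩
      simp [hc]
    · obtain ⟨e, he, hc⟩ := exists_frame_glueB (M := M)
      refine ⟨B, hz, e, he, (glueForm_eq_right (hM := hM) hAB (e 0) (e 1) le_rfl).trans ?_⟩
      simp [hc]

theorem glueSL2_form {M M' : Matrix (Fin 2) (Fin 2) Γ(X, A ⊓ B)} (hMM : M * M' = 1)
    (hM : M 0 0 * M 1 1 - M 0 1 * M 1 0 = 1) {V : X.Opens} (s t : Γ(glue M, V)) :
    (glueSL2 hAB M M' hMM hM).form V s t = glueForm hAB M hM s t := rfl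

theorem inf_le_preimage_inf {X' : Scheme.{u}} (F : X' ⟶ X) {U V : X.Opens} {U' V' : X'.Opens}
    (hU : U' ≤ F ⁻¹ᵁ U) (hV : V' ≤ F ⁻¹ᵁ V) : U' ⊓ V' ≤ F ⁻¹ᵁ (U ⊓ V) :=
  fun _ h => ⟨hU h.1, hV h.2⟩

theorem le_preimage_inf {X' : Scheme.{u}} (F : X' ⟶ X) {U V : X.Opens} {U' : X'.Opens}
    (hU : U' ≤ F ⁻¹ᵁ U) (hV : U' ≤ F ⁻¹ᵁ V) : U' ≤ F ⁻¹ᵁ (U ⊓ V) :=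
  fun _ h => ⟨hU h, hV h⟩

section

variable {X' : Scheme.{u}} (F : X' ⟶ X) {A' B' : X'.Opens} (hA : A' ≤ F ⁻¹ᵁ A)
  (hB : B' ≤ F ⁻¹ᵁ B) (M : Matrix (Fin r) (Fin r) Γ(X, A ⊓ B))
  (M' : Matrix (Fin r) (Fin r) Γ(X', A' ⊓ B'))
  (hM : ∀ i j, M' i j = pull F (inf_le_preimage_inf F hA hB) (M i j))

/-- Pullback of a section of a glued bundle. -/
def gluePull {V : X.Opens} (s : Γ(glue M, V)) : Γ(glue M', F ⁻¹ᵁ V) :=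
  glueMk
    (fun i => pull F (inf_le_preimage_inf F le_rfl hA)
      (glueA s (inf_le_left : V ⊓ A ≤ V) inf_le_right i))
    (fun i => pull F (inf_le_preimage_inf F le_rfl hB)
      (glueB s (inf_le_left : V ⊓ B ≤ V) inf_le_right i))
    (fun i => by
      have k : F ⁻¹ᵁ V ⊓ (A' ⊓ B') ≤ F ⁻¹ᵁ (V ⊓ (A ⊓ B)) :=
        inf_le_preimage_inf F le_rfl (inf_le_preimage_inf F hA hB)
      have h1 := congrArg (pull F k)
        (glueA_eq s (inf_le_left : V ⊓ (A ⊓ B) ≤ V) (inf_le_right.trans inf_le_left)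
        (inf_le_right.trans inf_le_right) i)
      rw [map_sum] at h1
      simp only [map_mul, pull_fres] at h1
      rw [← fres_glueA s inf_le_left inf_le_right
        (le_inf inf_le_left (inf_le_right.trans inf_le_left)), pull_fres] at h1
      simp only [← fres_glueB s inf_le_left inf_le_right
        (le_inf inf_le_left (inf_le_right.trans inf_le_right)), pull_fres] at h1
      simp only [fres_pull, hM]
      exact h1)

variable {V : X.Opens} {V' : X'.Opens}

theorem glueA_gluePull (s : Γ(glue M, V)) (h : V' ≤ F ⁻¹ᵁ V) (h' : V' ≤ A') (i : Fin r) :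
    glueA (gluePull F hA hB M M' hM s) h h' i = pull F (le_preimage_inf F h (h'.trans hA))
      (glueA s (inf_le_left : V ⊓ A ≤ V) inf_le_right i) := by
  rw [gluePull, glueA_glueMk, fres_pull]

theorem glueB_gluePull (s : Γ(glue M, V)) (h : V' ≤ F ⁻¹ᵁ V) (h' : V' ≤ B') (i : Fin r) :
    glueB (gluePull F hA hB M M' hM s) h h' i = pull F (le_preimage_inf F h (h'.trans hB))
      (glueB s (inf_le_left : V ⊓ B ≤ V) inf_le_right i) := by
  rw [gluePull, glueB_glueMk, fres_pull]

theorem gluePull_add (s t : Γ(glue M, V)) : gluePull F hA hB M M' hM (s + t) =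
    gluePull F hA hB M M' hM s + gluePull F hA hB M M' hM t :=
  glue_ext
    (fun i => by rw [glueA_add, glueA_gluePull, glueA_gluePull, glueA_gluePull, glueA_add, map_add])
    (fun i => by rw [glueB_add, glueB_gluePull, glueB_gluePull, glueB_gluePull, glueB_add, map_add])

theorem gluePull_smul (f : Γ(X, V)) (s : Γ(glue M, V)) : gluePull F hA hB M M' hM (f • s) =
    F.app V f • gluePull F hA hB M M' hM s :=
  glue_ext
    (fun i => by
      rw [glueA_smul, glueA_gluePull, glueA_gluePull, glueA_smul, map_mul, pull_fres,
        ← pull_eq_app, fres_pull])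
    (fun i => by
      rw [glueB_smul, glueB_gluePull, glueB_gluePull, glueB_smul, map_mul, pull_fres,
        ← pull_eq_app, fres_pull])

theorem res_gluePull {U : X.Opens} (h : V ≤ U) (s : Γ(glue M, U)) :
    res (glue M') (F.preimage_mono h) (gluePull F hA hB M M' hM s) =
      gluePull F hA hB M M' hM (res (glue M) h s) :=
  glue_ext
    (fun i => by
      rw [glueA_res, glueA_gluePull, glueA_gluePull, glueA_res,
        ← fres_glueA s inf_le_left inf_le_right (inf_le_inf_right A h), pull_fres])
    (fun i => by
      rw [glueB_res, glueB_gluePull, glueB_gluePull, glueB_res,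
        ← fres_glueB s inf_le_left inf_le_right (inf_le_inf_right B h), pull_fres])

/-- Pullback of sections of glued bundles. -/
def gluePush : glue M ⟶ (Scheme.Modules.pushforward F).obj (glue M') :=
  homMkPushforward F
    (fun _ => AddMonoidHom.mk' (fun s => gluePull F hA hB M M' hM s)
      fun s t => gluePull_add F hA hB M M' hM s t)
    (fun _ f s => gluePull_smul F hA hB M M' hM f s)
    (fun h s => res_gluePull F hA hB M M' hM h s)

end

end GlueMaps

end

end PicardLefschetz

/-! ### Taylor expansion along a section of a relative curve -/

namespace PicardLefschetz
noncomputable section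

/-- The scheme `W` over `S` is covered by `A` and `B`, the complement of `A` is a section `σ`, and
`T` is a function on `B` which is a relative local coordinate along `σ`. -/
structure SectionCoord {W S : Scheme.{u}} (π : W ⟶ S) (σ : S ⟶ W) (A B : W.Opens)
    (T : Γ(W, B)) : Prop where
  sec_proj : σ ≫ π = 𝟙 S
  cover : A ⊔ B = ⊤
  unit : IsUnit (fres (inf_le_right : A ⊓ B ≤ B) T)
  notMem : ∀ y : S, σ y ∉ A
  exists_sec : ∀ z : W, z ∉ A → ∃ y, σ y = z
  pull_sec : ∀ {N : S.Opens} (h : N ≤ σ ⁻¹ᵁ B), pull σ h T = 0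
  regular : ∀ {V : W.Opens} (h : V ≤ B) (f : Γ(W, V)), fres h T * f = 0 → f = 0
  dvd : ∀ {V : W.Opens} (h : V ≤ B) (f : Γ(W, V)), pull σ (le_refl (σ ⁻¹ᵁ V)) f = 0 →
    ∃ g, f = fres h T * g

theorem le_preimage_top {X X' : Scheme.{u}} (F : X' ⟶ X) {V : X'.Opens} : V ≤ F ⁻¹ᵁ ⊤ := fun _ _ => trivial

/-- The polynomial in `τ` with coefficients `c` coming from the base. -/
def poly {W S : Scheme.{u}} (π : W ⟶ S) {N : S.Opens} {V : W.Opens} (h : V ≤ π ⁻¹ᵁ N)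
    (τ : Γ(W, V)) {n : ℕ} (c : Fin n → Γ(S, N)) : Γ(W, V) :=
  ∑ i, pull π h (c i) * τ ^ (i : ℕ)

section

variable {W S : Scheme.{u}} {π : W ⟶ S} {N N' : S.Opens} {V V' : W.Opens} {n : ℕ}

/-- The Horner step that drives the inductions on the number of coefficients. -/
theorem poly_succ (h : V ≤ π ⁻¹ᵁ N) (τ : Γ(W, V)) (c : Fin (n + 1) → Γ(S, N)) :
    poly π h τ c = pull π h (c 0) + τ * poly π h τ (fun i => c i.succ) := by
  simp only [poly, Fin.sum_univ_succ, Finset.mul_sum, Fin.val_zero, pow_zero, mul_one,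
    Fin.val_succ, pow_succ]
  congr 1
  exact Finset.sum_congr rfl fun i _ => by ring

theorem fres_poly (h : V ≤ π ⁻¹ᵁ N) (h' : V' ≤ V) (τ : Γ(W, V)) (c : Fin n → Γ(S, N)) :
    fres h' (poly π h τ c) = poly π (h'.trans h) (fres h' τ) c := by
  simp only [poly, fres_sum, fres_mul, fres_pow, fres_pull]

theorem poly_fres (h : V ≤ π ⁻¹ᵁ N') (h' : N' ≤ N) (τ : Γ(W, V)) (c : Fin n → Γ(S, N)) :
    poly π h τ (fun i => fres h' (c i)) = poly π (h.trans (π.preimage_mono h')) τ c := by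
  simp only [poly, pull_fres]

theorem poly_sub (h : V ≤ π ⁻¹ᵁ N) (τ : Γ(W, V)) (c c' : Fin n → Γ(S, N)) :
    poly π h τ (fun i => c i - c' i) = poly π h τ c - poly π h τ c' := by
  simp only [poly, map_sub, sub_mul, Finset.sum_sub_distrib]

theorem pull_poly {W' S' : Scheme.{u}} {π' : W' ⟶ S'} (F : W' ⟶ W) (f : S' ⟶ S)
    (e : F ≫ π = π' ≫ f) {V' : W'.Opens} {N' : S'.Opens} (h : V ≤ π ⁻¹ᵁ N) (hV : V' ≤ F ⁻¹ᵁ V)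
    (hN : N' ≤ f ⁻¹ᵁ N) (h' : V' ≤ π' ⁻¹ᵁ N') (τ : Γ(W, V)) (c : Fin n → Γ(S, N)) :
    pull F hV (poly π h τ c) = poly π' h' (pull F hV τ) (fun i => pull f hN (c i)) := by
  simp only [poly, map_sum, map_mul, map_pow, pull_pull]
  exact Finset.sum_congr rfl fun i _ => by rw [pull_congr e]

end

namespace SectionCoord

variable {W S : Scheme.{u}} {π : W ⟶ S} {σ : S ⟶ W} {A B : W.Opens} {T : Γ(W, B)}
  (H : SectionCoord π σ A B T) {N N' : S.Opens} {V V' : W.Opens} {n : ℕ}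
include H

theorem mem (y : S) : σ y ∈ B := by
  have : σ y ∈ A ⊔ B := by rw [H.cover]; trivial
  exact this.resolve_left (H.notMem y)

theorem mem_or (z : W) : z ∈ A ∨ ∃ y, σ y = z := by
  by_cases hz : z ∈ A
  exacts [.inl hz, .inr (H.exists_sec z hz)]

theorem proj_sec (y : S) : π (σ y) = y := by
  rw [← Scheme.Hom.comp_apply, H.sec_proj]
  rfl

theorem preimage_eq : σ ⁻¹ᵁ (π ⁻¹ᵁ N) = N := by
  rw [← Scheme.Hom.comp_preimage, H.sec_proj]
  rfl

theorem isUnit (hA : V ≤ A) (hB : V ≤ B) : IsUnit (fres hB T) := by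
  have := H.unit.map (fresHom (le_inf hA hB))
  rwa [fresHom_apply, fres_fres] at this

theorem mul_cancel (h : V ≤ B) {f g : Γ(W, V)} (e : fres h T * f = fres h T * g) : f = g :=
  sub_eq_zero.mp (H.regular h _ (by rw [mul_sub, e, sub_self]))

theorem pow_mul_cancel (h : V ≤ B) (n : ℕ) {f g : Γ(W, V)}
    (e : fres h T ^ n * f = fres h T ^ n * g) : f = g := by
  induction n with
  | zero => simpa using e
  | succ n ih => exact ih (H.mul_cancel h (by rw [← mul_assoc, ← mul_assoc, ← pow_succ', e]))

theorem pull_sec_proj (h : V ≤ π ⁻¹ᵁ N) (h' : N' ≤ σ ⁻¹ᵁ V) (hN : N' ≤ N) (c : Γ(S, N)) :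
    pull σ h' (pull π h c) = fres hN c := by
  rw [pull_pull, pull_congr H.sec_proj _ (show N' ≤ (𝟙 S : S ⟶ S) ⁻¹ᵁ N from hN)]
  exact pull_id hN c

/-- The function minus its value on the section vanishes there, hence is divisible by `T`; iterating
on the quotient gives the Taylor expansion with remainder. -/
theorem exists_poly (h : V ≤ π ⁻¹ᵁ N) (h' : N ≤ σ ⁻¹ᵁ V) (hB : V ≤ B) (n : ℕ) (f : Γ(W, V)) :
    ∃ (c : Fin n → Γ(S, N)) (r : Γ(W, V)), f = poly π h (fres hB T) c + fres hB T ^ n * r := by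
  induction n generalizing f with
  | zero => exact ⟨Fin.elim0, f, by simp [poly]⟩
  | succ n ih =>
    obtain ⟨g, hg⟩ := H.dvd hB (f - pull π h (pull σ h' f)) (by
      have hN : σ ⁻¹ᵁ V ≤ N := (σ.preimage_mono h).trans H.preimage_eq.le
      rw [map_sub, H.pull_sec_proj h le_rfl hN, fres_pull, sub_self])
    obtain ⟨c, r, hc⟩ := ih g
    refine ⟨Fin.cons (pull σ h' f) c, r, ?_⟩
    rw [poly_succ]
    simp only [Fin.cons_zero, Fin.cons_succ]
    rw [add_assoc, pow_succ', mul_assoc, ← mul_add, ← hc, ← hg, add_sub_cancel]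

theorem pull_sec_poly (h : V ≤ π ⁻¹ᵁ N) (h' : N' ≤ σ ⁻¹ᵁ V) (hN : N' ≤ N) (hB : V ≤ B)
    (c : Fin (n + 1) → Γ(S, N)) : pull σ h' (poly π h (fres hB T) c) = fres hN (c 0) := by
  rw [poly_succ, map_add, map_mul, H.pull_sec_proj _ _ hN, pull_fres, H.pull_sec, zero_mul,
    add_zero]

/-- Restriction to the section kills `T` and isolates the constant coefficient; afterwards one
factor `T`, which is regular, is cancelled. -/
theorem eq_zero_of_poly_eq (h : V ≤ π ⁻¹ᵁ N) (h' : N ≤ σ ⁻¹ᵁ V) (hB : V ≤ B)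
    (c : Fin n → Γ(S, N)) (r : Γ(W, V)) (e : poly π h (fres hB T) c = fres hB T ^ n * r)
    (i : Fin n) : c i = 0 := by
  induction n with
  | zero => exact i.elim0
  | succ n ih =>
    have h0 : c 0 = 0 := by
      have := congrArg (pull σ h') e
      rwa [H.pull_sec_poly h h' le_rfl, fres_self, map_mul, map_pow, pull_fres, H.pull_sec,
        zero_pow n.succ_ne_zero, zero_mul] at this
    refine Fin.cases h0 (ih (fun i => c i.succ) ?_) i
    rw [poly_succ, h0, map_zero, zero_add, pow_succ', mul_assoc] at e
    exact H.mul_cancel hB e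

theorem poly_unique (h : V ≤ π ⁻¹ᵁ N) (h' : N ≤ σ ⁻¹ᵁ V) (hB : V ≤ B)
    {c c' : Fin n → Γ(S, N)} {r : Γ(W, V)}
    (e : poly π h (fres hB T) c = poly π h (fres hB T) c' + fres hB T ^ n * r) : c = c' :=
  funext fun i => sub_eq_zero.mp <|
    H.eq_zero_of_poly_eq h h' hB (fun i => c i - c' i) r (by rw [poly_sub, e]; ring) i

/-- Near a point of the section, an open set may be shrunk to one lying over its trace on the
base. -/
theorem exists_shrink {y : S} (hy : σ y ∈ V) (hN : y ∈ N) : ∃ (N' : S.Opens) (V' : W.Opens),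
    y ∈ N' ∧ N' ≤ N ∧ V' ≤ V ∧ σ y ∈ V' ∧ V' ≤ π ⁻¹ᵁ N' ∧ N' ≤ σ ⁻¹ᵁ V' := by
  refine ⟨σ ⁻¹ᵁ V ⊓ N, V ⊓ π ⁻¹ᵁ (σ ⁻¹ᵁ V ⊓ N), ⟨hy, hN⟩, inf_le_right, inf_le_left, ⟨hy, ?_⟩,
    inf_le_right, fun x hx => ⟨hx.1, ?_⟩⟩
  · change π (σ y) ∈ σ ⁻¹ᵁ V ⊓ N
    rw [H.proj_sec]
    exact ⟨hy, hN⟩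
  · change π (σ x) ∈ σ ⁻¹ᵁ V ⊓ N
    rw [H.proj_sec]
    exact hx

/-- Divisibility by a power of `T` may be checked near the section. -/
theorem exists_eq_pow_mul (hB : V ≤ B) (f : Γ(W, V)) (n : ℕ)
    (hf : ∀ y, σ y ∈ V → ∃ (V' : W.Opens) (hV : V' ≤ V) (_ : σ y ∈ V') (g : Γ(W, V')),
      fres hV f = fres (hV.trans hB) T ^ n * g) : ∃ g, f = fres hB T ^ n * g := by
  obtain ⟨g, hg⟩ := exists_function_of_locally
    (fun V' hV g => fres hV f = fres (hV.trans hB) T ^ n * g)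
    (fun hV h g e => by
      have := congrArg (fres h) e
      rwa [fres_fres, fres_mul, fres_pow, fres_fres] at this)
    (fun hV s t hs ht => H.pow_mul_cancel (hV.trans hB) n (hs.symm.trans ht))
    (fun z hz => by
      -- Off the section `T` is invertible and divisibility is automatic. The local quotients are
      -- unique because `T` is regular.
      rcases H.mem_or z with hA | ⟨y, rfl⟩
      · refine ⟨V ⊓ A, inf_le_left, ⟨hz, hA⟩, ?_⟩
        obtain ⟨g, hg⟩ :=
          ((H.isUnit (inf_le_right : V ⊓ A ≤ A) (inf_le_left.trans hB)).pow n).dvd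
        exact ⟨g, hg⟩
      · obtain ⟨V', hV, hy, g, hg⟩ := hf y hz
        exact ⟨V', hV, hy, g, hg⟩)
  refine ⟨g, fn_ext fun z hz => ?_⟩
  obtain ⟨V', hV, hz', e⟩ := hg z hz
  exact ⟨V', hV, hz', by rw [e, fres_mul, fres_pow, fres_fres]⟩

end SectionCoord

end
end PicardLefschetz

/-! ### Adapted frames and the normalisation of `L` -/

namespace PicardLefschetz
noncomputable section

theorem exists_functions_of_locally {X : Scheme.{u}} {U : X.Opens} {ι : Type*}
    (P : ∀ V : X.Opens, V ≤ U → (ι → Γ(X, V)) → Prop)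
    (hres : ∀ {V V' : X.Opens} (hV : V ≤ U) (h : V' ≤ V) (s : ι → Γ(X, V)), P V hV s →
      P V' (h.trans hV) (fun i => fres h (s i)))
    (huniq : ∀ {V : X.Opens} (hV : V ≤ U) (s t : ι → Γ(X, V)), P V hV s → P V hV t → s = t)
    (hex : ∀ z ∈ U, ∃ (V : X.Opens) (hV : V ≤ U), z ∈ V ∧ ∃ s : ι → Γ(X, V), P V hV s) :
    ∃ s : ι → Γ(X, U), ∀ z ∈ U, ∃ (V : X.Opens) (hV : V ≤ U), z ∈ V ∧
      P V hV (fun i => fres hV (s i)) := by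
  -- Since `P` constrains the whole family, each member is glued under the property of extending to
  -- a family satisfying `P`.
  have key : ∀ i, ∃ f : Γ(X, U), ∀ z ∈ U, ∃ (V : X.Opens) (hV : V ≤ U), z ∈ V ∧
      ∃ s, P V hV s ∧ s i = fres hV f := fun i =>
    exists_function_of_locally (fun V hV f => ∃ s, P V hV s ∧ s i = f)
      (fun hV h f ⟨s, hs, e⟩ => ⟨_, hres hV h s hs, by rw [← e]⟩)
      (fun hV f g ⟨s, hs, e⟩ ⟨t, ht, e'⟩ => by rw [← e, ← e', huniq hV s t hs ht])
      (fun z hz => by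
        obtain ⟨V, hV, hz', s, hs⟩ := hex z hz
        exact ⟨V, hV, hz', s i, s, hs, rfl⟩)
  choose f hf using key
  refine ⟨f, fun z hz => ?_⟩
  obtain ⟨V, hV, hz', s, hs⟩ := hex z hz
  have : s = fun i => fres hV (f i) := by
    refine funext fun i => fn_ext fun z' hz' => ?_
    obtain ⟨V', hV', hz'', s', hs', e⟩ := hf i z' (hV hz')
    refine ⟨V ⊓ V', inf_le_left, ⟨hz', hz''⟩, ?_⟩
    have h1 := hres hV (inf_le_left : V ⊓ V' ≤ V) s hs
    have h2 := hres hV' (inf_le_right : V ⊓ V' ≤ V') s' hs'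
    have h3 := congrFun (huniq _ _ _ h1 h2) i
    simp only [e, fres_fres] at h3 ⊢
    exact h3
  exact ⟨V, hV, hz', this ▸ hs⟩

namespace LocalModel

variable {B₀ : Scheme.{u}} {n : ℕ} {X S : Over B₀}

/-- The frames `(g l, q)` and `(e, w)` over `V` put `φ` into the normal form
`φ (g l) = τⁿ e - α w`, `φ q = β e + ⋯`. -/
structure AdaptedFrame (ξ : LocalModel n X S) (V : (prod X S).Opens) (τ : Γ(prod X S, V))
    (l : Γ(ξ.L, V)) (q : Γ(ξ.E₁, V)) (e w : Γ(ξ.E₂, V)) (α β : Γ(prod X S, V)) : Prop where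
  comp_l : toFn ξ.comp V l = τ ^ n
  form_q : ξ.vol₁.form V (ξ.g.app V l) q = 1
  h_q : toFn ξ.h V (ξ.φ.app V q) = β
  h_e : toFn ξ.h V e = 1
  h_w : toFn ξ.h V w = 0
  form_w : ξ.vol₂.form V e w = 1
  eq : τ ^ n • e = ξ.φ.app V (ξ.g.app V l) + α • w

variable {ξ : LocalModel n X S} {V V' : (prod X S).Opens} {τ : Γ(prod X S, V)}
    {l l' : Γ(ξ.L, V)} {q q' : Γ(ξ.E₁, V)} {e w e' w' : Γ(ξ.E₂, V)} {α β α' β' : Γ(prod X S, V)}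

theorem toFn_comp_eq (l : Γ(ξ.L, V)) :
    toFn ξ.comp V l = toFn ξ.h V (ξ.φ.app V (ξ.g.app V l)) := rfl

namespace AdaptedFrame

theorem restrict (F : ξ.AdaptedFrame V τ l q e w α β) (h : V' ≤ V) :
    ξ.AdaptedFrame V' (fres h τ) (res _ h l) (res _ h q) (res _ h e) (res _ h w) (fres h α)
      (fres h β) where
  comp_l := by rw [← fres_toFn, F.comp_l, fres_pow]
  form_q := by rw [← res_app, ← ξ.vol₁.form_res, F.form_q, fres_one]
  h_q := by rw [← res_app, ← fres_toFn, F.h_q]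
  h_e := by rw [← fres_toFn, F.h_e, fres_one]
  h_w := by rw [← fres_toFn, F.h_w, fres_zero]
  form_w := by rw [← ξ.vol₂.form_res, F.form_w, fres_one]
  eq := by rw [← fres_pow, ← res_smul, F.eq, res_add, res_smul, res_app, res_app]

/-- Both functionals take the values `1` on `e` and `0` on `w`. -/
theorem h_eq (F : ξ.AdaptedFrame V τ l q e w α β) (s : Γ(ξ.E₂, V)) :
    toFn ξ.h V s = ξ.vol₂.form V s w := by
  conv_lhs => rw [ξ.vol₂.eq_of_form_eq_one F.form_w s]
  rw [map_add, map_smul, map_smul, F.h_e, F.h_w, smul_zero, add_zero, smul_eq_mul, mul_one]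

theorem hφ_eq (F : ξ.AdaptedFrame V τ l q e w α β) (s : Γ(ξ.E₁, V)) :
    toFn ξ.h V (ξ.φ.app V s) =
      τ ^ n * ξ.vol₁.form V s q + β * ξ.vol₁.form V (ξ.g.app V l) s := by
  conv_lhs => rw [ξ.vol₁.eq_of_form_eq_one F.form_q s]
  rw [app_add, app_smul, app_smul, map_add, map_smul, map_smul, F.h_q, ← toFn_comp_eq, F.comp_l,
    smul_eq_mul, smul_eq_mul]
  ring

/-- The freedom in choosing the frame. It removes multiples of `τⁿ` from `α` and `β`, which are
thereby truncated to polynomials. -/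
theorem adjust (F : ξ.AdaptedFrame V τ l q e w α β) (r r' : Γ(prod X S, V)) :
    ξ.AdaptedFrame V τ l (q - r • ξ.g.app V l) (e - r' • w) w (α - τ ^ n * r') (β - τ ^ n * r) where
  comp_l := F.comp_l
  form_q := by rw [map_sub, map_smul, F.form_q, ξ.vol₁.form_self, smul_zero, sub_zero]
  h_q := by
    rw [app_sub, app_smul, map_sub, map_smul, F.h_q, ← toFn_comp_eq, F.comp_l, smul_eq_mul,
      mul_comm]
  h_e := by rw [map_sub, map_smul, F.h_e, F.h_w, smul_zero, sub_zero]
  h_w := F.h_w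
  form_w := by
    rw [map_sub, map_smul, LinearMap.sub_apply, LinearMap.smul_apply, F.form_w,
      ξ.vol₂.form_self, smul_zero, sub_zero]
  eq := by rw [smul_sub, F.eq, sub_smul, smul_smul, add_sub_assoc]

/-- The section `w` represents the functional `h` under the volume form, so there is no choice. -/
theorem w_unique (F : ξ.AdaptedFrame V τ l q e w α β)
    (F' : ξ.AdaptedFrame V τ l' q' e' w' α' β') : w = w' := by
  rw [ξ.vol₂.eq_of_form_eq_one F.form_w w', ← F.h_eq, F'.h_w, zero_smul, zero_add, ← F'.h_eq,
    F.h_e, one_smul]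

/-- With `l` fixed, `q` is determined up to multiples of `g l` and `e` up to multiples of `w`. Hence
`β`, and likewise `α` in `exists_eq_left`, is well defined modulo `τⁿ`. -/
theorem exists_eq_right (F : ξ.AdaptedFrame V τ l q e w α β)
    (F' : ξ.AdaptedFrame V τ l q' e' w' α' β') : ∃ r, β' = β + τ ^ n * r := by
  refine ⟨ξ.vol₁.form V q' q, ?_⟩
  rw [← F'.h_q, F.hφ_eq, F'.form_q]
  ring

theorem exists_eq_left (F : ξ.AdaptedFrame V τ l q e w α β)
    (F' : ξ.AdaptedFrame V τ l q' e' w' α' β') : ∃ r, α' = α + τ ^ n * r := by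
  refine ⟨ξ.vol₂.form V e e', ?_⟩
  have h := congrArg (ξ.vol₂.form V e) F'.eq
  have h' := congrArg (ξ.vol₂.form V e) F.eq
  rw [map_add, map_smul, map_smul, ← F.w_unique F', F.form_w] at h
  rw [map_add, map_smul, map_smul, F.form_w, ξ.vol₂.form_self] at h'
  simp only [smul_eq_mul, mul_one, mul_zero] at h h'
  linear_combination h' - h

theorem φ_q (F : ξ.AdaptedFrame V τ l q e w α β) :
    ξ.φ.app V q = β • e + ξ.vol₂.form V e (ξ.φ.app V q) • w := by
  conv_lhs => rw [ξ.vol₂.eq_of_form_eq_one F.form_w (ξ.φ.app V q), ← F.h_eq, F.h_q]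

theorem φ_l (F : ξ.AdaptedFrame V τ l q e w α β) :
    ξ.φ.app V (ξ.g.app V l) = τ ^ n • e - α • w := by
  rw [F.eq, add_sub_cancel_right]

/-- The determinant of the matrix of `φ` with columns `(τⁿ, -α)` and `(β, δ)`, where `δ = vol(e, φ
q)`. -/
theorem form_φ (F : ξ.AdaptedFrame V τ l q e w α β) :
    ξ.vol₂.form V (ξ.φ.app V (ξ.g.app V l)) (ξ.φ.app V q) =
      τ ^ n * ξ.vol₂.form V e (ξ.φ.app V q) + α * β := by
  rw [F.φ_l, map_sub, LinearMap.sub_apply, map_smul, map_smul, LinearMap.smul_apply,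
    LinearMap.smul_apply, ξ.vol₂.form_swap w, ← F.h_eq, F.h_q, smul_eq_mul, smul_eq_mul]
  ring

theorem form_φ_l (F : ξ.AdaptedFrame V τ l q e w α β) (s : Γ(ξ.E₂, V)) :
    ξ.vol₂.form V (ξ.φ.app V (ξ.g.app V l)) s =
      τ ^ n * ξ.vol₂.form V e s + α * toFn ξ.h V s := by
  rw [F.φ_l, map_sub, LinearMap.sub_apply, map_smul, map_smul, LinearMap.smul_apply,
    LinearMap.smul_apply, ξ.vol₂.form_swap w, ← F.h_eq, smul_eq_mul, smul_eq_mul]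
  ring

end AdaptedFrame

/-- The line bundle `L` is identified with the subsheaf `Tⁿ 𝒪` of `𝒪`, with generators `lA` over `A`
and `lB` over `B`. -/
structure Normalized (ξ : LocalModel n X S) {A B : (prod X S).Opens} (T : Γ(prod X S, B))
    (lA : Γ(ξ.L, A)) (lB : Γ(ξ.L, B)) : Prop where
  inj (V : (prod X S).Opens) : Function.Injective (toFn ξ.comp V)
  comp_lA : toFn ξ.comp A lA = 1
  comp_lB : toFn ξ.comp B lB = T ^ n
  dvd {V : (prod X S).Opens} (hV : V ≤ B) (l : Γ(ξ.L, V)) :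
    ∃ f, toFn ξ.comp V l = fres hV T ^ n * f

namespace Normalized

variable {A B : (prod X S).Opens} {T : Γ(prod X S, B)} {lA : Γ(ξ.L, A)} {lB : Γ(ξ.L, B)}
  {σ : S.left ⟶ prod X S} (K : ξ.Normalized T lA lB) (H : SectionCoord (pr₂ X S) σ A B T)
include K

theorem comp_res_lA (h : V ≤ A) : toFn ξ.comp V (res _ h lA) = 1 := by
  rw [← fres_toFn, K.comp_lA, fres_one]

theorem comp_res_lB (h : V ≤ B) : toFn ξ.comp V (res _ h lB) = fres h T ^ n := by
  rw [← fres_toFn, K.comp_lB, fres_pow]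

theorem eq_smul_lA (h : V ≤ A) (l : Γ(ξ.L, V)) : l = toFn ξ.comp V l • res _ h lA :=
  K.inj V (by rw [map_smul, K.comp_res_lA h, smul_eq_mul, mul_one])

theorem exists_eq_smul_lB (h : V ≤ B) (l : Γ(ξ.L, V)) :
    ∃ f, toFn ξ.comp V l = fres h T ^ n * f ∧ l = f • res _ h lB := by
  obtain ⟨f, hf⟩ := K.dvd h l
  exact ⟨f, hf, K.inj V (by rw [map_smul, K.comp_res_lB h, hf, smul_eq_mul, mul_comm])⟩

theorem lB_eq_smul_lA (hA : V ≤ A) (hB : V ≤ B) :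
    res _ hB lB = fres hB T ^ n • res _ hA lA := by
  rw [← K.comp_res_lB hB, ← K.eq_smul_lA hA]

theorem not_vanishesAt_left {z : prod X S} (hz : z ∈ A) : ¬ VanishesAt ξ.comp z :=
  not_vanishesAt_of_toFn_eq_one hz K.comp_lA

theorem l_eq {h : V ≤ B} (F : ξ.AdaptedFrame V (fres h T) l q e w α β) : l = res _ h lB :=
  K.inj V (by rw [K.comp_res_lB h, F.comp_l])

/-- Expand `g lB` in a local unimodular frame `(c, d)`. If both coefficients vanished at `z`, so
would `g`, because `lB` generates `L`. Hence one coefficient is a unit near `z`, and a multiple of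
the other frame vector completes `g lB`. -/
theorem exists_q {z : prod X S} (hz : z ∈ B) : ∃ (V : (prod X S).Opens) (hV : V ≤ B) (_ : z ∈ V)
    (q : Γ(ξ.E₁, V)), ξ.vol₁.form V (ξ.g.app V (res _ hV lB)) q = 1 := by
  obtain ⟨V, hV, hzV, c, d, hcd, hs⟩ := ξ.vol₁.exists_pair hz
  obtain ⟨x, y, hxy⟩ := hs le_rfl (ξ.g.app V (res _ hV lB))
  rw [res_self, res_self] at hxy
  by_cases hx : x ∈ idealAt V z hzV
  · by_cases hy : y ∈ idealAt V z hzV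
    · refine absurd (fun U hzU s => ?_) (ξ.subbundle z)
      refine ⟨U ⊓ V, inf_le_left, ⟨hzU, hzV⟩, ?_⟩
      obtain ⟨f, -, hf⟩ := K.exists_eq_smul_lB (inf_le_right.trans hV) (res _ inf_le_left s)
      rw [res_app, hf, app_smul, ← res_res hV inf_le_right, ← res_app, hxy, res_add, res_smul,
        res_smul]
      have hx' := (fres_mem_idealAt_iff (inf_le_right : U ⊓ V ≤ V) ⟨hzU, hzV⟩).mpr hx
      have hy' := (fres_mem_idealAt_iff (inf_le_right : U ⊓ V ≤ V) ⟨hzU, hzV⟩).mpr hy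
      exact Submodule.smul_mem _ _ (Submodule.add_mem _
        (Submodule.smul_mem_smul hx' trivial) (Submodule.smul_mem_smul hy' trivial))
    · obtain ⟨V', hV', hz', u, hu⟩ := exists_isUnit_fres hzV hy
      refine ⟨V', hV'.trans hV, hz', -(↑u⁻¹ : Γ(prod X S, V')) • res _ hV' c, ?_⟩
      rw [← res_res hV hV', ← res_app, map_smul, ← ξ.vol₁.form_res, hxy, map_add, map_smul,
        map_smul, LinearMap.add_apply, LinearMap.smul_apply, LinearMap.smul_apply,
        ξ.vol₁.form_self, ξ.vol₁.form_swap d, hcd, smul_zero, zero_add, smul_eq_mul, smul_eq_mul,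
        fres_mul, ← hu, fres_neg, fres_one]
      simp
  · obtain ⟨V', hV', hz', u, hu⟩ := exists_isUnit_fres hzV hx
    refine ⟨V', hV'.trans hV, hz', (↑u⁻¹ : Γ(prod X S, V')) • res _ hV' d, ?_⟩
    rw [← res_res hV hV', ← res_app, map_smul, ← ξ.vol₁.form_res, hxy, map_add, map_smul,
      map_smul, LinearMap.add_apply, LinearMap.smul_apply, LinearMap.smul_apply,
      ξ.vol₁.form_self, hcd, smul_zero, add_zero, smul_eq_mul, smul_eq_mul,
      fres_mul, ← hu, fres_one]
    simp

theorem exists_adaptedFrame {z : prod X S} (hz : z ∈ B) :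
    ∃ (V : (prod X S).Opens) (hV : V ≤ B) (_ : z ∈ V) (q : Γ(ξ.E₁, V)) (e w : Γ(ξ.E₂, V))
      (α β : Γ(prod X S, V)),
      ξ.AdaptedFrame V (fres hV T) (res _ hV lB) q e w α β := by
  obtain ⟨V₁, hV₁, hz₁, q, hq⟩ := K.exists_q hz
  have := ξ.quotient
  obtain ⟨V₂, hz₂, e, he⟩ := exists_toFn_eq_one_of_epi (h := ξ.h) z
  obtain ⟨w, hw⟩ := ξ.vol₂.exists_dual ξ.h
  have h₁ : V₁ ⊓ V₂ ≤ V₁ := inf_le_left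
  have h₂ : V₁ ⊓ V₂ ≤ V₂ := inf_le_right
  have he' : toFn ξ.h _ (res _ h₂ e) = 1 := by rw [← fres_toFn, he, fres_one]
  have hf : ξ.vol₂.form _ (res _ h₂ e) (res _ le_top w) = 1 := by rw [hw, he']
  -- The vector `w` is dual to `h`, so `vol(e, w) = h e = 1` and `h w = vol(w, w) = 0`. As `h` takes
  -- the value `Tⁿ` on both `Tⁿ e` and `φ g lB`, their difference is a multiple of `w`, and `α` is
  -- its coefficient.
  refine ⟨V₁ ⊓ V₂, h₁.trans hV₁, ⟨hz₁, hz₂⟩, res _ h₁ q, res _ h₂ e, res _ le_top w,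
    ξ.vol₂.form _ (res _ h₂ e) (fres (h₁.trans hV₁) T ^ n • res _ h₂ e -
      ξ.φ.app _ (ξ.g.app _ (res _ (h₁.trans hV₁) lB))), _,
    K.comp_res_lB _, ?_, rfl, he', ?_, hf, ?_⟩
  · rw [← res_res hV₁ h₁, ← res_app, ← ξ.vol₁.form_res, hq, fres_one]
  · rw [← hw, ξ.vol₂.form_self]
  · have := ξ.vol₂.eq_of_form_eq_one hf (fres (h₁.trans hV₁) T ^ n • res _ h₂ e -
      ξ.φ.app _ (ξ.g.app _ (res _ (h₁.trans hV₁) lB)))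
    rw [hw, map_sub, map_smul, he', ← toFn_comp_eq, K.comp_res_lB, smul_eq_mul, mul_one, sub_self,
      zero_smul, zero_add] at this
    rw [← this, add_sub_cancel]

end Normalized

end LocalModel

end
end PicardLefschetz

namespace PicardLefschetz
noncomputable section

/-! ### Convolution -/

/-- The coefficient of `τᵏ` in `(∑ aᵢ τⁱ) (∑ bⱼ τʲ)`. -/
def conv {R : Type*} [CommRing R] {n : ℕ} (a b : Fin n → R) (k : ℕ) : R :=
  ∑ i : Fin n, ∑ j : Fin n, if (i : ℕ) + j = k then a i * b j else 0

/-- The entry `a i` stands for `a_{i-n}`, so degrees are shifted by `n`: `m = -n + 1, …, -1` becomes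
`k = 1, …, n - 1`, and `m = 0` becomes `k = n`. -/
theorem convSum_eq_conv {R : Type*} [CommRing R] {n : ℕ} (a b : Fin n → R) (k : ℕ) (m : ℤ)
    (h : (k : ℤ) = m + n) : convSum a b m = conv a b k := by
  unfold convSum conv
  refine Finset.sum_congr rfl fun i _ => Finset.sum_congr rfl fun j _ => ?_
  exact if_congr (by omega) rfl rfl

theorem map_conv {R R' : Type*} [CommRing R] [CommRing R'] (f : R →+* R') {n : ℕ}
    (a b : Fin n → R) (k : ℕ) : f (conv a b k) = conv (fun i => f (a i)) (fun i => f (b i)) k := by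
  simp only [conv, map_sum]
  refine Finset.sum_congr rfl fun i _ => Finset.sum_congr rfl fun j _ => ?_
  split_ifs
  exacts [map_mul f _ _, map_zero f]

theorem map_convSum {R R' : Type*} [CommRing R] [CommRing R'] (f : R →+* R') {n : ℕ}
    (a b : Fin n → R) (m : ℤ) :
    f (convSum a b m) = convSum (fun i => f (a i)) (fun i => f (b i)) m := by
  simp only [convSum, map_sum]
  refine Finset.sum_congr rfl fun i _ => Finset.sum_congr rfl fun j _ => ?_
  split_ifs
  exacts [map_mul f _ _, map_zero f]

theorem conv_zero {R : Type*} [CommRing R] {n : ℕ} [NeZero n] (a b : Fin n → R) :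
    conv a b 0 = a 0 * b 0 := by
  unfold conv
  have h0 : ((0 : Fin n) : ℕ) = 0 := Fin.val_zero n
  rw [Finset.sum_eq_single 0, Finset.sum_eq_single 0]
  · rw [if_pos (by omega)]
  · exact fun j _ hj => if_neg fun h => hj (Fin.ext (by omega))
  · exact fun h => absurd (Finset.mem_univ _) h
  · exact fun i _ hi => Finset.sum_eq_zero fun j _ => if_neg fun h => hi (Fin.ext (by omega))
  · exact fun h => absurd (Finset.mem_univ _) h

/-- The product is cut at `τⁿ`. Its degrees stop at `2n - 2`, so the last term of the upper half is
zero and serves only to give both halves `n` terms. -/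
theorem sum_mul_sum_eq_conv {R : Type*} [CommRing R] {n : ℕ} (a b : Fin n → R) (τ : R) :
    (∑ i, a i * τ ^ (i : ℕ)) * ∑ j, b j * τ ^ (j : ℕ) =
      ∑ k : Fin n, conv a b k * τ ^ (k : ℕ) + τ ^ n * ∑ k : Fin n, conv a b (n + k) * τ ^ (k : ℕ) := by
  have h : (∑ i, a i * τ ^ (i : ℕ)) * ∑ j, b j * τ ^ (j : ℕ) =
      ∑ k : Fin (n + n), conv a b k * τ ^ (k : ℕ) := by
    rw [Finset.sum_mul_sum]
    simp only [conv, Finset.sum_mul]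
    rw [Finset.sum_comm' (t' := Finset.univ) (s' := fun _ => Finset.univ) (by simp)]
    rw [Finset.sum_comm]
    rw [eq_comm, Finset.sum_comm]
    refine Finset.sum_congr rfl fun i _ => ?_
    rw [Finset.sum_comm]
    refine Finset.sum_congr rfl fun j _ => ?_
    rw [Finset.sum_eq_single ⟨(i : ℕ) + j, by omega⟩]
    · rw [if_pos rfl, pow_add]
      ring
    · intro k _ hk
      rw [if_neg, zero_mul]
      intro h
      exact hk (Fin.ext h.symm)
    · simp
  rw [h, Fin.sum_univ_add, Finset.mul_sum]
  congr 1
  refine Finset.sum_congr rfl fun k _ => ?_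
  rw [Fin.val_natAdd, pow_add]
  ring

section

variable {W S : Scheme.{u}} {π : W ⟶ S} {N : S.Opens} {V : W.Opens} {n : ℕ}

theorem poly_mul_poly (h : V ≤ π ⁻¹ᵁ N) (τ : Γ(W, V)) (a b : Fin n → Γ(S, N)) :
    poly π h τ a * poly π h τ b = poly π h τ (fun k : Fin n => conv a b k) +
      τ ^ n * poly π h τ (fun k : Fin n => conv a b (n + k)) := by
  unfold poly
  rw [sum_mul_sum_eq_conv]
  simp only [map_conv]

theorem poly_eq_pull_zero [NeZero n] (h : V ≤ π ⁻¹ᵁ N) (τ : Γ(W, V)) (c : Fin n → Γ(S, N))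
    (hc : ∀ i : Fin n, i ≠ 0 → c i = 0) : poly π h τ c = pull π h (c 0) := by
  unfold poly
  rw [Finset.sum_eq_single 0]
  · simp
  · intro i _ hi
    rw [hc i hi, map_zero, zero_mul]
  · simp

end

/-! ### Existence and uniqueness of the coordinates -/

namespace LocalModel

variable {B₀ : Scheme.{u}} {n : ℕ} {X S : Over B₀}

/-- The functions `a`, `b` on `N ⊆ S` are the coordinates of the restriction of `ξ` to `N`. -/
def IsCoord (ξ : LocalModel n X S) (σ : S.left ⟶ prod X S) {B : (prod X S).Opens}
    (T : Γ(prod X S, B)) (N : S.left.Opens) (a b : Fin n → Γ(S.left, N)) : Prop :=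
  ∀ y ∈ N, ∃ (V : (prod X S).Opens) (hB : V ≤ B) (hN : V ≤ pr₂ X S ⁻¹ᵁ N) (_ : σ y ∈ V)
    (l : Γ(ξ.L, V)) (q : Γ(ξ.E₁, V)) (e w : Γ(ξ.E₂, V)),
    ξ.AdaptedFrame V (fres hB T) l q e w (poly (pr₂ X S) hN (fres hB T) a)
      (poly (pr₂ X S) hN (fres hB T) b)

variable {ξ : LocalModel n X S} {A B : (prod X S).Opens} {T : Γ(prod X S, B)} {lA : Γ(ξ.L, A)}
  {lB : Γ(ξ.L, B)} {σ : S.left ⟶ prod X S} {N N' : S.left.Opens} {a b a' b' : Fin n → Γ(S.left, N)}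

theorem IsCoord.restrict (H : SectionCoord (pr₂ X S) σ A B T) (hc : ξ.IsCoord σ T N a b)
    (h : N' ≤ N) :
    ξ.IsCoord σ T N' (fun i => fres h (a i)) (fun i => fres h (b i)) := by
  intro y hy
  obtain ⟨V, hB, hN, hyV, l, q, e, w, F⟩ := hc y (h hy)
  have h1 : V ⊓ pr₂ X S ⁻¹ᵁ N' ≤ V := inf_le_left
  have hy' : pr₂ X S (σ y) ∈ N' := by rwa [H.proj_sec]
  have F₁ := F.restrict h1
  rw [fres_poly, fres_poly, fres_fres, ← poly_fres inf_le_right h, ← poly_fres inf_le_right h] at F₁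
  exact ⟨_, h1.trans hB, inf_le_right, ⟨hyV, hy'⟩, _, _, _, _, F₁⟩

theorem IsCoord.of_locally {a b : Fin n → Γ(S.left, N)}
    (h : ∀ y ∈ N, ∃ (N' : S.left.Opens) (h : N' ≤ N), y ∈ N' ∧
      ξ.IsCoord σ T N' (fun i => fres h (a i)) (fun i => fres h (b i))) : ξ.IsCoord σ T N a b := by
  intro y hy
  obtain ⟨N', h', hy', hc⟩ := h y hy
  obtain ⟨V, hB, hN, hyV, l, q, e, w, F⟩ := hc y hy'
  rw [poly_fres, poly_fres] at F
  exact ⟨V, hB, _, hyV, l, q, e, w, F⟩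

namespace Normalized

variable (K : ξ.Normalized T lA lB) (H : SectionCoord (pr₂ X S) σ A B T)
include K H

/-- On a common small neighbourhood both adapted frames involve the same `l`, namely `lB`, so the
two polynomials agree modulo `Tⁿ`. Uniqueness of Taylor coefficients finishes. -/
theorem isCoord_unique (hc : ξ.IsCoord σ T N a b) (hc' : ξ.IsCoord σ T N a' b') :
    a = a' ∧ b = b' := by
  have key : ∀ y ∈ N, ∃ (N' : S.left.Opens) (h : N' ≤ N), y ∈ N' ∧
      (fun i => fres h (a' i)) = (fun i => fres h (a i)) ∧
      (fun i => fres h (b' i)) = (fun i => fres h (b i)) := by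
    intro y hy
    obtain ⟨V, hB, hN, hyV, l, q, e, w, F⟩ := hc y hy
    obtain ⟨V', hB', hN', hyV', l', q', e', w', F'⟩ := hc' y hy
    obtain ⟨N₁, V₁, hy₁, hN₁, hV₁, hyV₁, h, h'⟩ := H.exists_shrink (V := V ⊓ V') ⟨hyV, hyV'⟩ hy
    have F₁ := F.restrict (hV₁.trans inf_le_left)
    have F₁' := F'.restrict (hV₁.trans inf_le_right)
    simp only [fres_poly, fres_fres] at F₁ F₁'
    rw [K.l_eq F₁] at F₁
    rw [K.l_eq F₁'] at F₁'
    obtain ⟨r, hr⟩ := F₁.exists_eq_left F₁'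
    obtain ⟨r', hr'⟩ := F₁.exists_eq_right F₁'
    refine ⟨N₁, hN₁, hy₁, H.poly_unique h h' ((hV₁.trans inf_le_left).trans hB) (r := r) ?_,
      H.poly_unique h h' ((hV₁.trans inf_le_left).trans hB) (r := r') ?_⟩
    · rw [poly_fres, poly_fres, hr]
    · rw [poly_fres, poly_fres, hr']
  constructor
  · refine funext fun i => fn_ext fun y hy => ?_
    obtain ⟨N', h, hy', e, -⟩ := key y hy
    exact ⟨N', h, hy', (congrFun e i).symm⟩
  · refine funext fun i => fn_ext fun y hy => ?_
    obtain ⟨N', h, hy', -, e⟩ := key y hy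
    exact ⟨N', h, hy', (congrFun e i).symm⟩

/-- Expand `α` and `β` of any adapted frame to order `n` along the section and absorb the remainders
by `AdaptedFrame.adjust`. -/
theorem exists_isCoord_locally (y : S.left) : ∃ (N : S.left.Opens) (_ : y ∈ N)
    (a b : Fin n → Γ(S.left, N)), ξ.IsCoord σ T N a b := by
  obtain ⟨V, hB, hyV, q, e, w, α, β, F⟩ := K.exists_adaptedFrame (H.mem y)
  obtain ⟨N₁, V₁, hy₁, -, hV₁, hyV₁, h, h'⟩ := H.exists_shrink (V := V) (N := ⊤) hyV trivial
  have F₁ := F.restrict hV₁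
  rw [fres_fres] at F₁
  obtain ⟨a, r, ha⟩ := H.exists_poly h h' (hV₁.trans hB) n (fres hV₁ α)
  obtain ⟨b, r', hb⟩ := H.exists_poly h h' (hV₁.trans hB) n (fres hV₁ β)
  have F₂ := F₁.adjust r' r
  rw [ha, hb, add_sub_cancel_right, add_sub_cancel_right] at F₂
  exact ⟨N₁, hy₁, a, b, fun y' hy' => ⟨V₁, _, h, h' hy', _, _, _, _, F₂⟩⟩

/-- Local coordinates glue because they are unique. -/
theorem exists_isCoord (N : S.left.Opens) : ∃ a b, ξ.IsCoord σ T N a b := by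
  obtain ⟨c, hc⟩ := exists_functions_of_locally (ι := Fin n ⊕ Fin n) (U := N)
    (fun V _ c => ξ.IsCoord σ T V (fun i => c (.inl i)) (fun i => c (.inr i)))
    (fun hV h c hc => hc.restrict H h)
    (fun hV c c' hc hc' => by
      obtain ⟨h1, h2⟩ := K.isCoord_unique H hc hc'
      exact funext fun i => i.casesOn (congrFun h1) (congrFun h2))
    (fun y hy => by
      obtain ⟨N', hy', a, b, hc⟩ := K.exists_isCoord_locally H y
      exact ⟨N' ⊓ N, inf_le_right, ⟨hy', hy⟩, Sum.elim (fun i => fres inf_le_left (a i))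
        (fun i => fres inf_le_left (b i)), hc.restrict H inf_le_left⟩)
  refine ⟨fun i => c (.inl i), fun i => c (.inr i), IsCoord.of_locally fun y hy => ?_⟩
  obtain ⟨V, hV, hy', h⟩ := hc y hy
  exact ⟨V, hV, hy', h⟩

end Normalized

/-- Near the section, the data in terms of an adapted frame over a small open set. -/
theorem IsCoord.exists_frame (H : SectionCoord (pr₂ X S) σ A B T) {a b : Fin n → Γ(S.left, ⊤)}
    (hc : ξ.IsCoord σ T ⊤ a b) (y : S.left) {V : (prod X S).Opens} (hy : σ y ∈ V) :
    ∃ (V' : (prod X S).Opens) (hB : V' ≤ B) (_ : V' ≤ V) (_ : σ y ∈ V') (N : S.left.Opens)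
      (_ : y ∈ N) (_ : V' ≤ pr₂ X S ⁻¹ᵁ N) (_ : N ≤ σ ⁻¹ᵁ V') (l : Γ(ξ.L, V')) (q : Γ(ξ.E₁, V'))
      (e w : Γ(ξ.E₂, V')),
      ξ.AdaptedFrame V' (fres hB T) l q e w (poly (pr₂ X S) (le_preimage_top _) (fres hB T) a)
        (poly (pr₂ X S) (le_preimage_top _) (fres hB T) b) := by
  obtain ⟨V₀, hB, hN, hyV, l, q, e, w, F⟩ := hc y trivial
  obtain ⟨N₁, V₁, hy₁, -, hV₁, hyV₁, h, h'⟩ :=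
    H.exists_shrink (V := V₀ ⊓ V) (N := ⊤) ⟨hyV, hy⟩ trivial
  have F₁ := F.restrict (hV₁.trans inf_le_left)
  simp only [fres_poly, fres_fres] at F₁
  exact ⟨V₁, _, hV₁.trans inf_le_right, hyV₁, N₁, hy₁, h, h', _, _, _, _, F₁⟩

end LocalModel

end
end PicardLefschetz

/-! ### Determinant, equations and defect in terms of the coordinates -/

namespace PicardLefschetz
noncomputable section

theorem constFn_eq_pull {B : Scheme.{u}} {X S : Over B} (V : (prod X S).Opens)
    (c : Γ(S.left, ⊤)) : constFn X S V c = pull (pr₂ X S) (le_preimage_top _) c :=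
  (pull_eq_fres_app (pr₂ X S) (U := ⊤) (U' := V) (le_preimage_top _) c).symm

theorem pull_mem_idealAt_iff {X X' : Scheme.{u}} (F : X' ⟶ X) {U : X.Opens} {U' : X'.Opens}
    (h : U' ≤ F ⁻¹ᵁ U) {y : X'} (hy : y ∈ U') {f : Γ(X, U)} :
    pull F h f ∈ idealAt U' y hy ↔ f ∈ idealAt U (F y) (show F y ∈ U from h hy) := by
  rw [pull_eq_fres_app, fres_mem_idealAt_iff, mem_idealAt_iff, ← Scheme.preimage_basicOpen]
  exact (mem_idealAt_iff (show F y ∈ U from h hy)).symm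

theorem VanishesAt.form_mem {X : Scheme.{u}} {M E : X.Modules} (v : SL2Structure E)
    {φ : M ⟶ E} {U : X.Opens} {z : X} (h : VanishesAt φ z) (hz : z ∈ U) (s : Γ(M, U))
    (d : Γ(E, U)) : v.form U d (φ.app U s) ∈ idealAt U z hz := by
  obtain ⟨V, hV, hz', hs⟩ := h U hz s
  have := map_mem_of_mem_smul_top (v.form V (res E hV d)) hs
  rwa [← v.form_res, fres_mem_idealAt_iff] at this

namespace SectionCoord

variable {W S : Scheme.{u}} {π : W ⟶ S} {σ : S ⟶ W} {A B : W.Opens} {T : Γ(W, B)}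
  (H : SectionCoord π σ A B T) {N N' : S.Opens} {V V' : W.Opens} {n : ℕ}
include H

theorem pull_sec_poly_zero [NeZero n] (h : V ≤ π ⁻¹ᵁ N) (h' : N' ≤ σ ⁻¹ᵁ V) (hN : N' ≤ N)
    (hB : V ≤ B) (c : Fin n → Γ(S, N)) :
    pull σ h' (poly π h (fres hB T) c) = fres hN (c 0) := by
  obtain ⟨m, rfl⟩ := Nat.exists_eq_succ_of_ne_zero (NeZero.ne n)
  exact H.pull_sec_poly h h' hN hB c

end SectionCoord

namespace LocalModel

variable {B₀ : Scheme.{u}} {n : ℕ} [NeZero n] {X S : Over B₀} {ξ : LocalModel n X S}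
  {A B : (prod X S).Opens} {T : Γ(prod X S, B)} {lA : Γ(ξ.L, A)}
  {lB : Γ(ξ.L, B)} {σ : S.left ⟶ prod X S} {a b : Fin n → Γ(S.left, ⊤)}

/-- The heart of the computation. The determinant `τⁿ δ + α β` of `φ` is the pullback of `d`, so the
Taylor coefficients of `α β` below `τⁿ` are `d, 0, …, 0`. After cancelling `τⁿ`, `δ` is minus the
upper half of `α β`, and its value on the section is minus the coefficient of `τⁿ`. -/
theorem AdaptedFrame.conv_eq (H : SectionCoord (pr₂ X S) σ A B T) {V : (prod X S).Opens}
    {hB : V ≤ B} {N : S.left.Opens} (h : V ≤ pr₂ X S ⁻¹ᵁ N) (h' : N ≤ σ ⁻¹ᵁ V) {l : Γ(ξ.L, V)}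
    {q : Γ(ξ.E₁, V)} {e w : Γ(ξ.E₂, V)}
    (F : ξ.AdaptedFrame V (fres hB T) l q e w (poly (pr₂ X S) (le_preimage_top _) (fres hB T) a)
      (poly (pr₂ X S) (le_preimage_top _) (fres hB T) b)) {d : Γ(S.left, ⊤)} (hd : ξ.IsDet d) :
    (∀ k : ℕ, 1 ≤ k → k < n → fres (le_top : N ≤ ⊤) (conv a b k) = 0) ∧
      fres (le_top : N ≤ ⊤) d = fres le_top (a 0 * b 0) ∧
      pull σ h' (ξ.vol₂.form V e (ξ.φ.app V q)) = -fres le_top (conv a b n) := by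
  have e1 := hd V (ξ.g.app V l) q
  rw [F.form_q, mul_one, F.form_φ, poly_mul_poly, constFn_eq_pull] at e1
  set τ := fres hB T
  set δ := ξ.vol₂.form V e (ξ.φ.app V q)
  -- The constant `d` is written as a polynomial with `n` coefficients, so that `poly_unique`
  -- applies.
  let c : Fin n → Γ(S.left, ⊤) := fun k => if k = 0 then d else 0
  have hc : poly (pr₂ X S) (le_preimage_top (V := V) (pr₂ X S)) τ c = pull (pr₂ X S) (le_preimage_top _) d := by
    rw [poly_eq_pull_zero _ _ _ (fun i hi => if_neg hi)]
    exact congrArg _ (if_pos rfl)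
  have e2 : poly (pr₂ X S) (le_preimage_top (V := V) (pr₂ X S)) τ c =
      poly (pr₂ X S) (le_preimage_top _) τ (fun k : Fin n => conv a b k) +
        τ ^ n * (δ + poly (pr₂ X S) (le_preimage_top _) τ (fun k : Fin n => conv a b (n + k))) := by
    rw [hc, ← e1]
    ring
  have e3 := e2
  rw [← poly_fres h (le_top : N ≤ ⊤), ← poly_fres h (le_top : N ≤ ⊤)] at e3
  have e4 := H.poly_unique h h' hB e3
  refine ⟨fun k hk hk' => ?_, ?_, ?_⟩
  · have := congrFun e4 ⟨k, hk'⟩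
    have h0 : (⟨k, hk'⟩ : Fin n) ≠ 0 := fun h => by
      have := (congrArg Fin.val h).trans (Fin.val_zero n)
      exact absurd this (by change k ≠ 0; omega)
    simp only [c, if_neg h0, fres_zero] at this
    exact this.symm
  · have := congrFun e4 0
    simp only [c, if_pos, Fin.val_zero, conv_zero] at this
    exact this
  · have e5 : poly (pr₂ X S) (le_preimage_top (V := V) (pr₂ X S)) τ c =
        poly (pr₂ X S) (le_preimage_top _) τ (fun k : Fin n => conv a b k) := by
      rw [← poly_fres h (le_top : N ≤ ⊤), ← poly_fres h (le_top : N ≤ ⊤), e4]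
    rw [e5, left_eq_add] at e2
    have e6 := H.pow_mul_cancel hB n (e2.trans (mul_zero (τ ^ n)).symm)
    rw [eq_neg_of_add_eq_zero_left e6, map_neg, H.pull_sec_poly_zero _ h' le_top]
    simp only [Fin.val_zero, add_zero]

theorem IsCoord.conv_eq_zero (H : SectionCoord (pr₂ X S) σ A B T) (hc : ξ.IsCoord σ T ⊤ a b)
    {d : Γ(S.left, ⊤)} (hd : ξ.IsDet d) {k : ℕ} (hk : 1 ≤ k) (hk' : k < n) : conv a b k = 0 := by
  refine fn_ext fun y _ => ?_
  obtain ⟨V, hB, -, hy, N, hN, h, h', l, q, e, w, F⟩ := hc.exists_frame H y (V := ⊤) trivial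
  exact ⟨N, le_top, hN, by rw [(F.conv_eq H h h' hd).1 k hk hk', fres_zero]⟩

theorem IsCoord.det_eq (H : SectionCoord (pr₂ X S) σ A B T) (hc : ξ.IsCoord σ T ⊤ a b)
    {d : Γ(S.left, ⊤)} (hd : ξ.IsDet d) : d = a 0 * b 0 := by
  refine fn_ext fun y _ => ?_
  obtain ⟨V, hB, -, hy, N, hN, h, h', l, q, e, w, F⟩ := hc.exists_frame H y (V := ⊤) trivial
  exact ⟨N, le_top, hN, (F.conv_eq H h h' hd).2.1⟩

omit [NeZero n] in
-- The determinant always exists as a function on `X × S`; it descends to `S` because global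
-- functions do.
theorem exists_isDet (hconst : ∀ f : Γ(prod X S, ⊤), ∃ c, f = constFn X S ⊤ c) :
    ∃ d, ξ.IsDet d := by
  obtain ⟨D, hD⟩ := ξ.vol₁.exists_det ξ.vol₂ ξ.φ
  obtain ⟨d, rfl⟩ := hconst D
  refine ⟨d, fun U s t => ?_⟩
  rw [hD, constFn_eq_pull, constFn_eq_pull, fres_pull]

/-- In an adapted frame `φ` has the entries `τⁿ, -α, β, δ`. On the section these become `0`, `-a 0`,
`b 0` and `-conv a b n`. -/
theorem vanishesAt_iff (H : SectionCoord (pr₂ X S) σ A B T) (hc : ξ.IsCoord σ T ⊤ a b)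
    {d : Γ(S.left, ⊤)} (hd : ξ.IsDet d) (y : S.left) :
    VanishesAt ξ.φ (σ y) ↔ a 0 ∈ idealAt ⊤ y trivial ∧ b 0 ∈ idealAt ⊤ y trivial ∧
      conv a b n ∈ idealAt ⊤ y trivial := by
  obtain ⟨V, hB, -, hy, N, hN, h, h', l, q, e, w, F⟩ := hc.exists_frame H y (V := ⊤) trivial
  obtain ⟨-, -, hδ⟩ := F.conv_eq H h h' hd
  have hα := H.pull_sec_poly_zero (le_preimage_top (V := V) (pr₂ X S)) h' le_top hB a
  have hβ := H.pull_sec_poly_zero (le_preimage_top (V := V) (pr₂ X S)) h' le_top hB b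
  have hα' := pull_mem_idealAt_iff σ h' hN (f := poly (pr₂ X S) (le_preimage_top _) (fres hB T) a)
  have hβ' := pull_mem_idealAt_iff σ h' hN (f := poly (pr₂ X S) (le_preimage_top _) (fres hB T) b)
  have hδ' := pull_mem_idealAt_iff σ h' hN (f := ξ.vol₂.form V e (ξ.φ.app V q))
  rw [hα, fres_mem_idealAt_iff] at hα'
  rw [hβ, fres_mem_idealAt_iff] at hβ'
  rw [hδ, neg_mem_iff, fres_mem_idealAt_iff] at hδ'
  rw [hα', hβ', hδ']
  constructor
  · intro hv
    refine ⟨?_, ?_, hv.form_mem ξ.vol₂ _ q e⟩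
    · have := hv.form_mem ξ.vol₂ hy (ξ.g.app V l) e
      rwa [F.φ_l, map_sub, map_smul, map_smul, ξ.vol₂.form_self, F.form_w, smul_zero, zero_sub,
        neg_mem_iff, smul_eq_mul, mul_one] at this
    · have := (hv.comp ξ.h).toFn_mem hy q
      rwa [toFn_comp, F.h_q] at this
  · rintro ⟨h1, h2, h3⟩ U hU s
    -- This needs `n ≠ 0`: the entry `τⁿ` must vanish on the section.
    have hτ : fres hB T ^ n ∈ idealAt V (σ y) hy := by
      rw [← pull_mem_idealAt_iff σ h' hN, map_pow, pull_fres, H.pull_sec,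
        zero_pow (NeZero.ne n)]
      exact Ideal.zero_mem _
    refine ⟨U ⊓ V, inf_le_left, ⟨hU, hy⟩, ?_⟩
    have F' := F.restrict (inf_le_right : U ⊓ V ≤ V)
    have hm : ∀ {f : Γ(prod X S, V)}, f ∈ idealAt V (σ y) hy →
        fres (inf_le_right : U ⊓ V ≤ V) f ∈ idealAt (U ⊓ V) (σ y) ⟨hU, hy⟩ :=
      fun hf => (fres_mem_idealAt_iff _ _).mpr hf
    have hmem : ∀ {f : Γ(prod X S, V)} (t : Γ(ξ.E₂, U ⊓ V)), f ∈ idealAt V (σ y) hy →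
        fres (inf_le_right : U ⊓ V ≤ V) f • t ∈
          (idealAt (U ⊓ V) (σ y) ⟨hU, hy⟩ • ⊤ : Submodule _ Γ(ξ.E₂, U ⊓ V)) :=
      fun t hf => Submodule.smul_mem_smul (hm hf) trivial
    rw [res_app, ξ.vol₁.eq_of_form_eq_one F'.form_q (res _ inf_le_left s), app_add, app_smul,
      app_smul, F'.φ_l, F'.φ_q, ← fres_pow, ← res_app ξ.φ, ← ξ.vol₂.form_res]
    exact Submodule.add_mem _
      (Submodule.smul_mem _ _ (Submodule.sub_mem _ (hmem _ hτ) (hmem _ h1)))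
      (Submodule.smul_mem _ _ (Submodule.add_mem _ (hmem _ h2) (hmem _ h3)))

/-- Off the section `hφg` does not vanish, hence neither does `φ`. Only points of the section
matter, and each is the image of a point of a geometric fibre. -/
theorem defectFree_iff (H : SectionCoord (pr₂ X S) σ A B T) (K : ξ.Normalized T lA lB)
    (hgeom : ∀ y : S.left, ∃ (s : GeomPt S) (z : prod X s.over), s.fib X z = σ y)
    (hc : ξ.IsCoord σ T ⊤ a b) {d : Γ(S.left, ⊤)} (hd : ξ.IsDet d) :
    ξ.DefectFree ↔ ∀ y : S.left, ¬ (a 0 ∈ idealAt ⊤ y trivial ∧ b 0 ∈ idealAt ⊤ y trivial ∧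
      conv a b n ∈ idealAt ⊤ y trivial) := by
  simp only [← vanishesAt_iff H hc hd]
  constructor
  · intro h y
    obtain ⟨s, z, e⟩ := hgeom y
    exact e ▸ h s z
  · intro h s z
    rcases H.mem_or (s.fib X z) with hz | ⟨y, hy⟩
    · exact fun hv => K.not_vanishesAt_left hz ((hv.comp ξ.h).precomp ξ.g)
    · exact hy ▸ h y

end LocalModel

end
end PicardLefschetz

/-! ### The standard local model with given coordinates -/

namespace PicardLefschetz
noncomputable section

namespace SectionCoord

variable {W S : Scheme.{u}} {π : W ⟶ S} {σ : S ⟶ W} {A B : W.Opens} {T : Γ(W, B)}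
  (H : SectionCoord π σ A B T) {n : ℕ} (a b : Fin n → Γ(S, ⊤))

/-- The inverse of the coordinate `T` on `A ⊓ B`. -/
def inv : Γ(W, A ⊓ B) := (↑(H.unit.unit⁻¹) : Γ(W, A ⊓ B))

theorem mul_inv : fres (inf_le_right : A ⊓ B ≤ B) T * H.inv = 1 := H.unit.mul_val_inv

theorem pow_mul_inv_pow : fres (inf_le_right : A ⊓ B ≤ B) T ^ n * H.inv ^ n = 1 := by
  rw [← mul_pow, H.mul_inv, one_pow]

/-- The left side is the determinant of `matB`. The equations leave only the constant term of the
lower half of the product, and the first summand cancels the upper half. -/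
theorem T_pow_mul_add (hab : ∀ k : ℕ, 1 ≤ k → k < n → conv a b k = 0) [NeZero n] :
    T ^ n * -poly π (le_preimage_top π) T (fun k : Fin n => conv a b (n + k)) +
      poly π (le_preimage_top π) T a * poly π (le_preimage_top π) T b =
      pull π (le_preimage_top π) (a 0 * b 0) := by
  rw [poly_mul_poly, poly_eq_pull_zero _ _ (fun k : Fin n => conv a b k)]
  · simp only [Fin.val_zero, conv_zero]
    ring
  · intro i hi
    refine hab i ?_ i.2
    rw [Nat.one_le_iff_ne_zero]
    exact fun h => hi (Fin.ext (h.trans (Fin.val_zero n).symm))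

omit a b in
theorem fres_T_pow_mul_add {a b : Fin n → Γ(S, ⊤)} [NeZero n]
    (hab : ∀ k : ℕ, 1 ≤ k → k < n → conv a b k = 0) {V : W.Opens} (h : V ≤ B) :
    fres h T ^ n * -poly π (le_preimage_top π) (fres h T) (fun k : Fin n => conv a b (n + k)) +
      poly π (le_preimage_top π) (fres h T) a * poly π (le_preimage_top π) (fres h T) b =
      pull π (le_preimage_top π) (a 0 * b 0) := by
  have e := congrArg (fres h) (T_pow_mul_add (π := π) (T := T) a b hab)
  rwa [fres_add, fres_mul, fres_mul, fres_pow, fres_pull, fres_neg, fres_poly, fres_poly,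
    fres_poly] at e

/-- The gluing matrix of `L`. -/
def matL (_ : SectionCoord π σ A B T) (n : ℕ) : Matrix (Fin 1) (Fin 1) Γ(W, A ⊓ B) :=
  !![fres inf_le_right T ^ n]

/-- The inverse of the gluing matrix of `L`. -/
def matL' (n : ℕ) : Matrix (Fin 1) (Fin 1) Γ(W, A ⊓ B) := !![H.inv ^ n]

/-- The gluing matrix of `E₁`. -/
def mat₁ : Matrix (Fin 2) (Fin 2) Γ(W, A ⊓ B) :=
  !![fres inf_le_right T ^ n, fres inf_le_right (poly π (le_preimage_top π) T b); 0, H.inv ^ n]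

/-- The inverse of the gluing matrix of `E₁`. -/
def mat₁' : Matrix (Fin 2) (Fin 2) Γ(W, A ⊓ B) :=
  !![H.inv ^ n, -fres inf_le_right (poly π (le_preimage_top π) T b); 0, fres inf_le_right T ^ n]

/-- The gluing matrix of `E₂`. -/
def mat₂ : Matrix (Fin 2) (Fin 2) Γ(W, A ⊓ B) :=
  !![1, 0; H.inv ^ n * fres inf_le_right (poly π (le_preimage_top π) T a), 1]

/-- The inverse of the gluing matrix of `E₂`. -/
def mat₂' : Matrix (Fin 2) (Fin 2) Γ(W, A ⊓ B) :=
  !![1, 0; -(H.inv ^ n * fres inf_le_right (poly π (le_preimage_top π) T a)), 1]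

theorem matL_mul : H.matL n * H.matL' n = 1 := by
  ext i j
  fin_cases i; fin_cases j
  simp [matL, matL', Matrix.mul_apply, H.pow_mul_inv_pow]

theorem mat₁_mul : H.mat₁ b * H.mat₁' b = 1 := by
  have h := H.pow_mul_inv_pow (n := n)
  have h' := h
  rw [mul_comm] at h'
  ext i j
  fin_cases i <;> fin_cases j <;>
    simp [mat₁, mat₁', Matrix.mul_apply, Fin.sum_univ_two, h, h']
  ring

theorem mat₂_mul : H.mat₂ a * H.mat₂' a = 1 := by
  ext i j
  fin_cases i <;> fin_cases j <;> simp [mat₂, mat₂', Matrix.mul_apply, Fin.sum_univ_two]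

theorem mat₁_det : H.mat₁ b 0 0 * H.mat₁ b 1 1 - H.mat₁ b 0 1 * H.mat₁ b 1 0 = 1 := by
  simp [mat₁, H.pow_mul_inv_pow]

theorem mat₂_det : H.mat₂ a 0 0 * H.mat₂ a 1 1 - H.mat₂ a 0 1 * H.mat₂ a 1 0 = 1 := by
  simp [mat₂]

/-- The inclusion `g` of the standard local model. -/
def stdG : glue (H.matL n) ⟶ glue (H.mat₁ b) :=
  glueMap (H.matL n) (H.mat₁ b) !![1; 0] !![1; 0] (by
    intro i k
    fin_cases i <;> fin_cases k <;> simp [matL, mat₁, Fin.sum_univ_two, fres_one, fres_zero])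

/-- The matrix of `φ` over `A`. -/
def matA [NeZero n] : Matrix (Fin 2) (Fin 2) Γ(W, A) :=
  !![1, 0; 0, pull π (le_preimage_top π) (a 0 * b 0)]

/-- The matrix of `φ` over `B`. -/
def matB (_ : SectionCoord π σ A B T) : Matrix (Fin 2) (Fin 2) Γ(W, B) :=
  !![T ^ n, poly π (le_preimage_top π) T b; -poly π (le_preimage_top π) T a,
    -poly π (le_preimage_top π) T (fun k : Fin n => conv a b (n + k))]

/-- Over `A`, `φ` is `diag(1, d)` with `d = a 0 * b 0`; over `B` it must be `mat₂⁻¹ · diag(1, d) ·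
mat₁`, and the equations make this matrix regular along the section. Only the second row needs an
argument: its first entry uses `Tⁿ T⁻ⁿ = 1`, its second entry also the determinant identity. -/
theorem mat_comm [NeZero n] (hab : ∀ k : ℕ, 1 ≤ k → k < n → conv a b k = 0) (i k : Fin 2) :
    ∑ j, fres inf_le_left (matA (π := π) (A := A) a b i j) * H.mat₁ b j k =
      ∑ j, H.mat₂ a i j * fres inf_le_right (H.matB a b j k) := by
  have h := congrArg (fres (inf_le_right : A ⊓ B ≤ B)) (T_pow_mul_add (π := π) (T := T) a b hab)
  rw [fres_add, fres_mul, fres_mul, fres_pow, fres_pull, fres_neg] at h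
  have h' := H.pow_mul_inv_pow (n := n)
  fin_cases i <;> fin_cases k <;>
    simp [matA, mat₁, mat₂, matB, Fin.sum_univ_two, fres_one, fres_zero, fres_pow, fres_neg,
      fres_pull, -map_mul]
  · linear_combination -fres (inf_le_right : A ⊓ B ≤ B) (poly π (le_preimage_top π) T a) * h'
  · rw [← h]
    linear_combination -fres (inf_le_right : A ⊓ B ≤ B)
      (poly π (le_preimage_top π) T (fun k : Fin n => conv a b (n + k))) * h'

/-- The morphism `φ` of the standard local model. -/
def stdφ [NeZero n] (hab : ∀ k : ℕ, 1 ≤ k → k < n → conv a b k = 0) :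
    glue (H.mat₁ b) ⟶ glue (H.mat₂ a) :=
  glueMap (H.mat₁ b) (H.mat₂ a) (matA a b) (H.matB a b) (H.mat_comm a b hab)

/-- The quotient map `h` of the standard local model. -/
def stdH : glue (H.mat₂ a) ⟶ OMod W :=
  glueFst H.cover (H.mat₂ a) (by simp [mat₂]) (by simp [mat₂])

variable {a b} {V V' : W.Opens}

theorem glueA_stdG_zero (s : Γ(glue (H.matL n), V)) (h : V' ≤ V) (h' : V' ≤ A) :
    glueA ((H.stdG b).app V s) h h' 0 = glueA s h h' 0 := by
  rw [stdG, glueA_glueMap]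
  simp [fres_one]

theorem glueA_stdG_one (s : Γ(glue (H.matL n), V)) (h : V' ≤ V) (h' : V' ≤ A) :
    glueA ((H.stdG b).app V s) h h' 1 = 0 := by
  rw [stdG, glueA_glueMap]
  simp [fres_zero]

theorem glueB_stdG_zero (s : Γ(glue (H.matL n), V)) (h : V' ≤ V) (h' : V' ≤ B) :
    glueB ((H.stdG b).app V s) h h' 0 = glueB s h h' 0 := by
  rw [stdG, glueB_glueMap]
  simp [fres_one]

theorem glueB_stdG_one (s : Γ(glue (H.matL n), V)) (h : V' ≤ V) (h' : V' ≤ B) :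
    glueB ((H.stdG b).app V s) h h' 1 = 0 := by
  rw [stdG, glueB_glueMap]
  simp [fres_zero]

theorem fres_stdH_left (s : Γ(glue (H.mat₂ a), V)) (h : V' ≤ V) (h' : V' ≤ A) :
    fres h (toFn (H.stdH a) V s) = glueA s h h' 0 :=
  fres_glueFst_left H.cover s h h'

theorem fres_stdH_right (s : Γ(glue (H.mat₂ a), V)) (h : V' ≤ V) (h' : V' ≤ B) :
    fres h (toFn (H.stdH a) V s) = glueB s h h' 0 :=
  fres_glueFst_right H.cover s h h'

section

variable [NeZero n] {hab : ∀ k : ℕ, 1 ≤ k → k < n → conv a b k = 0}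

theorem glueA_stdφ_zero (s : Γ(glue (H.mat₁ b), V)) (h : V' ≤ V) (h' : V' ≤ A) :
    glueA ((H.stdφ a b hab).app V s) h h' 0 = glueA s h h' 0 := by
  rw [stdφ, glueA_glueMap]
  simp [matA, Fin.sum_univ_two, fres_one, fres_zero]

theorem glueA_stdφ_one (s : Γ(glue (H.mat₁ b), V)) (h : V' ≤ V) (h' : V' ≤ A) :
    glueA ((H.stdφ a b hab).app V s) h h' 1 =
      pull π (le_preimage_top π) (a 0 * b 0) * glueA s h h' 1 := by
  rw [stdφ, glueA_glueMap]
  simp [matA, Fin.sum_univ_two, fres_zero, fres_pull, -map_mul]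

theorem glueB_stdφ_zero (s : Γ(glue (H.mat₁ b), V)) (h : V' ≤ V) (h' : V' ≤ B) :
    glueB ((H.stdφ a b hab).app V s) h h' 0 = fres h' T ^ n * glueB s h h' 0 +
      poly π (le_preimage_top π) (fres h' T) b * glueB s h h' 1 := by
  rw [stdφ, glueB_glueMap]
  simp [matB, Fin.sum_univ_two, fres_pow, fres_poly]

theorem glueB_stdφ_one (s : Γ(glue (H.mat₁ b), V)) (h : V' ≤ V) (h' : V' ≤ B) :
    glueB ((H.stdφ a b hab).app V s) h h' 1 =
      -poly π (le_preimage_top π) (fres h' T) a * glueB s h h' 0 -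
        poly π (le_preimage_top π) (fres h' T) (fun k : Fin n => conv a b (n + k)) *
          glueB s h h' 1 := by
  rw [stdφ, glueB_glueMap]
  simp [matB, Fin.sum_univ_two, fres_neg, fres_poly]
  ring

theorem fres_stdComp_left (s : Γ(glue (H.matL n), V)) (h : V' ≤ V) (h' : V' ≤ A) :
    fres h (toFn (H.stdG b ≫ H.stdφ a b hab ≫ H.stdH a) V s) = glueA s h h' 0 := by
  rw [toFn_comp, toFn_comp, H.fres_stdH_left _ h h', glueA_stdφ_zero, glueA_stdG_zero]

theorem fres_stdComp_right (s : Γ(glue (H.matL n), V)) (h : V' ≤ V) (h' : V' ≤ B) :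
    fres h (toFn (H.stdG b ≫ H.stdφ a b hab ≫ H.stdH a) V s) =
      fres h' T ^ n * glueB s h h' 0 := by
  rw [toFn_comp, toFn_comp, H.fres_stdH_right _ h h', glueB_stdφ_zero, glueB_stdG_zero,
    glueB_stdG_one, mul_zero, add_zero]

end

end SectionCoord

end
end PicardLefschetz

/-! ### The standard model as an `S`-point over `n x` -/

namespace PicardLefschetz
noncomputable section

theorem exists_glueA {X : Scheme.{u}} {A B : X.Opens} {r : ℕ}
    {M M' : Matrix (Fin r) (Fin r) Γ(X, A ⊓ B)} (hM : M * M' = 1) {V : X.Opens} (hV : V ≤ A)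
    (c : Fin r → Γ(X, V)) : ∃ s : Γ(glue M, V), ∀ i, glueA s le_rfl hV i = c i := by
  obtain ⟨s, hs⟩ := (bijective_glueA hM hV).2 c
  exact ⟨s, congrFun hs⟩

theorem exists_glueB {X : Scheme.{u}} {A B : X.Opens} {r : ℕ}
    (M : Matrix (Fin r) (Fin r) Γ(X, A ⊓ B)) {V : X.Opens} (hV : V ≤ B)
    (c : Fin r → Γ(X, V)) : ∃ s : Γ(glue M, V), ∀ i, glueB s le_rfl hV i = c i := by
  obtain ⟨s, hs⟩ := (bijective_glueB hV).2 c
  exact ⟨s, congrFun hs⟩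

theorem glueB_ext {X : Scheme.{u}} {A B : X.Opens} {r : ℕ}
    {M : Matrix (Fin r) (Fin r) Γ(X, A ⊓ B)} {V : X.Opens} (hV : V ≤ B) {s t : Γ(glue M, V)}
    (h : ∀ i, glueB s le_rfl hV i = glueB t le_rfl hV i) : s = t :=
  (bijective_glueB hV).1 (funext h)

theorem zeroIdeal_eq {X : Scheme.{u}} {L : X.Modules} {c : L ⟶ OMod X} {J : X.IdealSheafData}
    (h : ∀ V : X.affineOpens, LinearMap.range (toFn c V.1) = J.ideal V) : zeroIdeal c = J :=
  (congrArg Scheme.IdealSheafData.ofIdeals (funext h)).trans J.ofIdeals_ideal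

/-- The relative curve `X × S`, with the ideal sheaf `J` of `n` times the section `σ`. -/
structure CurveCoord {B₀ : Scheme.{u}} (n : ℕ) (X S : Over B₀) (J : (prod X S).IdealSheafData)
    (σ : S.left ⟶ prod X S) (A B : (prod X S).Opens) (T : Γ(prod X S, B)) : Prop
    extends SectionCoord (pr₂ X S) σ A B T where
  exists_const : ∀ f : Γ(prod X S, ⊤), ∃ c, f = constFn X S ⊤ c
  exists_geomPt : ∀ y, ∃ (s : GeomPt S) (z : prod X s.over), s.fib X z = σ y
  exists_fib_mem : ∀ s : GeomPt S, ∃ z : prod X s.over, s.fib X z ∈ A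
  mem_ideal : ∀ (V : (prod X S).affineOpens) (f : Γ(prod X S, V)), f ∈ J.ideal V ↔
    ∃ g : Γ(prod X S, V ⊓ B), fres inf_le_left f = fres inf_le_right T ^ n * g
  degree : ∀ s : GeomPt S, degOver ((J.comap (s.fib X)).subschemeι ≫ pr₂ X s.over) = n

namespace CurveCoord

variable {B₀ : Scheme.{u}} {n : ℕ} {X S : Over B₀} {J : (prod X S).IdealSheafData}
  {σ : S.left ⟶ prod X S} {A B : (prod X S).Opens} {T : Γ(prod X S, B)}
  (C : CurveCoord n X S J σ A B T)
include C

section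

variable {a b : Fin n → Γ(S.left, ⊤)} [NeZero n]
  {hab : ∀ k : ℕ, 1 ≤ k → k < n → conv a b k = 0}

/-- In coordinates the composite is the identity over `A` and multiplication by the regular element
`Tⁿ` over `B`. -/
theorem injective_stdComp (V : (prod X S).Opens) : Function.Injective
    (toFn (C.stdG b ≫ C.stdφ a b hab ≫ C.stdH a) V) := by
  intro s t e
  refine glue_ext (fun i => ?_) (fun i => ?_)
  · rw [Subsingleton.elim i 0, ← C.fres_stdComp_left (hab := hab), e, C.fres_stdComp_left]
  · rw [Subsingleton.elim i 0]
    refine C.pow_mul_cancel inf_le_right n ?_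
    rw [← C.fres_stdComp_right (hab := hab), e, C.fres_stdComp_right]

theorem mem_range_stdComp {V : (prod X S).Opens} {f : Γ(prod X S, V)} :
    f ∈ LinearMap.range (toFn (C.stdG b ≫ C.stdφ a b hab ≫ C.stdH a) V) ↔
      ∃ g : Γ(prod X S, V ⊓ B), fres inf_le_left f = fres inf_le_right T ^ n * g := by
  constructor
  · rintro ⟨s, rfl⟩
    exact ⟨_, C.fres_stdComp_right s inf_le_left inf_le_right⟩
  · rintro ⟨g, hg⟩
    -- The relation `f = Tⁿ g` is exactly the gluing condition for `L`.
    let s : Γ(glue (C.matL n), V) :=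
      glueMk (fun _ => fres inf_le_left f) (fun _ => g) (fun i => by
        have := congrArg (fres (le_inf inf_le_left (inf_le_right.trans inf_le_right) :
          V ⊓ (A ⊓ B) ≤ V ⊓ B)) hg
        rw [fres_fres, fres_mul, fres_pow, fres_fres] at this
        fin_cases i
        simpa [SectionCoord.matL, fres_fres, fres_pow] using this)
    refine ⟨s, fn_ext_cover C.cover ?_ ?_⟩
    · rw [C.fres_stdComp_left _ _ inf_le_right, glueA_glueMk, fres_fres]
    · rw [C.fres_stdComp_right _ _ inf_le_right, glueB_glueMk, fres_self, hg]

theorem zeroIdeal_stdComp : zeroIdeal (C.stdG b ≫ C.stdφ a b hab ≫ C.stdH a) = J := by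
  refine zeroIdeal_eq fun V => ?_
  ext f
  exact (C.mem_range_stdComp (hab := hab)).trans (C.mem_ideal V f).symm

theorem exists_stdComp_eq_one : ∃ l, toFn (C.stdG b ≫ C.stdφ a b hab ≫ C.stdH a) A l = 1 := by
  obtain ⟨l, hl⟩ := exists_glueA C.matL_mul (le_refl A) fun _ => 1
  refine ⟨l, ?_⟩
  rw [← fres_self (toFn _ _ l), C.fres_stdComp_left _ _ le_rfl, hl]

theorem not_vanishesAt_stdComp {z : prod X S} (hz : z ∈ A) :
    ¬ VanishesAt (C.stdG b ≫ C.stdφ a b hab ≫ C.stdH a) z := by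
  obtain ⟨l, hl⟩ := C.exists_stdComp_eq_one (hab := hab)
  exact not_vanishesAt_of_toFn_eq_one hz hl

omit [NeZero n] in
theorem not_vanishesAt_stdG (z : prod X S) : ¬ VanishesAt (C.stdG b) z := by
  have hz : z ∈ A ⊔ B := by rw [C.cover]; trivial
  rcases hz with hz | hz
  · obtain ⟨l, hl⟩ := exists_glueA C.matL_mul (le_refl A) fun _ => 1
    obtain ⟨d, hd⟩ := exists_glueA (C.mat₁_mul b) (le_refl A) ![0, 1]
    refine not_vanishesAt_of_form_eq_one (glueSL2 C.cover _ _ (C.mat₁_mul b) (C.mat₁_det b))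
      hz (s := l) (d := d) ?_
    rw [glueSL2_form, glueForm_eq_left _ _ _ le_rfl, C.glueA_stdG_zero, C.glueA_stdG_one, hl, hd]
    simp
  · obtain ⟨l, hl⟩ := exists_glueB (C.matL n) (le_refl B) fun _ => 1
    obtain ⟨d, hd⟩ := exists_glueB (C.mat₁ b) (le_refl B) ![0, 1]
    refine not_vanishesAt_of_form_eq_one (glueSL2 C.cover _ _ (C.mat₁_mul b) (C.mat₁_det b))
      hz (s := l) (d := d) ?_
    rw [glueSL2_form, glueForm_eq_right _ _ _ le_rfl, C.glueB_stdG_zero, C.glueB_stdG_one, hl, hd]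
    simp

omit [NeZero n] in
theorem epi_stdH : Epi (C.stdH a) := by
  refine epi_of_locally_one fun z => ?_
  have hz : z ∈ A ⊔ B := by rw [C.cover]; trivial
  rcases hz with hz | hz
  · obtain ⟨e, he⟩ := exists_glueA (C.mat₂_mul a) (le_refl A) ![1, 0]
    refine ⟨A, hz, e, ?_⟩
    rw [← fres_self (toFn _ _ e), C.fres_stdH_left _ _ le_rfl, he]
    rfl
  · obtain ⟨e, he⟩ := exists_glueB (C.mat₂ a) (le_refl B) ![1, 0]
    refine ⟨B, hz, e, ?_⟩
    rw [← fres_self (toFn _ _ e), C.fres_stdH_right _ _ le_rfl, he]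
    rfl

variable (a b hab) in
/-- The standard local model with coordinates `a`, `b`. -/
def std : LocalModel n X S where
  L := glue (C.matL n)
  E₁ := glue (C.mat₁ b)
  E₂ := glue (C.mat₂ a)
  vol₁ := glueSL2 C.cover _ _ (C.mat₁_mul b) (C.mat₁_det b)
  vol₂ := glueSL2 C.cover _ _ (C.mat₂_mul a) (C.mat₂_det a)
  g := C.stdG b
  φ := C.stdφ a b hab
  h := C.stdH a
  isLineBundle := isVectorBundle_glue C.matL_mul C.cover
  subbundle := C.not_vanishesAt_stdG
  quotient := C.epi_stdH
  φ_nonzero s := by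
    obtain ⟨z, hz⟩ := C.exists_fib_mem s
    exact ⟨z, fun h => C.not_vanishesAt_stdComp (hab := hab) hz ((h.comp _).precomp _)⟩
  generic_iso s := by
    obtain ⟨z, hz⟩ := C.exists_fib_mem s
    exact ⟨z, C.not_vanishesAt_stdComp hz⟩
  degree s := by
    rw [C.zeroIdeal_stdComp]
    exact C.degree s

theorem toFn_std_comp (V : (prod X S).affineOpens) :
    Function.Injective (toFn (C.std a b hab).comp V.1) ∧
      LinearMap.range (toFn (C.std a b hab).comp V.1) = J.ideal V := by
  refine ⟨C.injective_stdComp (hab := hab) _, ?_⟩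
  ext f
  exact (C.mem_range_stdComp (hab := hab)).trans (C.mem_ideal V f).symm

/-- The standard basis vectors over `B` form an adapted frame; the required relations are entries of
`matB`. -/
theorem isCoord_std : (C.std a b hab).IsCoord σ T ⊤ a b := by
  intro y _
  obtain ⟨l, hl⟩ := exists_glueB (C.matL n) (le_refl B) fun _ => 1
  obtain ⟨q, hq⟩ := exists_glueB (C.mat₁ b) (le_refl B) ![0, 1]
  obtain ⟨e, he⟩ := exists_glueB (C.mat₂ a) (le_refl B) ![1, 0]
  obtain ⟨w, hw⟩ := exists_glueB (C.mat₂ a) (le_refl B) ![0, 1]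
  have key : fres (le_refl B) T ^ n • e = (C.stdφ a b hab).app B ((C.stdG b).app B l) +
      poly (pr₂ X S) (le_preimage_top _) (fres (le_refl B) T) a • w := by
    refine glueB_ext le_rfl fun i => ?_
    rw [glueB_add, glueB_smul, glueB_smul, hw, he]
    fin_cases i
    · change _ = glueB _ _ _ 0 + _
      rw [C.glueB_stdφ_zero, C.glueB_stdG_zero, C.glueB_stdG_one, hl]
      simp [fres_self]
    · change _ = glueB _ _ _ 1 + _
      rw [C.glueB_stdφ_one, C.glueB_stdG_zero, C.glueB_stdG_one, hl]
      simp [fres_self]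
  have key₁ : glueForm C.cover (C.mat₁ b) (C.mat₁_det b) ((C.stdG b).app B l) q = 1 := by
    rw [glueForm_eq_right _ _ _ le_rfl, C.glueB_stdG_zero, C.glueB_stdG_one, hq, hq, hl]
    simp
  have key₂ : glueForm C.cover (C.mat₂ a) (C.mat₂_det a) e w = 1 := by
    rw [glueForm_eq_right _ _ _ le_rfl, he, he, hw, hw]
    simp
  refine ⟨B, le_rfl, le_preimage_top _, C.mem y, l, q, e, w, ?_, ?_, ?_, ?_, ?_, ?_, ?_⟩
  · refine (fres_self _).symm.trans ((C.fres_stdComp_right (hab := hab) l le_rfl le_rfl).trans ?_)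
    rw [hl, mul_one]
  · exact key₁
  · refine (fres_self _).symm.trans ((C.fres_stdH_right _ le_rfl le_rfl).trans
      ((C.glueB_stdφ_zero (hab := hab) q le_rfl le_rfl).trans ?_))
    rw [hq, hq]
    simp
  · refine (fres_self _).symm.trans ((C.fres_stdH_right e le_rfl le_rfl).trans ?_)
    rw [he]
    rfl
  · refine (fres_self _).symm.trans ((C.fres_stdH_right w le_rfl le_rfl).trans ?_)
    rw [hw]
    rfl
  · exact key₂
  · exact key

end

end CurveCoord

end
end PicardLefschetz

/-! ### Normalisation of an arbitrary point, and tools for comparison -/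

namespace PicardLefschetz
noncomputable section

theorem exists_affineOpen {X : Scheme.{u}} {U : X.Opens} {z : X} (hz : z ∈ U) :
    ∃ V : X.affineOpens, z ∈ V.1 ∧ V.1 ≤ U := by
  obtain ⟨V, hV, hz', h⟩ := exists_isAffineOpen_mem_and_subset hz
  exact ⟨⟨V, hV⟩, hz', h⟩

/-- On affine open sets the image of `comp` is `J`, which contains `1` over `A` and `Tⁿ` over `B`.
The preimages are unique by injectivity, so they glue to `lA` and `lB`. -/
theorem CurveCoord.exists_normalized {B₀ : Scheme.{u}} {n : ℕ} {X S : Over B₀}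
    {J : (prod X S).IdealSheafData} {σ : S.left ⟶ prod X S} {A B : (prod X S).Opens}
    {T : Γ(prod X S, B)} (C : CurveCoord n X S J σ A B T) {ξ : LocalModel n X S}
    (hξ : ∀ V : (prod X S).affineOpens, Function.Injective (toFn ξ.comp V.1) ∧
      LinearMap.range (toFn ξ.comp V.1) = J.ideal V) : ∃ (lA : Γ(ξ.L, A)) (lB : Γ(ξ.L, B)), ξ.Normalized T lA lB := by
  have hmem : ∀ (V : (prod X S).affineOpens) (f : Γ(prod X S, V)),
      (∃ l, toFn ξ.comp V.1 l = f) ↔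
        ∃ g : Γ(prod X S, V ⊓ B), fres inf_le_left f = fres inf_le_right T ^ n * g := by
    intro V f
    rw [← C.mem_ideal V f, ← (hξ V).2]
    rfl
  have hinj : ∀ V : (prod X S).Opens, Function.Injective (toFn ξ.comp V) := by
    intro V s t e
    refine sec_ext fun z hz => ?_
    obtain ⟨V', hz', h⟩ := exists_affineOpen hz
    exact ⟨V', h, hz', (hξ V').1 (by rw [← fres_toFn, ← fres_toFn, e])⟩
  obtain ⟨lA, hA⟩ := exists_section_of_locally (M := ξ.L) (U := A)
    (fun V _ l => toFn ξ.comp V l = 1)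
    (fun _ h s e => by rw [← fres_toFn, e, fres_one])
    (fun _ s t e e' => hinj _ (e.trans e'.symm))
    (fun z hz => by
      obtain ⟨V, hz', h⟩ := exists_affineOpen hz
      refine ⟨V, h, hz', (hmem V 1).mpr ?_⟩
      obtain ⟨g, hg⟩ := ((C.isUnit (inf_le_left.trans h : V.1 ⊓ B ≤ A) inf_le_right).pow n).dvd
        (a := 1)
      exact ⟨g, by rw [fres_one]; exact hg⟩)
  obtain ⟨lB, hB⟩ := exists_section_of_locally (M := ξ.L) (U := B)
    (fun V hV l => toFn ξ.comp V l = fres hV T ^ n)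
    (fun _ h s e => by rw [← fres_toFn, e, fres_pow, fres_fres])
    (fun _ s t e e' => hinj _ (e.trans e'.symm))
    (fun z hz => by
      obtain ⟨V, hz', h⟩ := exists_affineOpen hz
      exact ⟨V, h, hz', (hmem V _).mpr ⟨1, by rw [fres_pow, fres_fres, mul_one]⟩⟩)
  refine ⟨lA, lB, hinj, fn_ext fun z hz => ?_, fn_ext fun z hz => ?_, fun {V} hV l => ?_⟩
  · obtain ⟨V, hV, hz', e⟩ := hA z hz
    exact ⟨V, hV, hz', by rw [fres_toFn, e, fres_one]⟩
  · obtain ⟨V, hV, hz', e⟩ := hB z hz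
    exact ⟨V, hV, hz', by rw [fres_toFn, e, fres_pow]⟩
  · refine C.exists_eq_pow_mul hV _ n fun y hy => ?_
    obtain ⟨V', hz', h⟩ := exists_affineOpen hy
    obtain ⟨g, hg⟩ := (hmem V' (toFn ξ.comp V' (res _ h l))).mp ⟨_, rfl⟩
    refine ⟨V'.1 ⊓ B, inf_le_left.trans h, ⟨hz', C.mem y⟩, g, ?_⟩
    rw [← fres_toFn, fres_fres] at hg
    exact hg

/-- The Plücker relation for `c`, `s` and the section dual to `l`, paired with `t`. It is what makes
the comparison maps preserve volume forms. -/
theorem SL2Structure.toFn_mul_form {X : Scheme.{u}} {E : X.Modules} (v : SL2Structure E)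
    (l : E ⟶ OMod X) {U : X.Opens} (c s t : Γ(E, U)) :
    toFn l U c * v.form U s t = toFn l U s * v.form U c t - v.form U c s * toFn l U t := by
  obtain ⟨d, hd⟩ := v.exists_dual l
  have h := congrArg (fun x => v.form U x t) (v.plucker c (res E le_top d) s)
  simp only [map_smul, map_add, LinearMap.smul_apply, LinearMap.add_apply, smul_eq_mul, hd] at h
  rw [v.form_swap (res E le_top d), hd] at h
  rw [h]
  ring

/-- A unimodular pair is sent to a unimodular pair, which is again a basis by Cramer's rule. -/
theorem SL2Structure.isIso_of_form_eq {X : Scheme.{u}} {E E' : X.Modules} (v : SL2Structure E)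
    (v' : SL2Structure E') {θ : E ⟶ E'}
    (h : ∀ U s t, v'.form U (θ.app U s) (θ.app U t) = v.form U s t) : IsIso θ := by
  refine isIso_of_locally_bijective fun z => ?_
  obtain ⟨V, -, hz, c, d, hcd, -⟩ := v.exists_pair (U := ⊤) (z := z) trivial
  refine ⟨V, hz, fun V' hV' => ?_⟩
  have hcd' : v.form V' (res E hV' c) (res E hV' d) = 1 := by rw [← v.form_res, hcd, fres_one]
  have hcd'' := (h V' (res E hV' c) (res E hV' d)).trans hcd'
  constructor
  · intro s t e
    rw [v.eq_of_form_eq_one hcd' s, v.eq_of_form_eq_one hcd' t, ← h, ← h, ← h, ← h, e]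
  · intro s
    refine ⟨v'.form V' s (θ.app V' (res E hV' d)) • res E hV' c +
      v'.form V' (θ.app V' (res E hV' c)) s • res E hV' d, ?_⟩
    rw [app_add, app_smul, app_smul, ← v'.eq_of_form_eq_one hcd'']

section

variable {R M : Type*} [CommRing R] [AddCommGroup M] [Module R M]

/-- The linear map with a single component. -/
def linearSingle (f : M →ₗ[R] R) : M →ₗ[R] Fin 1 → R :=
  LinearMap.pi fun _ => f

/-- The linear map with two given components. -/
def linearPair (f g : M →ₗ[R] R) : M →ₗ[R] Fin 2 → R :=
  LinearMap.pi ![f, g]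

end

namespace SectionCoord

variable {W S : Scheme.{u}} {π : W ⟶ S} {σ : S ⟶ W} {A B : W.Opens} {T : Γ(W, B)}
  (H : SectionCoord π σ A B T) {N : W.Modules} {V : W.Opens}

/-- The quotient by `Tⁿ` of a linear form with values divisible by `Tⁿ`. -/
def divPow (hV : V ≤ B) (n : ℕ) (f : Γ(N, V) →ₗ[Γ(W, V)] Γ(W, V))
    (h : ∀ s, ∃ r, f s = fres hV T ^ n * r) : Γ(N, V) →ₗ[Γ(W, V)] Γ(W, V) where
  toFun s := (h s).choose
  map_add' s t := H.pow_mul_cancel hV n (by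
    rw [← (h (s + t)).choose_spec, map_add, mul_add, ← (h s).choose_spec, ← (h t).choose_spec])
  map_smul' r s := H.pow_mul_cancel hV n (by
    rw [← (h (r • s)).choose_spec, map_smul, RingHom.id_apply, smul_eq_mul, smul_eq_mul,
      mul_left_comm, ← (h s).choose_spec])

theorem pow_mul_divPow (hV : V ≤ B) (n : ℕ) (f : Γ(N, V) →ₗ[Γ(W, V)] Γ(W, V))
    (h : ∀ s, ∃ r, f s = fres hV T ^ n * r) (s : Γ(N, V)) :
    fres hV T ^ n * H.divPow hV n f h s = f s :=
  (h s).choose_spec.symm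

end SectionCoord

end
end PicardLefschetz

/-! ### The comparison maps to the standard model -/

namespace PicardLefschetz
noncomputable section

namespace LocalModel.Normalized

variable {B₀ : Scheme.{u}} {n : ℕ} {X S : Over B₀} {ξ : LocalModel n X S}
  {A B : (prod X S).Opens} {T : Γ(prod X S, B)} {lA : Γ(ξ.L, A)} {lB : Γ(ξ.L, B)}
  {σ : S.left ⟶ prod X S} {a b : Fin n → Γ(S.left, ⊤)} (K : ξ.Normalized T lA lB)
  (H : SectionCoord (pr₂ X S) σ A B T) (hc : ξ.IsCoord σ T ⊤ a b)
  {V V' : (prod X S).Opens}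

include K in
theorem form_lB₁ (hA : V ≤ A) (hB : V ≤ B) (s : Γ(ξ.E₁, V)) :
    ξ.vol₁.form V (ξ.g.app V (res _ hB lB)) s =
      fres hB T ^ n * ξ.vol₁.form V (ξ.g.app V (res _ hA lA)) s := by
  rw [K.lB_eq_smul_lA hA hB, app_smul, map_smul, LinearMap.smul_apply, smul_eq_mul]

include K in
theorem form_lB₂ (hA : V ≤ A) (hB : V ≤ B) (s : Γ(ξ.E₂, V)) :
    ξ.vol₂.form V (ξ.φ.app V (ξ.g.app V (res _ hB lB))) s =
      fres hB T ^ n * ξ.vol₂.form V (ξ.φ.app V (ξ.g.app V (res _ hA lA))) s := by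
  rw [K.lB_eq_smul_lA hA hB, app_smul, app_smul, map_smul, LinearMap.smul_apply, smul_eq_mul]

/-- The linear form `s ↦ h φ s - β vol(g l, s)` on `E₁`. -/
def num₁ (ξ : LocalModel n X S) (T : Γ(prod X S, B)) (lB : Γ(ξ.L, B))
    (b : Fin n → Γ(S.left, ⊤)) (hV : V ≤ B) : Γ(ξ.E₁, V) →ₗ[Γ(prod X S, V)] Γ(prod X S, V) :=
  toFn (ξ.φ ≫ ξ.h) V - poly (pr₂ X S) (le_preimage_top _) (fres hV T) b •
    ξ.vol₁.form V (ξ.g.app V (res _ hV lB))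

/-- The linear form `s ↦ vol(φ g l, s) - α h s` on `E₂`. -/
def num₂ (ξ : LocalModel n X S) (T : Γ(prod X S, B)) (lB : Γ(ξ.L, B))
    (a : Fin n → Γ(S.left, ⊤)) (hV : V ≤ B) : Γ(ξ.E₂, V) →ₗ[Γ(prod X S, V)] Γ(prod X S, V) :=
  ξ.vol₂.form V (ξ.φ.app V (ξ.g.app V (res _ hV lB))) -
    poly (pr₂ X S) (le_preimage_top _) (fres hV T) a • toFn ξ.h V

theorem num₁_apply (hV : V ≤ B) (s : Γ(ξ.E₁, V)) : num₁ ξ T lB b hV s =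
    toFn ξ.h V (ξ.φ.app V s) - poly (pr₂ X S) (le_preimage_top _) (fres hV T) b *
      ξ.vol₁.form V (ξ.g.app V (res _ hV lB)) s := rfl

theorem num₂_apply (hV : V ≤ B) (s : Γ(ξ.E₂, V)) : num₂ ξ T lB a hV s =
    ξ.vol₂.form V (ξ.φ.app V (ξ.g.app V (res _ hV lB))) s -
      poly (pr₂ X S) (le_preimage_top _) (fres hV T) a * toFn ξ.h V s := rfl

theorem fres_num₁ (hV : V ≤ B) (h : V' ≤ V) (s : Γ(ξ.E₁, V)) :
    fres h (num₁ ξ T lB b hV s) = num₁ ξ T lB b (h.trans hV) (res _ h s) := by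
  rw [num₁_apply, num₁_apply, fres_sub, fres_mul, fres_toFn, fres_poly, fres_fres, ξ.vol₁.form_res,
    res_app, res_app, res_res]

theorem fres_num₂ (hV : V ≤ B) (h : V' ≤ V) (s : Γ(ξ.E₂, V)) :
    fres h (num₂ ξ T lB a hV s) = num₂ ξ T lB a (h.trans hV) (res _ h s) := by
  rw [num₂_apply, num₂_apply, fres_sub, fres_mul, fres_toFn, fres_poly, fres_fres, ξ.vol₂.form_res,
    res_app, res_app, res_res]

section

include K H hc

/-- Near the section, the numerator is `Tⁿ` times the coefficient of `g l` in an adapted frame. This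
is where the coordinates `b` enter the comparison. -/
theorem exists_num₁ (hV : V ≤ B) (s : Γ(ξ.E₁, V)) :
    ∃ r, num₁ ξ T lB b hV s = fres hV T ^ n * r := by
  refine H.exists_eq_pow_mul hV _ n fun y hy => ?_
  obtain ⟨V', hB, hV', hyV, N, hN, h, h', l, q, e, w, F⟩ := hc.exists_frame H y hy
  obtain rfl : l = res _ _ lB := K.l_eq F
  refine ⟨V', hV', hyV, ξ.vol₁.form V' (res _ hV' s) q, ?_⟩
  rw [fres_num₁, num₁_apply, F.hφ_eq, add_sub_cancel_right]

/-- Here the quotient is the coefficient of `w`, and the coordinates `a` enter. -/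
theorem exists_num₂ (hV : V ≤ B) (s : Γ(ξ.E₂, V)) :
    ∃ r, num₂ ξ T lB a hV s = fres hV T ^ n * r := by
  refine H.exists_eq_pow_mul hV _ n fun y hy => ?_
  obtain ⟨V', hB, hV', hyV, N, hN, h, h', l, q, e, w, F⟩ := hc.exists_frame H y hy
  obtain rfl : l = res _ _ lB := K.l_eq F
  refine ⟨V', hV', hyV, ξ.vol₂.form V' e (res _ hV' s), ?_⟩
  rw [fres_num₂, num₂_apply, F.form_φ_l, add_sub_cancel_right]

omit hc in
/-- The comparison of `L` with the standard bundle, over `A` and over `B`. -/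
theorem fres_divL (hV : V ≤ B) (h : V' ≤ V) (s : Γ(ξ.L, V)) :
    fres h (H.divPow hV n (toFn ξ.comp V) (K.dvd hV) s) =
      H.divPow (h.trans hV) n (toFn ξ.comp V') (K.dvd _) (res _ h s) :=
  H.pow_mul_cancel (h.trans hV) n (by
    rw [H.pow_mul_divPow, ← fres_toFn, ← H.pow_mul_divPow hV n _ (K.dvd hV), fres_mul, fres_pow,
      fres_fres])

theorem fres_div₁ (hV : V ≤ B) (h : V' ≤ V) (s : Γ(ξ.E₁, V)) :
    fres h (H.divPow hV n (num₁ ξ T lB b hV) (K.exists_num₁ H hc hV) s) =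
      H.divPow (h.trans hV) n (num₁ ξ T lB b _) (K.exists_num₁ H hc _) (res _ h s) :=
  H.pow_mul_cancel (h.trans hV) n (by
    rw [H.pow_mul_divPow, ← fres_num₁ hV h, ← H.pow_mul_divPow hV n _ (K.exists_num₁ H hc hV),
      fres_mul, fres_pow, fres_fres])

theorem fres_div₂ (hV : V ≤ B) (h : V' ≤ V) (s : Γ(ξ.E₂, V)) :
    fres h (H.divPow hV n (num₂ ξ T lB a hV) (K.exists_num₂ H hc hV) s) =
      H.divPow (h.trans hV) n (num₂ ξ T lB a _) (K.exists_num₂ H hc _) (res _ h s) :=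
  H.pow_mul_cancel (h.trans hV) n (by
    rw [H.pow_mul_divPow, ← fres_num₂ hV h, ← H.pow_mul_divPow hV n _ (K.exists_num₂ H hc hV),
      fres_mul, fres_pow, fres_fres])

end

variable (ξ)

/-- The coordinates of a section of `L` over `A`. -/
def coordLA (V : (prod X S).Opens) (_ : V ≤ A) :
    Γ(ξ.L, V) →ₗ[Γ(prod X S, V)] Fin 1 → Γ(prod X S, V) :=
  linearSingle (toFn ξ.comp V)

/-- The coordinates of a section of `E₁` over `A`. -/
def coord₁A (lA : Γ(ξ.L, A)) (V : (prod X S).Opens) (hV : V ≤ A) :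
    Γ(ξ.E₁, V) →ₗ[Γ(prod X S, V)] Fin 2 → Γ(prod X S, V) :=
  linearPair (toFn (ξ.φ ≫ ξ.h) V) (ξ.vol₁.form V (ξ.g.app V (res _ hV lA)))

/-- The coordinates of a section of `E₂` over `A`. -/
def coord₂A (lA : Γ(ξ.L, A)) (V : (prod X S).Opens) (hV : V ≤ A) :
    Γ(ξ.E₂, V) →ₗ[Γ(prod X S, V)] Fin 2 → Γ(prod X S, V) :=
  linearPair (toFn ξ.h V) (ξ.vol₂.form V (ξ.φ.app V (ξ.g.app V (res _ hV lA))))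

variable {ξ}

/-- The coordinates of a section of `L` over `B`. -/
def coordLB (V : (prod X S).Opens) (hV : V ≤ B) :
    Γ(ξ.L, V) →ₗ[Γ(prod X S, V)] Fin 1 → Γ(prod X S, V) :=
  linearSingle (H.divPow hV n (toFn ξ.comp V) (K.dvd hV))

/-- The coordinates of a section of `E₁` over `B`. -/
def coord₁B (V : (prod X S).Opens) (hV : V ≤ B) :
    Γ(ξ.E₁, V) →ₗ[Γ(prod X S, V)] Fin 2 → Γ(prod X S, V) :=
  linearPair (H.divPow hV n (num₁ ξ T lB b hV) (K.exists_num₁ H hc hV))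
    (ξ.vol₁.form V (ξ.g.app V (res _ hV lB)))

/-- The coordinates of a section of `E₂` over `B`. -/
def coord₂B (V : (prod X S).Opens) (hV : V ≤ B) :
    Γ(ξ.E₂, V) →ₗ[Γ(prod X S, V)] Fin 2 → Γ(prod X S, V) :=
  linearPair (toFn ξ.h V) (H.divPow hV n (num₂ ξ T lB a hV) (K.exists_num₂ H hc hV))

theorem fres_coordLA (hV : V ≤ A) (h : V' ≤ V) (s : Γ(ξ.L, V)) (i : Fin 1) :
    fres h (coordLA ξ V hV s i) = coordLA ξ V' (h.trans hV) (res _ h s) i :=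
  fres_toFn ξ.comp h s

theorem fres_coordLB (hV : V ≤ B) (h : V' ≤ V) (s : Γ(ξ.L, V)) (i : Fin 1) :
    fres h (K.coordLB H V hV s i) = K.coordLB H V' (h.trans hV) (res _ h s) i :=
  K.fres_divL H _ _ _

theorem fres_coord₁A (hV : V ≤ A) (h : V' ≤ V) (s : Γ(ξ.E₁, V)) (i : Fin 2) :
    fres h (coord₁A ξ lA V hV s i) = coord₁A ξ lA V' (h.trans hV) (res _ h s) i := by
  fin_cases i
  · exact fres_toFn (ξ.φ ≫ ξ.h) h s
  · exact (ξ.vol₁.form_res _ _ _).trans (by rw [res_app, res_res]; rfl)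

theorem fres_coord₁B (hV : V ≤ B) (h : V' ≤ V) (s : Γ(ξ.E₁, V)) (i : Fin 2) :
    fres h (K.coord₁B H hc V hV s i) = K.coord₁B H hc V' (h.trans hV) (res _ h s) i := by
  fin_cases i
  · exact K.fres_div₁ H hc _ _ _
  · exact (ξ.vol₁.form_res _ _ _).trans (by rw [res_app, res_res]; rfl)

theorem fres_coord₂A (hV : V ≤ A) (h : V' ≤ V) (s : Γ(ξ.E₂, V)) (i : Fin 2) :
    fres h (coord₂A ξ lA V hV s i) = coord₂A ξ lA V' (h.trans hV) (res _ h s) i := by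
  fin_cases i
  · exact fres_toFn ξ.h h s
  · exact (ξ.vol₂.form_res _ _ _).trans (by rw [res_app, res_app, res_res]; rfl)

theorem fres_coord₂B (hV : V ≤ B) (h : V' ≤ V) (s : Γ(ξ.E₂, V)) (i : Fin 2) :
    fres h (K.coord₂B H hc V hV s i) = K.coord₂B H hc V' (h.trans hV) (res _ h s) i := by
  fin_cases i
  · exact fres_toFn ξ.h h s
  · exact K.fres_div₂ H hc _ _ _

theorem coordL_eq (hV : V ≤ A) (hV' : V ≤ B) (s : Γ(ξ.L, V)) (i : Fin 1) :
    coordLA ξ V hV s i =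
      ∑ j, fres (le_inf hV hV') (H.matL n i j) * K.coordLB H V hV' s j := by
  fin_cases i
  simp only [Fin.sum_univ_one]
  change toFn ξ.comp V s = fres (le_inf hV hV') (fres inf_le_right T ^ n) *
    H.divPow hV' n (toFn ξ.comp V) (K.dvd hV') s
  rw [fres_pow, fres_fres, H.pow_mul_divPow]

/-- The coordinates with respect to `u₁ = g lA` and `v₁ ∈ ker hφ` are `hφ s` and `vol(u₁, s)`. For
`s = x (g l) + y q` one has `hφ s = Tⁿ x + β y`, while `g lB = Tⁿ u₁` gives `vol(u₁, s) = T⁻ⁿ y`: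
the rows of `mat₁`. -/
theorem coord₁_eq (hV : V ≤ A) (hV' : V ≤ B) (s : Γ(ξ.E₁, V)) (i : Fin 2) :
    coord₁A ξ lA V hV s i =
      ∑ j, fres (le_inf hV hV') (H.mat₁ b i j) * K.coord₁B H hc V hV' s j := by
  rw [Fin.sum_univ_two]
  fin_cases i
  · change toFn ξ.h V (ξ.φ.app V s) = fres (le_inf hV hV') (fres inf_le_right T ^ n) *
      H.divPow hV' n _ (K.exists_num₁ H hc hV') s +
        fres (le_inf hV hV') (fres inf_le_right (poly (pr₂ X S) (le_preimage_top _) T b)) *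
          ξ.vol₁.form V (ξ.g.app V (res _ hV' lB)) s
    rw [fres_pow, fres_fres, H.pow_mul_divPow, num₁_apply, fres_fres, fres_poly, sub_add_cancel]
  · change ξ.vol₁.form V (ξ.g.app V (res _ hV lA)) s = fres (le_inf hV hV') 0 *
      H.divPow hV' n _ (K.exists_num₁ H hc hV') s +
        fres (le_inf hV hV') (H.inv ^ n) * ξ.vol₁.form V (ξ.g.app V (res _ hV' lB)) s
    have := congrArg (fres (le_inf hV hV')) (H.pow_mul_inv_pow (n := n))
    rw [fres_mul, fres_pow, fres_fres, fres_one] at this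
    rw [K.form_lB₁ hV hV', fres_zero]
    linear_combination -ξ.vol₁.form V (ξ.g.app V (res _ hV lA)) s * this

/-- For `s = x e + y w` one has `h s = x` and `vol(φ g lB, s) = α x + Tⁿ y`; dividing the latter by
`Tⁿ` gives the second row of `mat₂`. -/
theorem coord₂_eq (hV : V ≤ A) (hV' : V ≤ B) (s : Γ(ξ.E₂, V)) (i : Fin 2) :
    coord₂A ξ lA V hV s i =
      ∑ j, fres (le_inf hV hV') (H.mat₂ a i j) * K.coord₂B H hc V hV' s j := by
  rw [Fin.sum_univ_two]
  fin_cases i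
  · change toFn ξ.h V s = fres (le_inf hV hV') 1 * toFn ξ.h V s +
      fres (le_inf hV hV') 0 * H.divPow hV' n _ (K.exists_num₂ H hc hV') s
    rw [fres_one, fres_zero]
    ring
  · change ξ.vol₂.form V (ξ.φ.app V (ξ.g.app V (res _ hV lA))) s =
      fres (le_inf hV hV') (H.inv ^ n * fres inf_le_right
        (poly (pr₂ X S) (le_preimage_top _) T a)) * toFn ξ.h V s +
          fres (le_inf hV hV') 1 * H.divPow hV' n _ (K.exists_num₂ H hc hV') s
    have := congrArg (fres (le_inf hV hV')) (H.pow_mul_inv_pow (n := n))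
    rw [fres_mul, fres_pow, fres_fres, fres_one] at this
    refine H.pow_mul_cancel hV' n ?_
    have e := H.pow_mul_divPow hV' n _ (K.exists_num₂ H hc hV') s
    rw [num₂_apply] at e
    rw [← K.form_lB₂ hV hV', mul_add, fres_one, one_mul, e, fres_mul, fres_fres, fres_poly]
    linear_combination -poly (pr₂ X S) (le_preimage_top _) (fres hV' T) a * toFn ξ.h V s * this

/-- The comparison of `L` with the standard bundle. -/
def θL : ξ.L ⟶ glue (H.matL n) :=
  homToGlue (H.matL n) (coordLA ξ) (K.coordLB H) fres_coordLA (K.fres_coordLB H) (K.coordL_eq H)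

/-- The comparison of `E₁` with the standard bundle. -/
def θ₁ : ξ.E₁ ⟶ glue (H.mat₁ b) :=
  homToGlue (H.mat₁ b) (coord₁A ξ lA) (K.coord₁B H hc) fres_coord₁A (K.fres_coord₁B H hc)
    (K.coord₁_eq H hc)

/-- The comparison of `E₂` with the standard bundle. -/
def θ₂ : ξ.E₂ ⟶ glue (H.mat₂ a) :=
  homToGlue (H.mat₂ a) (coord₂A ξ lA) (K.coord₂B H hc) fres_coord₂A (K.fres_coord₂B H hc)
    (K.coord₂_eq H hc)

end LocalModel.Normalized

end
end PicardLefschetz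

/-! ### The comparison maps respect the whole structure -/

namespace PicardLefschetz
noncomputable section

namespace LocalModel

variable {B₀ : Scheme.{u}} {n : ℕ} {X S : Over B₀}

namespace Normalized

variable {ξ : LocalModel n X S}
  {A B : (prod X S).Opens} {T : Γ(prod X S, B)} {lA : Γ(ξ.L, A)} {lB : Γ(ξ.L, B)}
  {σ : S.left ⟶ prod X S} {a b : Fin n → Γ(S.left, ⊤)} (K : ξ.Normalized T lA lB)
  (H : SectionCoord (pr₂ X S) σ A B T) (hc : ξ.IsCoord σ T ⊤ a b)
  {V V' : (prod X S).Opens}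

theorem glueA_θL (s : Γ(ξ.L, V)) (h : V' ≤ V) (h' : V' ≤ A) (i : Fin 1) :
    glueA ((K.θL H).app V s) h h' i = toFn ξ.comp V' (res _ h s) := by
  rw [θL, glueA_homToGlue (hA := fres_coordLA) (hB := K.fres_coordLB H) (hM := K.coordL_eq H)]
  rfl

theorem pow_mul_glueB_θL (s : Γ(ξ.L, V)) (h : V' ≤ V) (h' : V' ≤ B) (i : Fin 1) :
    fres h' T ^ n * glueB ((K.θL H).app V s) h h' i = toFn ξ.comp V' (res _ h s) := by
  rw [θL, glueB_homToGlue (hA := fres_coordLA) (hB := K.fres_coordLB H) (hM := K.coordL_eq H)]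
  exact H.pow_mul_divPow h' n _ (K.dvd h') _

theorem glueA_θ₁_zero (s : Γ(ξ.E₁, V)) (h : V' ≤ V) (h' : V' ≤ A) :
    glueA ((K.θ₁ H hc).app V s) h h' 0 = toFn ξ.h V' (ξ.φ.app V' (res _ h s)) := by
  rw [θ₁, glueA_homToGlue (hA := fres_coord₁A) (hB := K.fres_coord₁B H hc)
    (hM := K.coord₁_eq H hc)]
  rfl

theorem glueA_θ₁_one (s : Γ(ξ.E₁, V)) (h : V' ≤ V) (h' : V' ≤ A) :
    glueA ((K.θ₁ H hc).app V s) h h' 1 =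
      ξ.vol₁.form V' (ξ.g.app V' (res _ h' lA)) (res _ h s) := by
  rw [θ₁, glueA_homToGlue (hA := fres_coord₁A) (hB := K.fres_coord₁B H hc)
    (hM := K.coord₁_eq H hc)]
  rfl

theorem pow_mul_glueB_θ₁_zero (s : Γ(ξ.E₁, V)) (h : V' ≤ V) (h' : V' ≤ B) :
    fres h' T ^ n * glueB ((K.θ₁ H hc).app V s) h h' 0 =
      toFn ξ.h V' (ξ.φ.app V' (res _ h s)) - poly (pr₂ X S) (le_preimage_top _) (fres h' T) b *
        ξ.vol₁.form V' (ξ.g.app V' (res _ h' lB)) (res _ h s) := by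
  rw [θ₁, glueB_homToGlue (hA := fres_coord₁A) (hB := K.fres_coord₁B H hc)
    (hM := K.coord₁_eq H hc)]
  exact H.pow_mul_divPow h' n _ (K.exists_num₁ H hc h') _

theorem glueB_θ₁_one (s : Γ(ξ.E₁, V)) (h : V' ≤ V) (h' : V' ≤ B) :
    glueB ((K.θ₁ H hc).app V s) h h' 1 =
      ξ.vol₁.form V' (ξ.g.app V' (res _ h' lB)) (res _ h s) := by
  rw [θ₁, glueB_homToGlue (hA := fres_coord₁A) (hB := K.fres_coord₁B H hc)
    (hM := K.coord₁_eq H hc)]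
  rfl

theorem glueA_θ₂_zero (s : Γ(ξ.E₂, V)) (h : V' ≤ V) (h' : V' ≤ A) :
    glueA ((K.θ₂ H hc).app V s) h h' 0 = toFn ξ.h V' (res _ h s) := by
  rw [θ₂, glueA_homToGlue (hA := fres_coord₂A) (hB := K.fres_coord₂B H hc)
    (hM := K.coord₂_eq H hc)]
  rfl

theorem glueA_θ₂_one (s : Γ(ξ.E₂, V)) (h : V' ≤ V) (h' : V' ≤ A) :
    glueA ((K.θ₂ H hc).app V s) h h' 1 =
      ξ.vol₂.form V' (ξ.φ.app V' (ξ.g.app V' (res _ h' lA))) (res _ h s) := by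
  rw [θ₂, glueA_homToGlue (hA := fres_coord₂A) (hB := K.fres_coord₂B H hc)
    (hM := K.coord₂_eq H hc)]
  rfl

theorem glueB_θ₂_zero (s : Γ(ξ.E₂, V)) (h : V' ≤ V) (h' : V' ≤ B) :
    glueB ((K.θ₂ H hc).app V s) h h' 0 = toFn ξ.h V' (res _ h s) := by
  rw [θ₂, glueB_homToGlue (hA := fres_coord₂A) (hB := K.fres_coord₂B H hc)
    (hM := K.coord₂_eq H hc)]
  rfl

theorem pow_mul_glueB_θ₂_one (s : Γ(ξ.E₂, V)) (h : V' ≤ V) (h' : V' ≤ B) :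
    fres h' T ^ n * glueB ((K.θ₂ H hc).app V s) h h' 1 =
      ξ.vol₂.form V' (ξ.φ.app V' (ξ.g.app V' (res _ h' lB))) (res _ h s) -
        poly (pr₂ X S) (le_preimage_top _) (fres h' T) a * toFn ξ.h V' (res _ h s) := by
  rw [θ₂, glueB_homToGlue (hA := fres_coord₂A) (hB := K.fres_coord₂B H hc)
    (hM := K.coord₂_eq H hc)]
  exact H.pow_mul_divPow h' n _ (K.exists_num₂ H hc h') _

/-- Apply `toFn_mul_form` to the functional `hφ` and to `g lA`, where it is `1`, or to `g lB`, where
it is `Tⁿ`. Over `B` the terms with `β` cancel and `Tⁿ` is divided out. -/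
theorem glueForm_θ₁ (s t : Γ(ξ.E₁, V)) :
    glueForm H.cover (H.mat₁ b) (H.mat₁_det b) ((K.θ₁ H hc).app V s) ((K.θ₁ H hc).app V t) =
      ξ.vol₁.form V s t := by
  refine glueForm_ext H.cover ?_ ?_
  · simp only [glueA_θ₁_zero, glueA_θ₁_one]
    rw [ξ.vol₁.form_res]
    have h := ξ.vol₁.toFn_mul_form (ξ.φ ≫ ξ.h) (ξ.g.app _ (res _ (inf_le_right : V ⊓ A ≤ A) lA))
      (res _ inf_le_left s) (res _ inf_le_left t)
    have e := K.comp_res_lA (inf_le_right : V ⊓ A ≤ A)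
    rw [toFn_comp_eq] at e
    rw [toFn_comp, toFn_comp, toFn_comp, e, one_mul] at h
    exact h.symm
  · refine H.pow_mul_cancel inf_le_right n ?_
    rw [mul_sub, ← mul_assoc, ← mul_assoc, mul_right_comm _ (glueB _ _ _ 1),
      pow_mul_glueB_θ₁_zero, pow_mul_glueB_θ₁_zero, glueB_θ₁_one, glueB_θ₁_one, ξ.vol₁.form_res]
    have h := ξ.vol₁.toFn_mul_form (ξ.φ ≫ ξ.h) (ξ.g.app _ (res _ (inf_le_right : V ⊓ B ≤ B) lB))
      (res _ inf_le_left s) (res _ inf_le_left t)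
    have e := K.comp_res_lB (inf_le_right : V ⊓ B ≤ B)
    rw [toFn_comp_eq] at e
    rw [toFn_comp, toFn_comp, toFn_comp, e] at h
    rw [h]
    ring

theorem glueForm_θ₂ (s t : Γ(ξ.E₂, V)) :
    glueForm H.cover (H.mat₂ a) (H.mat₂_det a) ((K.θ₂ H hc).app V s) ((K.θ₂ H hc).app V t) =
      ξ.vol₂.form V s t := by
  refine glueForm_ext H.cover ?_ ?_
  · simp only [glueA_θ₂_zero, glueA_θ₂_one]
    rw [ξ.vol₂.form_res]
    have h := ξ.vol₂.toFn_mul_form ξ.h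
      (ξ.φ.app _ (ξ.g.app _ (res _ (inf_le_right : V ⊓ A ≤ A) lA)))
      (res _ inf_le_left s) (res _ inf_le_left t)
    have e := K.comp_res_lA (inf_le_right : V ⊓ A ≤ A)
    rw [toFn_comp_eq] at e
    rw [e, one_mul] at h
    exact h.symm
  · refine H.pow_mul_cancel inf_le_right n ?_
    rw [mul_sub, mul_left_comm, ← mul_assoc _ (glueB _ _ _ 1),
      pow_mul_glueB_θ₂_one, pow_mul_glueB_θ₂_one, glueB_θ₂_zero, glueB_θ₂_zero, ξ.vol₂.form_res]
    have h := ξ.vol₂.toFn_mul_form ξ.h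
      (ξ.φ.app _ (ξ.g.app _ (res _ (inf_le_right : V ⊓ B ≤ B) lB)))
      (res _ inf_le_left s) (res _ inf_le_left t)
    have e := K.comp_res_lB (inf_le_right : V ⊓ B ≤ B)
    rw [toFn_comp_eq] at e
    rw [e] at h
    rw [h]
    ring

theorem isIso_θL : IsIso (K.θL H) := by
  refine isIso_of_locally_bijective fun z => ?_
  have hz : z ∈ A ⊔ B := by rw [H.cover]; trivial
  rcases hz with hz | hz
  · refine ⟨A, hz, fun V hV => bijective_homToGlue_left H.matL_mul hV ⟨fun s t e => ?_,
      fun c => ⟨c 0 • res _ hV lA, ?_⟩⟩⟩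
    · exact K.inj V (congrFun e 0)
    · refine funext fun i => ?_
      rw [Subsingleton.elim i 0]
      change toFn ξ.comp V (c 0 • _) = c 0
      rw [map_smul, K.comp_res_lA, smul_eq_mul, mul_one]
  · refine ⟨B, hz, fun V hV => bijective_homToGlue_right hV ⟨fun s t e => ?_,
      fun c => ⟨c 0 • res _ hV lB, ?_⟩⟩⟩
    · refine K.inj V ?_
      have h := congrArg (fun x => fres hV T ^ n * x) (congrFun e 0)
      exact (H.pow_mul_divPow hV n _ (K.dvd hV) s).symm.trans
        (h.trans (H.pow_mul_divPow hV n _ (K.dvd hV) t))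
    · refine funext fun i => H.pow_mul_cancel hV n ?_
      rw [Subsingleton.elim i 0]
      refine (H.pow_mul_divPow hV n _ (K.dvd hV) _).trans ?_
      rw [map_smul, K.comp_res_lB, smul_eq_mul, mul_comm]

theorem g_θ₁ : ξ.g ≫ K.θ₁ H hc = K.θL H ≫ H.stdG b := by
  refine modules_hom_ext fun V s => ?_
  rw [app_comp, app_comp]
  refine glue_ext (fun i => ?_) (fun i => ?_)
  -- As `L` has rank one, `g s` is proportional to `g lA`, and the alternating form vanishes on the
  -- pair.
  · have e : ξ.vol₁.form _ (ξ.g.app _ (res _ (inf_le_right : V ⊓ A ≤ A) lA))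
        (res _ inf_le_left (ξ.g.app V s)) = 0 := by
      rw [res_app, K.eq_smul_lA inf_le_right (res _ inf_le_left s), app_smul, map_smul,
        ξ.vol₁.form_self, smul_zero]
    fin_cases i
    · exact (K.glueA_θ₁_zero H hc _ _ _).trans ((H.glueA_stdG_zero _ _ _).trans
        ((K.glueA_θL H _ _ _ _).trans (by rw [toFn_comp_eq, res_app]))).symm
    · exact (K.glueA_θ₁_one H hc _ _ _).trans (e.trans (H.glueA_stdG_one _ _ _).symm)
  · have e : ξ.vol₁.form _ (ξ.g.app _ (res _ (inf_le_right : V ⊓ B ≤ B) lB))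
        (res _ inf_le_left (ξ.g.app V s)) = 0 := by
      obtain ⟨f, -, hf⟩ := K.exists_eq_smul_lB inf_le_right (res _ (inf_le_left : V ⊓ B ≤ V) s)
      rw [res_app, hf, app_smul, map_smul, ξ.vol₁.form_self, smul_zero]
    fin_cases i
    · refine H.pow_mul_cancel inf_le_right n ?_
      refine (K.pow_mul_glueB_θ₁_zero H hc _ _ _).trans (Eq.trans ?_
        (congrArg _ (H.glueB_stdG_zero _ _ _)).symm)
      rw [K.pow_mul_glueB_θL H, e, mul_zero, sub_zero, toFn_comp_eq, res_app]
    · exact (K.glueB_θ₁_one H hc _ _ _).trans (e.trans (H.glueB_stdG_one _ _ _).symm)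

theorem h_eq_θ₂ : ξ.h = K.θ₂ H hc ≫ H.stdH a := by
  refine modules_hom_ext fun V s => ?_
  change toFn ξ.h V s = toFn (K.θ₂ H hc ≫ H.stdH a) V s
  rw [toFn_comp]
  refine fn_ext_cover H.cover ?_ ?_
  · rw [H.fres_stdH_left _ _ inf_le_right, K.glueA_θ₂_zero H hc, fres_toFn]
  · rw [H.fres_stdH_right _ _ inf_le_right, K.glueB_θ₂_zero H hc, fres_toFn]

theorem φ_θ₂ [NeZero n] (hab : ∀ k : ℕ, 1 ≤ k → k < n → conv a b k = 0)
    (hd : ξ.IsDet (a 0 * b 0)) : ξ.φ ≫ K.θ₂ H hc = K.θ₁ H hc ≫ H.stdφ a b hab := by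
  refine modules_hom_ext fun V s => ?_
  rw [app_comp, app_comp]
  refine glue_ext (fun i => ?_) (fun i => ?_)
  · fin_cases i
    · exact (K.glueA_θ₂_zero H hc _ _ _).trans ((H.glueA_stdφ_zero _ _ _).trans
        ((K.glueA_θ₁_zero H hc _ _ _).trans (by rw [res_app]))).symm
    · refine (K.glueA_θ₂_one H hc _ _ _).trans (Eq.trans ?_ (H.glueA_stdφ_one _ _ _).symm)
      rw [K.glueA_θ₁_one H hc, res_app, hd, constFn_eq_pull]
  · fin_cases i
    · refine (K.glueB_θ₂_zero H hc _ _ _).trans (Eq.trans ?_ (H.glueB_stdφ_zero _ _ _).symm)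
      rw [K.pow_mul_glueB_θ₁_zero H hc, K.glueB_θ₁_one H hc, res_app, sub_add_cancel]
    · refine H.pow_mul_cancel inf_le_right n ((K.pow_mul_glueB_θ₂_one H hc _ _ _).trans
        (Eq.trans ?_ (congrArg _ (H.glueB_stdφ_one _ _ _)).symm))
      -- After multiplication by `Tⁿ`, this entry reduces to the determinant identity `Tⁿ δ + α β =
      -- d`.
      have e := SectionCoord.fres_T_pow_mul_add (π := pr₂ X S) (T := T) hab (inf_le_right : V ⊓ B ≤ B)
      rw [mul_sub, ← mul_assoc, ← mul_assoc, mul_right_comm, K.pow_mul_glueB_θ₁_zero H hc,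
        K.glueB_θ₁_one H hc, res_app, hd, constFn_eq_pull, ← e]
      ring

end Normalized

end LocalModel

end
end PicardLefschetz

/-! ### Coordinates under isomorphism and base change -/

namespace PicardLefschetz
noncomputable section

theorem hom_app_inv_app {X : Scheme.{u}} {M N : X.Modules} (e : M ≅ N) (U : X.Opens)
    (s : Γ(N, U)) : e.hom.app U (e.inv.app U s) = s := by
  rw [← app_comp, e.inv_hom_id]
  rfl

theorem app_smul_pushforward {X X' : Scheme.{u}} (F : X' ⟶ X) {M : X.Modules} {N : X'.Modules}
    (θ : M ⟶ (Scheme.Modules.pushforward F).obj N) {U : X.Opens} (f : Γ(X, U)) (s : Γ(M, U)) :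
    (show Γ(N, F ⁻¹ᵁ U) from θ.app U (f • s)) =
      F.app U f • (show Γ(N, F ⁻¹ᵁ U) from θ.app U s) :=
  app_smul θ f s

theorem prodMap_fst {B : Scheme.{u}} (X : Over B) {S' S : Over B} (f : S' ⟶ S) :
    prodMap X f ≫ pr₁ X S = pr₁ X S' :=
  (pullback.lift_fst _ _ _).trans (Category.comp_id _)

theorem prodMap_snd {B : Scheme.{u}} (X : Over B) {S' S : Over B} (f : S' ⟶ S) :
    prodMap X f ≫ pr₂ X S = pr₂ X S' ≫ f.left :=
  pullback.lift_snd _ _ _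

namespace LocalModel

variable {B₀ : Scheme.{u}} {n : ℕ} {X S S' : Over B₀}

theorem Isomorphic.symm {ξ ξ' : LocalModel n X S} (h : ξ.Isomorphic ξ') : ξ'.Isomorphic ξ := by
  obtain ⟨eL, e₁, e₂, hg, hφ, hh, h₁, h₂⟩ := h
  refine ⟨eL.symm, e₁.symm, e₂.symm, ?_, ?_, ?_, fun U s t => ?_, fun U s t => ?_⟩
  · rw [Iso.symm_hom, Iso.symm_hom, Iso.eq_inv_comp, ← Category.assoc, ← hg, Category.assoc,
      e₁.hom_inv_id, Category.comp_id]
  · rw [Iso.symm_hom, Iso.symm_hom, Iso.eq_inv_comp, ← Category.assoc, ← hφ, Category.assoc,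
      e₂.hom_inv_id, Category.comp_id]
  · rw [Iso.symm_hom, Iso.eq_inv_comp, hh]
  · rw [← h₁, Iso.symm_hom, hom_app_inv_app, hom_app_inv_app]
  · rw [← h₂, Iso.symm_hom, hom_app_inv_app, hom_app_inv_app]

theorem Isomorphic.trans {ξ ξ' ξ'' : LocalModel n X S} (h : ξ.Isomorphic ξ')
    (h' : ξ'.Isomorphic ξ'') : ξ.Isomorphic ξ'' := by
  obtain ⟨eL, e₁, e₂, hg, hφ, hh, h₁, h₂⟩ := h
  obtain ⟨eL', e₁', e₂', hg', hφ', hh', h₁', h₂'⟩ := h'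
  refine ⟨eL ≪≫ eL', e₁ ≪≫ e₁', e₂ ≪≫ e₂', ?_, ?_, ?_, fun U s t => ?_, fun U s t => ?_⟩
  · rw [Iso.trans_hom, Iso.trans_hom, ← Category.assoc, hg, Category.assoc, hg', Category.assoc]
  · rw [Iso.trans_hom, Iso.trans_hom, ← Category.assoc, hφ, Category.assoc, hφ', Category.assoc]
  · rw [Iso.trans_hom, hh, hh', Category.assoc]
  · rw [Iso.trans_hom, app_comp, app_comp, h₁', h₁]
  · rw [Iso.trans_hom, app_comp, app_comp, h₂', h₂]

theorem Isomorphic.isCoord {ξ ξ' : LocalModel n X S} (h : ξ.Isomorphic ξ')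
    {σ : S.left ⟶ prod X S} {B : (prod X S).Opens} {T : Γ(prod X S, B)} {N : S.left.Opens}
    {a b : Fin n → Γ(S.left, N)} (hc : ξ.IsCoord σ T N a b) : ξ'.IsCoord σ T N a b := by
  obtain ⟨eL, e₁, e₂, hg, hφ, hh, h₁, h₂⟩ := h
  intro y hy
  obtain ⟨V, hB, hN, hyV, l, q, e, w, F⟩ := hc y hy
  have hg' : ∀ s, ξ'.g.app V (eL.hom.app V s) = e₁.hom.app V (ξ.g.app V s) := fun s => by
    rw [← app_comp, ← hg, app_comp]
  have hφ' : ∀ s, ξ'.φ.app V (e₁.hom.app V s) = e₂.hom.app V (ξ.φ.app V s) := fun s => by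
    rw [← app_comp, ← hφ, app_comp]
  have hh' : ∀ s, toFn ξ'.h V (e₂.hom.app V s) = toFn ξ.h V s := fun s => by
    rw [hh, toFn_comp]
  refine ⟨V, hB, hN, hyV, eL.hom.app V l, e₁.hom.app V q, e₂.hom.app V e, e₂.hom.app V w, ?_⟩
  constructor
  · rw [toFn_comp_eq, hg', hφ', hh', ← toFn_comp_eq, F.comp_l]
  · rw [hg', h₁, F.form_q]
  · rw [hφ', hh', F.h_q]
  · rw [hh', F.h_e]
  · rw [hh', F.h_w]
  · rw [h₂, F.form_w]
  · rw [hg', hφ', ← app_smul, F.eq, app_add, app_smul]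

theorem Isomorphic.isPullback {ξ ξ' : LocalModel n X S} (h : ξ.Isomorphic ξ') {f : S' ⟶ S}
    {ζ : LocalModel n X S'} (hp : IsPullback f ξ' ζ) : IsPullback f ξ ζ := by
  obtain ⟨eL, e₁, e₂, hg, hφ, hh, h₁, h₂⟩ := h
  obtain ⟨θL, θ₁, θ₂, pg, pφ, ph, p₁, p₂⟩ := hp
  refine ⟨eL.hom ≫ θL, e₁.hom ≫ θ₁, e₂.hom ≫ θ₂, ?_, ?_, fun U s => ?_, fun U s t => ?_,
    fun U s t => ?_⟩
  · rw [← Category.assoc, hg, Category.assoc, pg, Category.assoc]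
  · rw [← Category.assoc, hφ, Category.assoc, pφ, Category.assoc]
  · rw [app_comp, hh, toFn_comp]
    exact ph _ _
  · rw [app_comp, app_comp, ← h₁]
    exact p₁ _ _ _
  · rw [app_comp, app_comp, ← h₂]
    exact p₂ _ _ _

/-- The comparison maps of the pullback carry an adapted frame to an adapted frame, with the
polynomials pulled back coefficient by coefficient. -/
theorem IsPullback.isCoord {f : S' ⟶ S} {ξ : LocalModel n X S} {ξ' : LocalModel n X S'}
    (h : IsPullback f ξ ξ') {σ : S.left ⟶ prod X S} {B : (prod X S).Opens}
    {T : Γ(prod X S, B)} {σ' : S'.left ⟶ prod X S'} {B' : (prod X S').Opens}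
    {T' : Γ(prod X S', B')} (hB : B' ≤ prodMap X f ⁻¹ᵁ B) (hB' : prodMap X f ⁻¹ᵁ B ≤ B')
    (hT : T' = pull (prodMap X f) hB T) (hσ : σ' ≫ prodMap X f = f.left ≫ σ)
    {a b : Fin n → Γ(S.left, ⊤)} (hc : ξ.IsCoord σ T ⊤ a b) :
    ξ'.IsCoord σ' T' ⊤ (fun i => pull f.left (le_preimage_top _) (a i))
      (fun i => pull f.left (le_preimage_top _) (b i)) := by
  obtain ⟨θL, θ₁, θ₂, pg, pφ, ph, p₁, p₂⟩ := h
  intro y _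
  obtain ⟨V, hVB, hN, hyV, l, q, e, w, F⟩ := hc (f.left y) trivial
  have hy : σ' y ∈ prodMap X f ⁻¹ᵁ V := by
    change prodMap X f (σ' y) ∈ V
    rwa [← Scheme.Hom.comp_apply, hσ, Scheme.Hom.comp_apply]
  have hτ : fres ((Scheme.Hom.preimage_mono _ hVB).trans hB') T' =
      (prodMap X f).app V (fres hVB T) := by
    rw [hT, fres_pull, ← pull_eq_app, pull_fres]
  have hp : ∀ c : Fin n → Γ(S.left, ⊤), poly (pr₂ X S') (le_preimage_top _)
      (fres ((Scheme.Hom.preimage_mono _ hVB).trans hB') T')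
        (fun i => pull f.left (le_preimage_top _) (c i)) =
      (prodMap X f).app V (poly (pr₂ X S) hN (fres hVB T) c) := by
    intro c
    rw [← pull_eq_app, pull_poly (π' := pr₂ X S') (N' := ⊤) (prodMap X f) f.left (prodMap_snd X f) hN le_rfl
      (le_preimage_top _) (le_preimage_top _), hτ, pull_eq_app]
  have hg' : ∀ s, ξ'.g.app (prodMap X f ⁻¹ᵁ V) (θL.app V s) = θ₁.app V (ξ.g.app V s) := fun s => by
    have := congrArg (fun ψ => ψ.app V s) pg
    exact this.symm
  have hφ' : ∀ s, ξ'.φ.app (prodMap X f ⁻¹ᵁ V) (θ₁.app V s) = θ₂.app V (ξ.φ.app V s) := fun s => by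
    have := congrArg (fun ψ => ψ.app V s) pφ
    exact this.symm
  refine ⟨prodMap X f ⁻¹ᵁ V, (Scheme.Hom.preimage_mono _ hVB).trans hB', le_preimage_top _, hy, θL.app V l, θ₁.app V q, θ₂.app V e,
    θ₂.app V w, ?_⟩
  rw [hp, hp]
  constructor
  · refine (congrArg (toFn ξ'.h _) ((congrArg (ξ'.φ.app _) (hg' l)).trans (hφ' _))).trans
      ((ph _ _).trans ?_)
    rw [← toFn_comp_eq, F.comp_l, hτ, map_pow]
  · refine (congrArg (fun x => ξ'.vol₁.form _ x _) (hg' l)).trans ((p₁ _ _ _).trans ?_)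
    rw [F.form_q, map_one]
  · refine (congrArg (toFn ξ'.h _) (hφ' q)).trans ((ph _ _).trans ?_)
    rw [F.h_q]
  · refine (ph _ _).trans ?_
    rw [F.h_e, map_one]
  · refine (ph _ _).trans ?_
    rw [F.h_w, map_zero]
  · refine (p₂ _ _ _).trans ?_
    rw [F.form_w, map_one]
  · rw [hτ, ← map_pow]
    refine (app_smul_pushforward (prodMap X f) θ₂ _ e).symm.trans ?_
    rw [F.eq]
    refine (app_add θ₂ _ _).trans ?_
    exact congrArg₂ (fun x y => x + y) ((hφ' _).symm.trans (congrArg (ξ'.φ.app _) (hg' l).symm))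
      (app_smul_pushforward (prodMap X f) θ₂ _ w)

end LocalModel

namespace CurveCoord

variable {B₀ : Scheme.{u}} {n : ℕ} {X S S' : Over B₀} {J : (prod X S).IdealSheafData}
  {σ : S.left ⟶ prod X S} {A B : (prod X S).Opens} {T : Γ(prod X S, B)}
  (C : CurveCoord n X S J σ A B T) {ξ : LocalModel n X S} {lA : Γ(ξ.L, A)} {lB : Γ(ξ.L, B)}
  {a b : Fin n → Γ(S.left, ⊤)}

/-- Rigidity: the coordinates determine the point up to isomorphism. -/
theorem isomorphic_std [NeZero n] (K : ξ.Normalized T lA lB) (hc : ξ.IsCoord σ T ⊤ a b)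
    (hab : ∀ k : ℕ, 1 ≤ k → k < n → conv a b k = 0) (hd : ξ.IsDet (a 0 * b 0)) :
    ξ.Isomorphic (C.std a b hab) := by
  have H := C.toSectionCoord
  have iL := K.isIso_θL H
  have i₁ : IsIso (K.θ₁ H hc) := ξ.vol₁.isIso_of_form_eq
    (glueSL2 C.cover _ _ (C.mat₁_mul b) (C.mat₁_det b)) fun _ => K.glueForm_θ₁ H hc
  have i₂ : IsIso (K.θ₂ H hc) := ξ.vol₂.isIso_of_form_eq
    (glueSL2 C.cover _ _ (C.mat₂_mul a) (C.mat₂_det a)) fun _ => K.glueForm_θ₂ H hc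
  let eL : ξ.L ≅ glue (H.matL n) := asIso (K.θL H)
  let e₁ : ξ.E₁ ≅ glue (H.mat₁ b) := asIso (K.θ₁ H hc)
  let e₂ : ξ.E₂ ≅ glue (H.mat₂ a) := asIso (K.θ₂ H hc)
  exact ⟨eL, e₁, e₂, K.g_θ₁ H hc, K.φ_θ₂ H hc hab hd,
    K.h_eq_θ₂ H hc, fun _ => K.glueForm_θ₁ H hc, fun _ => K.glueForm_θ₂ H hc⟩

end CurveCoord

end
end PicardLefschetz

/-! ### Base change of the standard model, and the contracting action -/

namespace PicardLefschetz
noncomputable section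

namespace CurveCoord

variable {B₀ : Scheme.{u}} {n : ℕ} {X S S' : Over B₀} {J : (prod X S).IdealSheafData}
  {σ : S.left ⟶ prod X S} {A B : (prod X S).Opens} {T : Γ(prod X S, B)}
  (C : CurveCoord n X S J σ A B T) {J' : (prod X S').IdealSheafData}
  {σ' : S'.left ⟶ prod X S'} {A' B' : (prod X S').Opens} {T' : Γ(prod X S', B')}
  (C' : CurveCoord n X S' J' σ' A' B' T') {f : S' ⟶ S} (hA : A' ≤ prodMap X f ⁻¹ᵁ A)
  (hB : B' ≤ prodMap X f ⁻¹ᵁ B) (hT : T' = pull (prodMap X f) hB T)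
  {a b : Fin n → Γ(S.left, ⊤)}

theorem conv_pull (hab : ∀ k : ℕ, 1 ≤ k → k < n → conv a b k = 0) (k : ℕ) (hk : 1 ≤ k)
    (hk' : k < n) : conv (fun i => pull f.left (le_preimage_top (V := ⊤) _) (a i))
      (fun i => pull f.left (le_preimage_top (V := ⊤) _) (b i)) k = 0 := by
  rw [← map_conv, hab k hk hk', map_zero]

include hT in
theorem fres_eq_pull {V' : (prod X S').Opens} (h : V' ≤ B') :
    fres h T' = pull (prodMap X f) (h.trans hB) T := by
  rw [hT, fres_pull]

include hT in
theorem pull_inv : C'.inv = pull (prodMap X f) (inf_le_preimage_inf _ hA hB) C.inv := by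
  have h := congrArg (pull (prodMap X f) (inf_le_preimage_inf _ hA hB)) C.mul_inv
  rw [map_mul, map_one, pull_fres, ← fres_eq_pull hB hT inf_le_right] at h
  exact C'.unit.mul_left_cancel (C'.mul_inv.trans h.symm)

include hT in
theorem poly_eq_pull {V' : (prod X S').Opens} {V : (prod X S).Opens} (h : V' ≤ B') (hV : V ≤ B)
    (hF : V' ≤ prodMap X f ⁻¹ᵁ V) (c : Fin n → Γ(S.left, ⊤)) :
    poly (pr₂ X S') (le_preimage_top _) (fres h T')
      (fun i => pull f.left (le_preimage_top (V := ⊤) _) (c i)) =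
      pull (prodMap X f) hF (poly (pr₂ X S) (le_preimage_top _) (fres hV T) c) := by
  rw [fres_eq_pull hB hT, pull_poly (π' := pr₂ X S') (prodMap X f) f.left (prodMap_snd X f) _ hF
    (le_preimage_top _) (le_preimage_top (V := V') _), pull_fres]

include hT in
theorem pull_matL (i j : Fin 1) : C'.matL n i j =
    pull (prodMap X f) (inf_le_preimage_inf _ hA hB) (C.matL n i j) := by
  fin_cases i; fin_cases j
  change fres inf_le_right T' ^ n = pull _ _ (fres inf_le_right T ^ n)
  rw [map_pow, pull_fres, fres_eq_pull hB hT]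

include hT in
theorem pull_mat₁ (i j : Fin 2) :
    C'.mat₁ (fun i => pull f.left (le_preimage_top (V := ⊤) _) (b i)) i j =
      pull (prodMap X f) (inf_le_preimage_inf _ hA hB) (C.mat₁ b i j) := by
  fin_cases i <;> fin_cases j
  · change fres inf_le_right T' ^ n = pull _ _ (fres inf_le_right T ^ n)
    rw [map_pow, pull_fres, fres_eq_pull hB hT]
  · change fres inf_le_right (poly (pr₂ X S') (le_preimage_top _) T' _) =
      pull _ _ (fres inf_le_right (poly (pr₂ X S) (le_preimage_top _) T b))
    rw [fres_poly, fres_poly]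
    exact poly_eq_pull hB hT _ _ _ _
  · exact (map_zero _).symm
  · change C'.inv ^ n = pull _ _ (C.inv ^ n)
    rw [map_pow, pull_inv C C' hA hB hT]

include hT in
theorem pull_mat₂ (i j : Fin 2) :
    C'.mat₂ (fun i => pull f.left (le_preimage_top (V := ⊤) _) (a i)) i j =
      pull (prodMap X f) (inf_le_preimage_inf _ hA hB) (C.mat₂ a i j) := by
  fin_cases i <;> fin_cases j
  · exact (map_one _).symm
  · exact (map_zero _).symm
  · change C'.inv ^ n * fres inf_le_right (poly (pr₂ X S') (le_preimage_top _) T' _) =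
      pull _ _ (C.inv ^ n * fres inf_le_right (poly (pr₂ X S) (le_preimage_top _) T a))
    rw [fres_poly, fres_poly, map_mul, map_pow, pull_inv C C' hA hB hT]
    exact congrArg _ (poly_eq_pull hB hT _ _ _ _)
  · exact (map_one _).symm

variable {V : (prod X S).Opens}

theorem pull_pull_pr₂ {V' : (prod X S').Opens} {f : S' ⟶ S} (h : V ≤ pr₂ X S ⁻¹ᵁ ⊤)
    (h' : V' ≤ prodMap X f ⁻¹ᵁ V) (d : Γ(S.left, ⊤)) :
    pull (prodMap X f) h' (pull (pr₂ X S) h d) =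
      pull (pr₂ X S') (le_preimage_top _) (pull f.left (le_preimage_top (V := ⊤) _) d) := by
  rw [pull_pull, pull_pull, pull_congr (prodMap_snd X f)]

include hA hB hT in
-- All matrices of the model are built from `T`, its inverse and the coordinates, so coordinatewise
-- pullback of sections commutes with every part of the structure.
theorem isPullback_std [NeZero n] (hab : ∀ k : ℕ, 1 ≤ k → k < n → conv a b k = 0) :
    LocalModel.IsPullback f (C.std a b hab)
      (C'.std (fun i => pull f.left (le_preimage_top (V := ⊤) _) (a i))
        (fun i => pull f.left (le_preimage_top (V := ⊤) _) (b i)) (conv_pull hab)) := by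
  have hL := pull_matL (n := n) C C' hA hB hT
  have h₁ := pull_mat₁ C C' hA hB hT (b := b)
  have h₂ := pull_mat₂ C C' hA hB hT (a := a)
  let θL := gluePush (prodMap X f) hA hB _ _ hL
  let θ₁ := gluePush (prodMap X f) hA hB _ _ h₁
  let θ₂ := gluePush (prodMap X f) hA hB _ _ h₂
  have eg : ∀ (V : (prod X S).Opens) (s : Γ(glue (C.matL n), V)),
      gluePull (prodMap X f) hA hB _ _ h₁ ((C.stdG b).app V s) =
        (C'.stdG _).app _ (gluePull (prodMap X f) hA hB _ _ hL s) := by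
    intro V s
    refine glue_ext (fun i => ?_) (fun i => ?_)
    · rw [glueA_gluePull]
      fin_cases i
      · refine (congrArg _ (C.glueA_stdG_zero _ _ _)).trans (Eq.trans ?_
          (C'.glueA_stdG_zero _ _ _).symm)
        rw [glueA_gluePull]
      · exact (congrArg _ (C.glueA_stdG_one _ _ _)).trans ((map_zero _).trans
          (C'.glueA_stdG_one _ _ _).symm)
    · rw [glueB_gluePull]
      fin_cases i
      · refine (congrArg _ (C.glueB_stdG_zero _ _ _)).trans (Eq.trans ?_
          (C'.glueB_stdG_zero _ _ _).symm)
        rw [glueB_gluePull]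
      · exact (congrArg _ (C.glueB_stdG_one _ _ _)).trans ((map_zero _).trans
          (C'.glueB_stdG_one _ _ _).symm)
  have eφ : ∀ (V : (prod X S).Opens) (s : Γ(glue (C.mat₁ b), V)),
      gluePull (prodMap X f) hA hB _ _ h₂ ((C.stdφ a b hab).app V s) =
        (C'.stdφ _ _ (conv_pull hab)).app _ (gluePull (prodMap X f) hA hB _ _ h₁ s) := by
    intro V s
    refine glue_ext (fun i => ?_) (fun i => ?_)
    · rw [glueA_gluePull]
      fin_cases i
      · refine (congrArg _ (C.glueA_stdφ_zero _ _ _)).trans (Eq.trans ?_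
          (C'.glueA_stdφ_zero _ _ _).symm)
        rw [glueA_gluePull]
      · refine (congrArg _ (C.glueA_stdφ_one _ _ _)).trans (Eq.trans ?_
          (C'.glueA_stdφ_one _ _ _).symm)
        rw [glueA_gluePull, map_mul, pull_pull_pr₂]
        simp only [map_mul]
    · rw [glueB_gluePull]
      fin_cases i
      · refine (congrArg _ (C.glueB_stdφ_zero _ _ _)).trans (Eq.trans ?_
          (C'.glueB_stdφ_zero _ _ _).symm)
        rw [glueB_gluePull, glueB_gluePull, map_add, map_mul, map_mul, map_pow, pull_fres,
          fres_eq_pull hB hT]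
        rw [← fres_eq_pull hB hT inf_le_right, poly_eq_pull hB hT]
      · refine (congrArg _ (C.glueB_stdφ_one _ _ _)).trans (Eq.trans ?_
          (C'.glueB_stdφ_one _ _ _).symm)
        rw [glueB_gluePull, glueB_gluePull, map_sub, map_mul, map_mul, map_neg,
          ← poly_eq_pull hB hT inf_le_right, ← poly_eq_pull hB hT inf_le_right]
        simp only [map_conv]
  have eh : ∀ (V : (prod X S).Opens) (s : Γ(glue (C.mat₂ a), V)),
      toFn (C'.stdH _) _ (gluePull (prodMap X f) hA hB _ _ h₂ s) =
        (prodMap X f).app V (toFn (C.stdH a) V s) := by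
    intro V s
    rw [← pull_eq_app]
    refine fn_ext_cover C'.cover ?_ ?_
    · rw [C'.fres_stdH_left _ _ inf_le_right, glueA_gluePull,
        ← C.fres_stdH_left _ inf_le_left inf_le_right, pull_fres, fres_pull]
    · rw [C'.fres_stdH_right _ _ inf_le_right, glueB_gluePull,
        ← C.fres_stdH_right _ inf_le_left inf_le_right, pull_fres, fres_pull]
  have ev₁ : ∀ (V : (prod X S).Opens) (s t : Γ(glue (C.mat₁ b), V)),
      glueForm C'.cover _ (C'.mat₁_det _) (gluePull (prodMap X f) hA hB _ _ h₁ s)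
        (gluePull (prodMap X f) hA hB _ _ h₁ t) =
          (prodMap X f).app V (glueForm C.cover _ (C.mat₁_det b) s t) := by
    intro V s t
    rw [← pull_eq_app]
    refine glueForm_ext C'.cover ?_ ?_
    · simp only [glueA_gluePull]
      rw [fres_pull, ← map_mul, ← map_mul, ← map_sub, ← fres_glueForm_left C.cover, pull_fres]
    · simp only [glueB_gluePull]
      rw [fres_pull, ← map_mul, ← map_mul, ← map_sub, ← fres_glueForm_right C.cover, pull_fres]
  have ev₂ : ∀ (V : (prod X S).Opens) (s t : Γ(glue (C.mat₂ a), V)),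
      glueForm C'.cover _ (C'.mat₂_det _) (gluePull (prodMap X f) hA hB _ _ h₂ s)
        (gluePull (prodMap X f) hA hB _ _ h₂ t) =
          (prodMap X f).app V (glueForm C.cover _ (C.mat₂_det a) s t) := by
    intro V s t
    rw [← pull_eq_app]
    refine glueForm_ext C'.cover ?_ ?_
    · simp only [glueA_gluePull]
      rw [fres_pull, ← map_mul, ← map_mul, ← map_sub, ← fres_glueForm_left C.cover, pull_fres]
    · simp only [glueB_gluePull]
      rw [fres_pull, ← map_mul, ← map_mul, ← map_sub, ← fres_glueForm_right C.cover, pull_fres]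
  exact ⟨θL, θ₁, θ₂, modules_hom_ext eg, modules_hom_ext eφ, eh, ev₁, ev₂⟩

end CurveCoord

namespace LocalModel

variable {B₀ : Scheme.{u}} {n : ℕ} {X S : Over B₀} {ξ : LocalModel n X S}

/-- The composite `hφg` is unchanged, so `l` stays. Unimodularity and the normalisation of `h`
replace `q, e, w` by `c q, c e, c⁻¹ w`. Then `hφ q` is scaled by `c⁻¹ · c² · c = c²`, and so is `α`.
-/
theorem IsCoord.act {σ : S.left ⟶ prod X S} {B : (prod X S).Opens} {T : Γ(prod X S, B)}
    {a b : Fin n → Γ(S.left, ⊤)} (hc : ξ.IsCoord σ T ⊤ a b) (c : Γ(S.left, ⊤)ˣ) :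
    (ξ.act c).IsCoord σ T ⊤ (fun i => (c : Γ(S.left, ⊤)) ^ 2 * a i)
      (fun i => (c : Γ(S.left, ⊤)) ^ 2 * b i) := by
  intro y hy
  obtain ⟨V, hB, hN, hyV, l, q, e, w, F⟩ := hc y hy
  let u := constUnit X S c
  set γ : Γ(prod X S, V) := fres le_top (u : Γ(prod X S, ⊤)) with hγ
  set γ' : Γ(prod X S, V) := fres le_top ((u⁻¹ : Γ(prod X S, ⊤)ˣ) : Γ(prod X S, ⊤))
  have h1 : γ * γ' = 1 := by rw [← fres_mul, Units.mul_inv, fres_one]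
  have hγ2 : fres le_top ((u ^ 2 : Γ(prod X S, ⊤)ˣ) : Γ(prod X S, ⊤)) = γ ^ 2 := by
    rw [Units.val_pow_eq_pow_val, fres_pow]
  have hp : ∀ a : Fin n → Γ(S.left, ⊤), poly (pr₂ X S) hN (fres hB T)
      (fun i => (c : Γ(S.left, ⊤)) ^ 2 * a i) = γ ^ 2 * poly (pr₂ X S) hN (fres hB T) a := by
    intro a
    have : pull (pr₂ X S) hN (c : Γ(S.left, ⊤)) = γ := by
      change _ = fres le_top (constFn X S ⊤ (c : Γ(S.left, ⊤)))
      rw [constFn_eq_pull, fres_pull]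
    simp only [poly, map_mul, map_pow, this, Finset.mul_sum, mul_assoc]
  set γ2 : Γ(prod X S, V) := fres le_top ((u ^ 2 : Γ(prod X S, ⊤)ˣ) : Γ(prod X S, ⊤)) with hγ2'
  have hcomp : (ξ.act c).comp = ξ.comp := act_comp _
  have k1 : ξ.vol₁.form V (γ' • ξ.g.app V l) (γ • q) = 1 := by
    rw [map_smul, map_smul, LinearMap.smul_apply, F.form_q, smul_eq_mul, smul_eq_mul, mul_one, h1]
  have k2 : γ' * toFn ξ.h V (γ2 • ξ.φ.app V (γ • q)) =
      γ ^ 2 * poly (pr₂ X S) hN (fres hB T) b := by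
    have : ξ.φ.app V (γ • q) = γ • ξ.φ.app V q := app_smul _ _ _
    rw [this, map_smul, map_smul, F.h_q, smul_eq_mul, smul_eq_mul, hγ2]
    linear_combination γ ^ 2 * poly (pr₂ X S) hN (fres hB T) b * h1
  have k3 : γ' * toFn ξ.h V (γ • e) = 1 := by
    rw [map_smul, F.h_e, smul_eq_mul, mul_one, mul_comm, h1]
  have k4 : γ' * toFn ξ.h V (γ' • w) = 0 := by
    rw [map_smul, F.h_w, smul_zero, mul_zero]
  have k5 : ξ.vol₂.form V (γ • e) (γ' • w) = 1 := by
    rw [map_smul, map_smul, LinearMap.smul_apply, F.form_w, smul_eq_mul, smul_eq_mul, mul_one,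
      mul_comm, h1]
  have k6 : fres hB T ^ n • γ • e = γ2 • ξ.φ.app V (γ' • ξ.g.app V l) +
      (γ ^ 2 * poly (pr₂ X S) hN (fres hB T) a) • γ' • w := by
    have e1 : ξ.φ.app V (γ' • ξ.g.app V l) = γ' • ξ.φ.app V (ξ.g.app V l) := app_smul _ _ _
    rw [smul_comm, F.eq, e1, smul_add, smul_smul, smul_smul, smul_smul, hγ2]
    congr 2
    · linear_combination -γ * h1
    · linear_combination -γ * poly (pr₂ X S) hN (fres hB T) a * h1
  refine ⟨V, hB, hN, hyV, l, γ • q, γ • e, γ' • w, ?_⟩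
  rw [hp, hp]
  exact ⟨by rw [hcomp]; exact F.comp_l, k1, k2, k3, k4, k5, k6⟩

end LocalModel

end
end PicardLefschetz

namespace PicardLefschetz
noncomputable section

/-! ### Ideal sheaves -/

section IdealSheaf

variable {X Y : Scheme.{u}}

open Scheme.IdealSheafData

theorem mem_ideal_iff_app {J : X.IdealSheafData} {V : X.affineOpens} {f : Γ(X, V)} :
    f ∈ J.ideal V ↔ J.subschemeι.app V f = 0 := by
  rw [← J.ker_subschemeι_app]
  rfl

theorem fres_mem_ideal {J : X.IdealSheafData} {V W : X.affineOpens} (h : W.1 ≤ V.1) {f : Γ(X, V)}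
    (hf : f ∈ J.ideal V) : fres h f ∈ J.ideal W :=
  J.ideal_le_comap_ideal (U := W) (V := V) h hf

theorem fres_app (F : X ⟶ Y) {V W : Y.Opens} (h : W ≤ V) (f : Γ(Y, V)) :
    fres (F.preimage_mono h) (F.app V f) = F.app W (fres h f) := by
  rw [← pull_eq_app, ← pull_eq_app, fres_pull, pull_fres]

/-- Membership means vanishing on the closed subscheme, which is a local condition. -/
theorem mem_ideal_of_locally {J : X.IdealSheafData} {V : X.affineOpens} {f : Γ(X, V)}
    (h : ∀ z ∈ V.1, ∃ (W : X.affineOpens) (hW : W.1 ≤ V.1), z ∈ W.1 ∧ fres hW f ∈ J.ideal W) :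
    f ∈ J.ideal V := by
  rw [mem_ideal_iff_app]
  refine fn_ext fun z hz => ?_
  obtain ⟨W, hW, hzW, hf⟩ := h (J.subschemeι z) hz
  refine ⟨J.subschemeι ⁻¹ᵁ W.1, J.subschemeι.preimage_mono hW, hzW, ?_⟩
  rw [fres_zero]
  exact (fres_app _ hW _).trans (mem_ideal_iff_app.mp hf)

theorem pull_mem_comap_ideal (I : Y.IdealSheafData) (F : X ⟶ Y) {U : Y.affineOpens}
    {V : X.affineOpens} (h : V.1 ≤ F ⁻¹ᵁ U.1) {f : Γ(Y, U)} (hf : f ∈ I.ideal U) :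
    pull F h f ∈ (I.comap F).ideal V := by
  have h1 := I.le_map_comap F U hf
  have h2 := Scheme.Hom.ideal_ker_le _ U h1
  rw [mem_ideal_iff_app, ← pull_eq_app, pull_pull]
  have h3 : ((I.comap F).subschemeι ≫ F).app U f = 0 := h2
  rw [pull_eq_fres_app, h3, fres_zero]

/-- By the adjunction between `comap` and `map`, it suffices to compare ideals of global functions
on the affine target. -/
theorem comap_ideal_top [IsAffine X] [IsAffine Y] (I : Y.IdealSheafData) (F : X ⟶ Y) :
    (I.comap F).ideal ⟨⊤, isAffineOpen_top X⟩ ≤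
      (I.ideal ⟨⊤, isAffineOpen_top Y⟩).map F.appTop.hom := by
  have key : I.comap F ≤ ofIdealTop ((I.ideal ⟨⊤, isAffineOpen_top Y⟩).map F.appTop.hom) := by
    rw [← le_map_iff_comap_le]
    refine le_of_isAffine ?_
    rw [ideal_map _ F ⟨⊤, isAffineOpen_top Y⟩ (isAffineOpen_top X)]
    refine (Ideal.le_comap_map (f := F.appTop.hom)).trans (Ideal.comap_mono ?_)
    simp
  refine (key _).trans ?_
  rw [ofIdealTop_ideal]
  refine Ideal.map_le_iff_le_comap.mpr fun f hf => ?_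
  have : fres le_top f = f := fres_self f
  exact (congrArg (· ∈ _) this).mpr hf

theorem comap_ι_ideal (I : X.IdealSheafData) (U : X.affineOpens) :
    (I.comap U.1.ι).ideal ⟨⊤, @isAffineOpen_top U.1 U.2⟩ ≤
      (I.ideal U).map (pull U.1.ι (U' := ⊤) (U := U.1) (by simp)) := by
  have := U.2
  intro r hr
  rw [ideal_comap_of_isOpenImmersion] at hr
  have hU : U.1 ≤ U.1.ι ''ᵁ ⊤ := by simp
  have h1 := fres_mem_ideal (V := ⟨U.1.ι ''ᵁ ⊤, _⟩) hU hr
  have h2 : pull U.1.ι (U' := ⊤) (U := U.1) (by simp)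
      (fres hU ((U.1.ι.appIso ⊤).inv.hom r)) = r := by
    rw [pull_fres]
    exact (ConcreteCategory.congr_hom (Scheme.Hom.appIso_inv_appLE U.1.ι
      (U := ⊤) (V := ⊤) (by simp)) r).trans (fres_self r)
  rw [← h2]
  exact Ideal.mem_map_of_mem _ h1

/-- The nontrivial inclusion is reduced to affine schemes by factoring the restriction of `F` to `V`
through `U`. -/
theorem comap_ideal (I : Y.IdealSheafData) (F : X ⟶ Y) {U : Y.affineOpens} {V : X.affineOpens}
    (h : V.1 ≤ F ⁻¹ᵁ U.1) : (I.comap F).ideal V = (I.ideal U).map (pull F h) := by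
  refine le_antisymm (fun f hf => ?_)
    (Ideal.map_le_iff_le_comap.mpr fun f hf => pull_mem_comap_ideal I F h hf)
  have hVa : IsAffine V.1 := V.2
  have hUa : IsAffine U.1 := U.2
  have h1 := pull_mem_comap_ideal (I.comap F) V.1.ι (V := ⟨⊤, isAffineOpen_top V.1⟩) (U := V)
    (by simp) hf
  rw [← comap_comp, ← Scheme.Hom.resLE_comp_ι F h, comap_comp] at h1
  have h2 := Ideal.map_mono (f := (F.resLE U.1 V.1 h).appTop.hom) (comap_ι_ideal I U)
    (comap_ideal_top _ _ h1)
  rw [Ideal.map_map] at h2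
  have h3 : ((F.resLE U.1 V.1 h).appTop.hom).comp (pull U.1.ι (U' := ⊤) (U := U.1) (by simp)) =
      (pull V.1.ι (U' := ⊤) (U := V.1) (by simp)).comp (pull F h) := by
    ext a
    change (F.resLE U.1 V.1 h).app ⊤ _ = pull _ _ (pull F h a)
    rw [← pull_eq_app]
    refine (pull_pull _ _ _ _ _).trans ((pull_congr (Scheme.Hom.resLE_comp_ι F h) _ ?_ _).trans
      (pull_pull _ _ _ _ _).symm)
    exact fun z _ => h z.2
  rw [h3, ← Ideal.map_map] at h2
  have hbij : Function.Bijective (pull V.1.ι (U' := ⊤) (U := V.1) (by simp)) := by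
    have : IsIso (V.1.ι.appLE V.1 ⊤ (by simp)) := inferInstance
    exact ConcreteCategory.bijective_of_isIso (V.1.ι.appLE V.1 ⊤ _)
  obtain ⟨g, hg, e⟩ := (Ideal.mem_map_iff_of_surjective _ hbij.2).mp h2
  rwa [← hbij.1 e]

end IdealSheaf

end
end PicardLefschetz

namespace PicardLefschetz
noncomputable section

/-! ### A local coordinate at a rational point -/

theorem mem_of_spec_field {k : Type u} [Field k] {V : (Spec (.of k)).Opens} {z : Spec (.of k)}
    (hz : z ∈ V) : V = ⊤ := by
  refine top_le_iff.mp fun y _ => ?_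
  have : y = z := Subsingleton.elim (α := PrimeSpectrum k) y z
  rwa [this]

theorem isUnit_or_eq_zero {k : Type u} [Field k] {V : (Spec (.of k)).Opens} (f : Γ(Spec (.of k), V))
    (hV : V = ⊤) : IsUnit f ∨ f = 0 := by
  subst hV
  rcases eq_or_ne f 0 with h | h
  · exact .inr h
  · left
    have h1 : (Scheme.ΓSpecIso (.of k)).hom.hom f ≠ 0 := by
      intro h0
      refine h ?_
      exact (Scheme.ΓSpecIso (.of k)).commRingCatIsoToRingEquiv.injective (h0.trans (map_zero _).symm)
    have h2 : IsUnit (M := k) ((Scheme.ΓSpecIso (.of k)).hom.hom f) := Ne.isUnit h1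
    exact (isUnit_map_iff (Scheme.ΓSpecIso (.of k)).commRingCatIsoToRingEquiv f).mp h2

section

variable {k : Type u} [Field k] {X : Scheme.{u}} {x : Spec (.of k) ⟶ X}

/-- On the spectrum of a field a function is either zero or a unit, so pulling back to zero and
vanishing at the image point coincide. -/
theorem mem_ker_ideal_iff [QuasiCompact x] {U : X.affineOpens}
    (hU : x (IsLocalRing.closedPoint k) ∈ U.1) {f : Γ(X, U)} :
    f ∈ x.ker.ideal U ↔ f ∈ idealAt U.1 (x (IsLocalRing.closedPoint k)) hU := by
  have hV : x ⁻¹ᵁ U.1 = ⊤ := mem_of_spec_field hU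
  rw [Scheme.Hom.ker_apply, RingHom.mem_ker, mem_idealAt_iff]
  have e : x (IsLocalRing.closedPoint k) ∈ X.basicOpen f ↔ IsUnit (x.app U.1 f) := by
    change IsLocalRing.closedPoint k ∈ x ⁻¹ᵁ X.basicOpen f ↔ _
    rw [Scheme.preimage_basicOpen]
    refine ⟨fun h => ?_, fun h => ?_⟩
    · rcases isUnit_or_eq_zero (x.app U.1 f) hV with h' | h'
      · exact h'
      · rw [h', Scheme.basicOpen_zero] at h
        exact h.elim
    · rw [Scheme.basicOpen_of_isUnit _ h]
      exact hU
  have : Nontrivial Γ(Spec (.of k), x ⁻¹ᵁ U.1) := by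
    rw [hV]
    exact (Scheme.ΓSpecIso (.of k)).commRingCatIsoToRingEquiv.symm.injective.nontrivial
  rw [e]
  rcases isUnit_or_eq_zero (x.app U.1 f) hV with h' | h'
  · exact iff_of_false (fun h0 => h'.ne_zero h0) (not_not_intro h')
  · exact iff_of_true h' fun h => h.ne_zero h'

/-- Each of the finitely many generators of the ideal of the point is a multiple of `t` in the
stalk, hence on a neighbourhood. An affine neighbourhood inside the intersection of these works. -/
theorem exists_affine_ker_eq_span [QuasiCompact x] [IsLocallyNoetherian X] {U : X.Opens}
    (hU : x (IsLocalRing.closedPoint k) ∈ U) {t : Γ(X, U)}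
    (ht : IsUniformizer (x (IsLocalRing.closedPoint k)) U hU t) :
    ∃ (B : X.affineOpens) (hB : B.1 ≤ U), x (IsLocalRing.closedPoint k) ∈ B.1 ∧
      x.ker.ideal B = Ideal.span {fres hB t} := by
  set p := x (IsLocalRing.closedPoint k) with hp
  obtain ⟨W, hW, hpW, hWU⟩ := exists_isAffineOpen_mem_and_subset hU
  have : IsNoetherianRing Γ(X, W) := IsLocallyNoetherian.component_noetherian ⟨W, hW⟩
  obtain ⟨s, hs⟩ := (IsNoetherian.noetherian (x.ker.ideal ⟨W, hW⟩) : (x.ker.ideal ⟨W, hW⟩).FG)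
  have key : ∀ f ∈ s, ∃ (V : X.Opens) (hV : V ≤ W), p ∈ V ∧
      fres hV f ∈ Ideal.span {fres (hV.trans hWU) t} := by
    intro f hf
    have h1 : f ∈ idealAt W p hpW := by
      rw [← mem_ker_ideal_iff (U := ⟨W, hW⟩), ← hs]
      exact Ideal.subset_span hf
    have h2 : X.presheaf.germ W p hpW f ∈ IsLocalRing.maximalIdeal (X.presheaf.stalk p) := h1
    rw [← ht, Ideal.mem_span_singleton] at h2
    obtain ⟨g, hg⟩ := h2
    obtain ⟨V, hV, hpV, g, rfl⟩ := X.presheaf.exists_le_germ_eq g hpW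
    have h3 : X.presheaf.germ W p hpW f =
        X.presheaf.germ V p hpV (fres (hV.trans hWU) t * g) := by
      rw [map_mul, hg]
      congr 1
      exact (TopCat.Presheaf.germ_res_apply ..).symm
    obtain ⟨V', hpV', i₁, i₂, e⟩ := X.presheaf.germ_eq p hpW hpV f _ h3
    refine ⟨V', i₁.le, hpV', ?_⟩
    have e' : fres i₁.le f = fres i₂.le (fres (hV.trans hWU) t * g) := e
    rw [e', fres_mul, fres_fres]
    exact Ideal.mul_mem_right _ _ (Ideal.mem_span_singleton_self _)
  choose! V hV hpV hfV using key
  have hp' : p ∈ W ⊓ s.inf V := by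
    refine ⟨hpW, ?_⟩
    rw [SetLike.mem_coe, ← SetLike.mem_coe, TopologicalSpace.Opens.coe_finset_inf]
    simpa using hpV
  obtain ⟨B, hB, hpB, hBW⟩ := exists_isAffineOpen_mem_and_subset hp'
  have hBW' : B ≤ W := fun z hz => (hBW hz).1
  have hBV : ∀ f ∈ s, B ≤ V f := fun f hf z hz => Finset.inf_le (f := V) hf (hBW hz).2
  refine ⟨⟨B, hB⟩, hBW'.trans hWU, hpB, le_antisymm ?_ ?_⟩
  · rw [← x.ker.map_ideal (U := ⟨B, hB⟩) (V := ⟨W, hW⟩) hBW', ← hs, Ideal.map_span, Ideal.span_le]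
    rintro _ ⟨f, hf, rfl⟩
    have h1 := Ideal.mem_map_of_mem (fresHom (hBV f hf)) (hfV f hf)
    rw [Ideal.map_span, Set.image_singleton, fresHom_apply, fresHom_apply, fres_fres,
      fres_fres] at h1
    exact h1
  · rw [Ideal.span_singleton_le_iff_mem, mem_ker_ideal_iff (U := ⟨B, hB⟩) hpB,
      fres_mem_idealAt_iff _ hpB]
    exact ht.le (Ideal.mem_span_singleton_self _)

theorem eq_point_of_not_isUnit [QuasiCompact x] (hx : IsClosed (Set.range x)) {B : X.affineOpens}
    {τ : Γ(X, B)} (hτ : x.ker.ideal B = Ideal.span {τ}) {z : X} (hz : z ∈ B.1)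
    (h : z ∉ X.basicOpen τ) : z = x (IsLocalRing.closedPoint k) := by
  have h1 : z ∈ x.ker.support := by
    rw [Scheme.IdealSheafData.mem_support_iff_of_mem hz, hτ, Scheme.zeroLocus_span,
      Scheme.zeroLocus_singleton]
    exact h
  have h2 : z ∈ (x.ker.support : Set X) := h1
  rw [Scheme.Hom.support_ker, hx.closure_eq] at h2
  obtain ⟨y, rfl⟩ := h2
  rw [Subsingleton.elim (α := PrimeSpectrum k) y (IsLocalRing.closedPoint k)]

theorem isUnit_fres_inf [QuasiCompact x] (hx : IsClosed (Set.range x)) {B : X.affineOpens}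
    {τ : Γ(X, B)} (hτ : x.ker.ideal B = Ideal.span {τ}) {A : X.Opens}
    (hA : x (IsLocalRing.closedPoint k) ∉ A) :
    IsUnit (fres (inf_le_right : A ⊓ B.1 ≤ B.1) τ) := by
  refine isUnit_of_locally fun z hz => ?_
  refine exists_isUnit_fres hz fun h => hA ?_
  rw [fres_mem_idealAt_iff _ hz, mem_idealAt_iff] at h
  rw [← eq_point_of_not_isUnit hx hτ hz.2 h]
  exact hz.1

/-- If the generator were zero, restriction to `x` would be injective near the point, so the
constants would surject onto the functions of a standard smooth neighbourhood. Its Kähler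
differentials would then vanish, whereas smoothness makes their rank `1`. -/
theorem uniformizer_ne_zero [IsIntegral X] [QuasiCompact x] (π : X ⟶ Spec (.of k))
    [SmoothOfRelativeDimension 1 π] (hπ : x ≫ π = 𝟙 _) {B : X.affineOpens}
    (hB : x (IsLocalRing.closedPoint k) ∈ B.1) {τ : Γ(X, B)}
    (hτ : x.ker.ideal B = Ideal.span {τ}) : τ ≠ 0 := by
  rintro rfl
  obtain ⟨U, -, V, hV, hpV, e, h⟩ :=
    SmoothOfRelativeDimension.exists_isStandardSmoothOfRelativeDimension (n := 1) (f := π)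
      (x (IsLocalRing.closedPoint k))
  have hinj : ∀ f : Γ(X, V), x.app V f = 0 → f = 0 := by
    intro f hf
    have h1 : f ∈ x.ker.ideal ⟨V, hV⟩ := by
      rw [Scheme.Hom.ker_apply]
      exact hf
    obtain ⟨W, hW, hpW, hWV⟩ := exists_isAffineOpen_mem_and_subset (U := V ⊓ B.1) ⟨hpV, hB⟩
    have hWV' : W ≤ V := fun z hz => (hWV hz).1
    have hWB : W ≤ B.1 := fun z hz => (hWV hz).2
    have h2 := fres_mem_ideal (W := ⟨W, hW⟩) (V := ⟨V, hV⟩) hWV' h1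
    rw [← x.ker.map_ideal (U := ⟨W, hW⟩) (V := B) hWB, hτ, Ideal.map_span, Set.image_singleton,
      map_zero, Ideal.span_singleton_eq_bot.mpr rfl, Ideal.mem_bot] at h2
    have : Nonempty W := ⟨⟨_, hpW⟩⟩
    exact map_injective_of_isIntegral X (homOfLE hWV') (h2.trans (map_zero _).symm)
  have hsurj : Function.Surjective (π.appLE U V e).hom := by
    intro f
    have hx : x ⁻¹ᵁ V = ⊤ := mem_of_spec_field hpV
    have hU : U = ⊤ := mem_of_spec_field (e hpV)
    refine ⟨fres (hU.le.trans hx.ge) (x.app V f), ?_⟩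
    rw [← sub_eq_zero]
    refine hinj _ ?_
    rw [map_sub, sub_eq_zero]
    change x.app V (pull π e _) = _
    rw [← pull_eq_app (F := x) (U := V)]
    have hU' : x ⁻¹ᵁ V ≤ U := le_top.trans hU.ge
    rw [pull_pull]
    refine (pull_congr hπ _ hU' _).trans ((pull_id hU' _).trans
      ((fres_fres _ hU' _).trans (fres_self _)))
  algebraize [(π.appLE U V e).hom]
  have : Nontrivial Γ(X, V) := by
    have : Nonempty V := ⟨⟨_, hpV⟩⟩
    infer_instance
  have h1 := Algebra.IsStandardSmoothOfRelativeDimension.rank_kaehlerDifferential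
    (R := Γ(Spec (.of k), U)) (S := Γ(X, V)) 1
  have := KaehlerDifferential.subsingleton_of_surjective Γ(Spec (.of k), U) Γ(X, V) hsurj
  rw [rank_subsingleton'] at h1
  norm_num at h1

end

end
end PicardLefschetz

namespace PicardLefschetz
noncomputable section

/-! ### The section of the relative curve given by a rational point -/

theorem exists_eq_mul_of_locally {X : Scheme.{u}} {V : X.Opens} {τ f : Γ(X, V)}
    (hτ : ∀ (W : X.Opens) (h : W ≤ V) (g : Γ(X, W)), fres h τ * g = 0 → g = 0)
    (hf : ∀ z ∈ V, ∃ (W : X.Opens) (h : W ≤ V) (_ : z ∈ W) (g : Γ(X, W)),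
      fres h f = fres h τ * g) : ∃ g, f = τ * g := by
  obtain ⟨g, hg⟩ := exists_function_of_locally (fun W h g => fres h f = fres h τ * g)
    (fun hV h g e => by
      have := congrArg (fres h) e
      rwa [fres_fres, fres_mul, fres_fres] at this)
    (fun hV s t hs ht => sub_eq_zero.mp (hτ _ hV _ (by rw [mul_sub, ← hs, ← ht, sub_self])))
    (fun z hz => by
      obtain ⟨W, h, hzW, g, hg⟩ := hf z hz
      exact ⟨W, h, hzW, g, hg⟩)
  refine ⟨g, fn_ext fun z hz => ?_⟩
  obtain ⟨W, hW, hz', e⟩ := hg z hz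
  exact ⟨W, hW, hz', by rw [e, fres_mul]⟩

section

variable {B : Scheme.{u}} {X S S' : Over B} (x : Over.mk (𝟙 B) ⟶ X)

/-- The section of `X × S ⟶ S` given by a section `x` of `X`. -/
def sec (S : Over B) : S.left ⟶ prod X S :=
  pullback.lift (S.hom ≫ x.left) (𝟙 _) (by
    have : x.left ≫ X.hom = 𝟙 B := Over.w x
    rw [Category.assoc, this, Category.comp_id, Category.id_comp])

theorem sec_pr₁ : sec x S ≫ pr₁ X S = S.hom ≫ x.left := pullback.lift_fst _ _ _

theorem sec_pr₂ : sec x S ≫ pr₂ X S = 𝟙 _ := pullback.lift_snd _ _ _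

/-- The pasted square has identities as horizontal arrows. Consequently the section is a closed
immersion, and its ideal is pulled back from that of `x`. -/
theorem isPullback_sec : CategoryTheory.IsPullback (sec x S) S.hom (pr₁ X S) x.left := by
  have h1 : CategoryTheory.IsPullback (pr₂ X S) (pr₁ X S) S.hom X.hom :=
    (IsPullback.of_hasPullback X.hom S.hom).flip
  refine IsPullback.of_right (h₁₂ := pr₂ X S) (h₂₂ := X.hom) (v₁₃ := S.hom) ?_
    (sec_pr₁ x) h1
  have : x.left ≫ X.hom = 𝟙 B := Over.w x
  rw [sec_pr₂, this]
  exact IsPullback.of_horiz_isIso ⟨by simp⟩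

theorem sec_prodMap (f : S' ⟶ S) : sec x S' ≫ prodMap X f = f.left ≫ sec x S := by
  refine pullback.hom_ext ?_ ?_
  · rw [Category.assoc, Category.assoc]
    refine (congrArg _ (prodMap_fst X f)).trans ?_
    rw [sec_pr₁, sec_pr₁, ← Category.assoc, Over.w f]
  · rw [Category.assoc, Category.assoc]
    refine (congrArg _ (prodMap_snd X f)).trans ?_
    rw [sec_pr₂, ← Category.assoc, sec_pr₂, Category.id_comp, Category.comp_id]

theorem exists_sec_eq {z : prod X S} {y : B} (h : pr₁ X S z = x.left y) : ∃ s, sec x S s = z := by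
  obtain ⟨w, rfl, -⟩ := Scheme.Pullback.exists_preimage_pullback z y h
  refine ⟨(isPullback_sec x (S := S)).isoPullback.inv w, ?_⟩
  rw [← Scheme.Hom.comp_apply, IsPullback.isoPullback_inv_fst]

theorem isClosedImmersion_sec [IsClosedImmersion x.left] : IsClosedImmersion (sec x S) :=
  MorphismProperty.of_isPullback (isPullback_sec x).flip inferInstance

theorem ker_sec [IsClosedImmersion x.left] :
    (sec x S).ker = x.left.ker.comap (pr₁ X S) := by
  rw [← Scheme.IdealSheafData.ker_fst_of_isClosedImmersion,
    ← Scheme.Hom.ker_comp_of_isIso (isPullback_sec x (S := S)).isoPullback.hom,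
    IsPullback.isoPullback_hom_fst]

end

section

variable {k : Type u} [Field k] {X : Over (Spec (.of k))} {x : Over.mk (𝟙 (Spec (.of k))) ⟶ X}

/-- On the affine open set `B`, the ideal sheaf of the rational point `x` is generated by the
function `τ ≠ 0`, and `A` is the complement of the point. -/
structure LocalCoord (x : Over.mk (𝟙 (Spec (.of k))) ⟶ X) (A : X.left.Opens)
    (B : X.left.affineOpens) (τ : Γ(X.left, B)) : Prop where
  ker_eq : x.left.ker.ideal B = Ideal.span {τ}
  ne_zero : τ ≠ 0
  mem : x.left (IsLocalRing.closedPoint k) ∈ B.1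
  mem_iff : ∀ z, z ∈ A ↔ z ≠ x.left (IsLocalRing.closedPoint k)
  isUnit : IsUnit (fres (inf_le_right : A ⊓ B.1 ≤ B.1) τ)

namespace LocalCoord

variable {A : X.left.Opens} {B : X.left.affineOpens} {τ : Γ(X.left, B)} (H : LocalCoord x A B τ)
  [IsIntegral X.left] [IsClosedImmersion x.left]
include H

omit [IsClosedImmersion x.left] in
-- A nonzero element of a domain is regular, and regularity survives the flat map `pr₁`.
theorem regular (S : Over (Spec (.of k))) {V : (prod X S).Opens} (h : V ≤ pr₁ X S ⁻¹ᵁ B.1)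
    (f : Γ(prod X S, V)) (e : fres h (pull (pr₁ X S) (le_refl (pr₁ X S ⁻¹ᵁ B.1)) τ) * f = 0) :
    f = 0 := by
  refine fn_ext fun z hz => ?_
  obtain ⟨W, hW, hzW, hWV'⟩ := exists_isAffineOpen_mem_and_subset hz
  have hWV : W ≤ V := hWV'
  refine ⟨W, hWV, hzW, ?_⟩
  have e' := congrArg (fres hWV) e
  rw [fres_mul, fres_fres, fres_pull, fres_zero] at e'
  rw [fres_zero]
  have hflat := Flat.flat_appLE (pr₁ X S) B.2 hW (hWV.trans h)
  algebraize [((pr₁ X S).appLE B.1 W (hWV.trans h)).hom]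
  have : Nonempty B.1 := ⟨⟨_, H.mem⟩⟩
  have hreg : IsSMulRegular Γ(X.left, B) τ := mul_right_injective₀ H.ne_zero
  have h2 := hreg.of_flat (S := Γ(prod X S, W))
  exact h2 (e'.trans (mul_zero _).symm)

omit [IsIntegral X.left] [IsClosedImmersion x.left] in
theorem comap_ideal (S : Over (Spec (.of k))) (n : ℕ) {V : (prod X S).affineOpens}
    (h : V.1 ≤ pr₁ X S ⁻¹ᵁ B.1) : ((x.left.ker ^ n).comap (pr₁ X S)).ideal V =
      Ideal.span {fres h (pull (pr₁ X S) (le_refl (pr₁ X S ⁻¹ᵁ B.1)) τ) ^ n} := by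
  rw [PicardLefschetz.comap_ideal _ _ h, Scheme.IdealSheafData.ideal_pow, Pi.pow_apply, H.ker_eq,
    Ideal.span_singleton_pow, Ideal.map_span, Set.image_singleton, map_pow, fres_pull]

theorem sectionCoord (S : Over (Spec (.of k))) : SectionCoord (pr₂ X S) (sec x S)
    (pr₁ X S ⁻¹ᵁ A) (pr₁ X S ⁻¹ᵁ B.1) (pull (pr₁ X S) (le_refl (pr₁ X S ⁻¹ᵁ B.1)) τ) where
  sec_proj := sec_pr₂ x
  cover := by
    refine top_le_iff.mp fun z _ => ?_
    by_cases h : pr₁ X S z = x.left (IsLocalRing.closedPoint k)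
    · right
      change pr₁ X S z ∈ B.1
      rw [h]
      exact H.mem
    · exact .inl ((H.mem_iff _).mpr h)
  unit := by
    have := H.isUnit.map (pull (pr₁ X S) (le_refl (pr₁ X S ⁻¹ᵁ (A ⊓ B.1))))
    rw [pull_fres] at this
    rw [fres_pull]
    exact this
  notMem y hy := by
    refine (H.mem_iff _).mp hy ?_
    rw [← Scheme.Hom.comp_apply, sec_pr₁, Scheme.Hom.comp_apply,
      Subsingleton.elim (α := PrimeSpectrum k) (S.hom y) (IsLocalRing.closedPoint k)]
  exists_sec z hz := by
    refine exists_sec_eq x (y := IsLocalRing.closedPoint k) ?_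
    by_contra h
    exact hz ((H.mem_iff _).mpr h)
  pull_sec {N} h := by
    have h1 : τ ∈ x.left.ker.ideal B := H.ker_eq ▸ Ideal.mem_span_singleton_self _
    rw [Scheme.Hom.ker_apply] at h1
    have h2 : x.left.app B.1 τ = 0 := h1
    have h' : N ≤ (S.hom ≫ x.left) ⁻¹ᵁ B.1 := by
      rw [← sec_pr₁ x]
      exact h
    have h3 := pull_pull (F := x.left) S.hom (le_refl (x.left ⁻¹ᵁ B.1)) h' τ
    rw [pull_eq_app, h2, map_zero] at h3
    rw [pull_pull]
    exact (pull_congr (sec_pr₁ x) _ h' τ).trans h3.symm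
  regular := H.regular S
  dvd {V} h f hf := by
    have := isClosedImmersion_sec x (S := S)
    refine exists_eq_mul_of_locally (fun W hW g hg => H.regular S (hW.trans h) g ?_) fun z hz => ?_
    · rwa [fres_fres] at hg
    · obtain ⟨W, hW, hzW, hWV'⟩ := exists_isAffineOpen_mem_and_subset hz
      have hWV : W ≤ V := hWV'
      refine ⟨W, hWV, hzW, ?_⟩
      have h1 : fres hWV f ∈ (sec x S).ker.ideal ⟨W, hW⟩ := by
        rw [Scheme.Hom.ker_apply, RingHom.mem_ker]
        change (sec x S).app W _ = 0
        rw [pull_eq_app] at hf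
        rw [← fres_app _ hWV, hf, fres_zero]
      -- The case `n = 1` says that the ideal of the section is generated by `T`.
      have h2 := H.comap_ideal S 1 (V := ⟨W, hW⟩) (hWV.trans h)
      rw [ker_sec, ← pow_one x.left.ker, h2, pow_one, Ideal.mem_span_singleton] at h1
      obtain ⟨g, hg⟩ := h1
      exact ⟨g, by rw [fres_fres, hg]⟩

end LocalCoord

end

end
end PicardLefschetz

/-! ### Points of geometric fibres, and the ideal of `n x` -/

namespace PicardLefschetz
noncomputable section

theorem exists_isAlgClosed (F : Type u) [Field F] :
    ∃ (K : Type u) (_ : Field K) (_ : IsAlgClosed K), Nonempty (F →+* K) :=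
  ⟨AlgebraicClosure F, inferInstance, inferInstance, ⟨algebraMap _ _⟩⟩

theorem exists_geomPt_eq {B : Scheme.{u}} (S : Over B) (y : S.left) :
    ∃ s : GeomPt S, ∀ z, s.pt z = y := by
  obtain ⟨K, _, _, ⟨f⟩⟩ := exists_isAlgClosed (S.left.residueField y)
  refine ⟨⟨K, Spec.map (CommRingCat.ofHom f) ≫ S.left.fromSpecResidueField y⟩, fun z => ?_⟩
  rw [Scheme.Hom.comp_apply]
  exact Scheme.fromSpecResidueField_apply _ _

namespace LocalCoord

variable {k : Type u} [Field k] {X : Over (Spec (.of k))} {x : Over.mk (𝟙 (Spec (.of k))) ⟶ X}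
  {A : X.left.Opens} {B : X.left.affineOpens} {τ : Γ(X.left, B)} (H : LocalCoord x A B τ)
  [IsIntegral X.left] [IsClosedImmersion x.left]
include H

omit [IsIntegral X.left] in
theorem ker_ideal_eq_top {V : X.left.affineOpens} (hV : V.1 ≤ A) : x.left.ker.ideal V = ⊤ := by
  rw [Scheme.Hom.ker_apply]
  have h : x.left ⁻¹ᵁ V.1 = ⊥ := by
    refine eq_bot_iff.mpr fun y hy => ?_
    refine ((H.mem_iff _).mp (hV hy) ?_).elim
    rw [Subsingleton.elim (α := PrimeSpectrum k) y (IsLocalRing.closedPoint k)]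
  have : Subsingleton Γ((Over.mk (𝟙 (Spec (.of k)))).left, x.left ⁻¹ᵁ V.1) := by
    rw [h]
    exact inferInstanceAs (Subsingleton Γ(Spec (.of k), ⊥))
  exact (Ideal.eq_top_iff_one _).mpr (Subsingleton.elim _ _)

/-- Over the preimage of `A` the ideal is the unit ideal, so only the condition over `B` remains.
There the ideal is generated by `Tⁿ`, and local quotients glue by regularity. -/
theorem mem_comap_ideal_iff (S : Over (Spec (.of k))) (n : ℕ) (V : (prod X S).affineOpens)
    (f : Γ(prod X S, V)) : f ∈ ((x.left.ker ^ n).comap (pr₁ X S)).ideal V ↔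
      ∃ g : Γ(prod X S, V.1 ⊓ pr₁ X S ⁻¹ᵁ B.1), fres inf_le_left f =
        fres inf_le_right (pull (pr₁ X S) (le_refl (pr₁ X S ⁻¹ᵁ B.1)) τ) ^ n * g := by
  have C := H.sectionCoord S
  refine ⟨fun hf => ?_, fun ⟨g, hg⟩ => mem_ideal_of_locally fun z hz => ?_⟩
  · refine C.exists_eq_pow_mul inf_le_right _ n fun y hy => ?_
    obtain ⟨W, hW, hzW, hWV'⟩ := exists_isAffineOpen_mem_and_subset hy
    have hWV : W ≤ V.1 ⊓ pr₁ X S ⁻¹ᵁ B.1 := hWV'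
    have h1 := fres_mem_ideal (W := ⟨W, hW⟩) (hWV.trans inf_le_left) hf
    rw [H.comap_ideal S n (V := ⟨W, hW⟩) (hWV.trans inf_le_right),
      Ideal.mem_span_singleton] at h1
    obtain ⟨g, hg⟩ := h1
    exact ⟨W, hWV, hzW, g, by rw [fres_fres, hg]⟩
  · by_cases hzA : pr₁ X S z ∈ A
    · obtain ⟨A', hA', hzA', hAA'⟩ := exists_isAffineOpen_mem_and_subset hzA
      obtain ⟨W, hW, hzW, hWV'⟩ := exists_isAffineOpen_mem_and_subset
        (U := V.1 ⊓ pr₁ X S ⁻¹ᵁ A') ⟨hz, hzA'⟩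
      have hWV : W ≤ V.1 ⊓ pr₁ X S ⁻¹ᵁ A' := hWV'
      refine ⟨⟨W, hW⟩, hWV.trans inf_le_left, hzW, ?_⟩
      rw [PicardLefschetz.comap_ideal _ _ (U := ⟨A', hA'⟩) (V := ⟨W, hW⟩) (hWV.trans inf_le_right),
        Scheme.IdealSheafData.ideal_pow, Pi.pow_apply, H.ker_ideal_eq_top (V := ⟨A', hA'⟩) hAA',
        Ideal.top_pow, Ideal.map_top]
      trivial
    · obtain ⟨y, rfl⟩ := C.exists_sec z hzA
      obtain ⟨W, hW, hzW, hWV'⟩ := exists_isAffineOpen_mem_and_subset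
        (U := V.1 ⊓ pr₁ X S ⁻¹ᵁ B.1) ⟨hz, C.mem y⟩
      have hWV : W ≤ V.1 ⊓ pr₁ X S ⁻¹ᵁ B.1 := hWV'
      refine ⟨⟨W, hW⟩, hWV.trans inf_le_left, hzW, ?_⟩
      rw [H.comap_ideal S n (V := ⟨W, hW⟩) (hWV.trans inf_le_right), Ideal.mem_span_singleton]
      have := congrArg (fres hWV) hg
      rw [fres_fres, fres_mul, fres_pow, fres_fres] at this
      exact ⟨_, this⟩

omit H [IsIntegral X.left] [IsClosedImmersion x.left] in
theorem fib_sec {S : Over (Spec (.of k))} (s : GeomPt S) (z : Spec (.of s.K)) :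
    s.fib X (sec x s.over z) = sec x S (s.pt z) :=
  congrArg (fun f => f z) (sec_prodMap x (Over.homMk s.pt rfl : s.over ⟶ S))

omit H [IsIntegral X.left] [IsClosedImmersion x.left] in
theorem exists_geomPt (S : Over (Spec (.of k))) (y : S.left) :
    ∃ (s : GeomPt S) (z : prod X s.over), s.fib X z = sec x S y := by
  obtain ⟨s, hs⟩ := exists_geomPt_eq S y
  exact ⟨s, _, (fib_sec s (IsLocalRing.closedPoint _)).trans (congrArg (sec x S) (hs _))⟩

/-- If `X` had only the point `x`, then `τ` would vanish everywhere, hence be zero since `X` is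
reduced. -/
theorem nonempty : ∃ z, z ∈ A := by
  by_contra h
  push Not at h
  refine H.ne_zero ((basicOpen_eq_bot_iff τ).mp (eq_bot_iff.mpr fun z hz => ?_))
  have hz' : z = x.left (IsLocalRing.closedPoint k) := by
    by_contra h'
    exact h z ((H.mem_iff z).mpr h')
  subst hz'
  have h1 : τ ∈ x.left.ker.ideal B := H.ker_eq ▸ Ideal.mem_span_singleton_self _
  exact (mem_idealAt_iff H.mem).mp ((mem_ker_ideal_iff H.mem).mp h1) hz

theorem exists_fib_mem (S : Over (Spec (.of k))) (s : GeomPt S) :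
    ∃ z : prod X s.over, s.fib X z ∈ pr₁ X S ⁻¹ᵁ A := by
  obtain ⟨a, ha⟩ := H.nonempty
  -- The two points have the same image in the one-point base, so some point of the fibre product
  -- lies over both.
  obtain ⟨z, hz, -⟩ := Scheme.Pullback.exists_preimage_pullback (f := X.hom) (g := s.over.hom) a
    (IsLocalRing.closedPoint s.K) (Subsingleton.elim (α := PrimeSpectrum k) _ _)
  refine ⟨z, ?_⟩
  change pr₁ X S (s.fib X z) ∈ A
  rw [GeomPt.fib, ← Scheme.Hom.comp_apply, prodMap_fst]
  rwa [hz]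

end LocalCoord

end
end PicardLefschetz

/-! ### Global functions on `X × S`, and the degree of `n x` -/

namespace PicardLefschetz
noncomputable section

/-- The ring `Γ(X, 𝒪)` is a domain integral over the algebraically closed field `k`, hence equals
`k`. Flat base change shows that functions on `X × N` come from `N` for affine `N ⊆ S`. Restriction
to the section gives one candidate valid over every `N`, so no gluing is needed. -/
theorem exists_constFn_eq {k : Type u} [Field k] [IsAlgClosed k] {X : Over (Spec (.of k))}
    [IsIntegral X.left] [IsProper X.hom] {x : Over.mk (𝟙 (Spec (.of k))) ⟶ X}
    (S : Over (Spec (.of k))) (f : Γ(prod X S, ⊤)) : ∃ c, f = constFn X S ⊤ c := by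
  have hX : IsIso X.hom.appTop := by
    let F := (Scheme.ΓSpecIso (.of k)).inv ≫ X.hom.appTop
    have h : F.hom.IsIntegral := RingHom.isIntegral_respectsIso.2
      (e := (Scheme.ΓSpecIso (.of k)).symm.commRingCatIsoToRingEquiv) _
      (isIntegral_appTop_of_universallyClosed X.hom)
    have hF : Function.Bijective F.hom := by
      algebraize [F.hom]
      exact IsAlgClosed.algebraMap_bijective_of_isIntegral (k := k) (K := Γ(X.left, ⊤))
    have : IsIso F := (ConcreteCategory.isIso_iff_bijective F).mpr hF
    exact IsIso.of_isIso_comp_left (Scheme.ΓSpecIso (.of k)).inv X.hom.appTop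
  have : CompactSpace X.left := (quasiCompact_iff_compactSpace X.hom).mp inferInstance
  have hqs : QuasiSeparatedSpace X.left := (quasiSeparated_iff_quasiSeparatedSpace X.hom).mp inferInstance
  refine ⟨pull (sec x S) (show ⊤ ≤ sec x S ⁻¹ᵁ ⊤ from le_rfl) f, ?_⟩
  rw [constFn_eq_pull]
  refine fn_ext fun z _ => ?_
  obtain ⟨N, hN, hzN, -⟩ := exists_isAffineOpen_mem_and_subset (U := ⊤) (x := pr₂ X S z) trivial
  refine ⟨pr₂ X S ⁻¹ᵁ N, le_top, hzN, ?_⟩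
  have hP : IsIso (pushoutSection (UY := pr₂ X S ⁻¹ᵁ N) (IsPullback.of_hasPullback X.hom S.hom)
    (US := ⊤) (UT := N) (UX := ⊤) le_top le_top (by simp)) :=
    isIso_pushoutSection_of_isQuasiSeparated_of_flat_right _ _ _ _ (isAffineOpen_top _) hN
      isCompact_univ isQuasiSeparated_univ
  have hP' := (isIso_pushoutSection_iff ..).mp hP
  have hX' : IsIso (X.hom.appLE ⊤ ⊤ le_top) := by
    have : X.hom.appLE ⊤ ⊤ le_top = X.hom.appTop := by
      rw [Scheme.Hom.appTop, ← Scheme.Hom.appLE_eq_app]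
      rfl
    rw [this]
    exact hX
  have := hP'.isIso_inr_of_isIso hX'
  have hbij := ConcreteCategory.bijective_of_isIso
    ((pr₂ X S).appLE N (pr₂ X S ⁻¹ᵁ N) (le_refl (pr₂ X S ⁻¹ᵁ N)))
  obtain ⟨c, hc⟩ := hbij.2 (fres le_top f)
  have hc' : pull (pr₂ X S) (le_refl (pr₂ X S ⁻¹ᵁ N)) c = fres le_top f := hc
  have hN' : N ≤ sec x S ⁻¹ᵁ pr₂ X S ⁻¹ᵁ N := by
    rw [← Scheme.Hom.comp_preimage, sec_pr₂]
    exact le_rfl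
  have e := congrArg (pull (sec x S) hN') hc'
  rw [pull_pull, pull_fres] at e
  have e' : pull (sec x S ≫ pr₂ X S) hN' c = c :=
    (pull_congr (sec_pr₂ x) _ (le_refl N) c).trans ((pull_id (le_refl N) c).trans (fres_self c))
  rw [← hc', ← e', fres_pull]
  refine (congrArg _ e).trans ?_
  rw [← fres_pull (F := sec x S) (show ⊤ ≤ sec x S ⁻¹ᵁ ⊤ from le_rfl) (le_top : N ≤ ⊤), pull_fres]

namespace LocalCoord

variable {k : Type u} [Field k] {X : Over (Spec (.of k))} {x : Over.mk (𝟙 (Spec (.of k))) ⟶ X}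
  {A : X.left.Opens} {B : X.left.affineOpens} {τ : Γ(X.left, B)} (H : LocalCoord x A B τ)
  [IsIntegral X.left] [IsClosedImmersion x.left]
include H

theorem subschemeι_mem (S : Over (Spec (.of k))) (n : ℕ) : ∀ z,
    ((x.left.ker ^ n).comap (pr₁ X S)).subschemeι z ∈ pr₁ X S ⁻¹ᵁ B.1 := by
  set J := (x.left.ker ^ n).comap (pr₁ X S)
  intro z
  have C := H.sectionCoord S
  rcases C.mem_or (J.subschemeι z) with h | ⟨y, hy⟩
  · obtain ⟨V, hV, hzV, hVA'⟩ := exists_isAffineOpen_mem_and_subset h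
    have hVA : V ≤ pr₁ X S ⁻¹ᵁ A := hVA'
    have h1 : (1 : Γ(prod X S, V)) ∈ J.ideal ⟨V, hV⟩ := by
      rw [H.mem_comap_ideal_iff S n ⟨V, hV⟩]
      obtain ⟨g, hg⟩ := ((C.isUnit (V := V ⊓ pr₁ X S ⁻¹ᵁ B.1) (inf_le_left.trans hVA)
        inf_le_right).pow n).dvd (a := fres inf_le_left (1 : Γ(prod X S, V)))
      exact ⟨g, hg⟩
    rw [mem_ideal_iff_app, map_one] at h1
    exact (one_notMem_idealAt (X := J.subscheme) (U := J.subschemeι ⁻¹ᵁ V) hzV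
      (h1 ▸ zero_mem _)).elim
  · rw [← hy]
    exact C.mem y

/-- The subscheme lies in the affine set `V`, so its ring of functions is `Γ(V)/(Tⁿ)`. By Taylor
expansion along the section, `1, T, …, T^{n-1}` is a `K`-basis. -/
theorem degOver_eq {K : Type u} [Field K] (π : Spec (.of K) ⟶ Spec (.of k)) (n : ℕ) :
    degOver (((x.left.ker ^ n).comap (pr₁ X (Over.mk π))).subschemeι ≫ pr₂ X (Over.mk π)) = n := by
  have C := H.sectionCoord (Over.mk π)
  set J := (x.left.ker ^ n).comap (pr₁ X (Over.mk π)) with hJ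
  set V := pr₁ X (Over.mk π) ⁻¹ᵁ B.1 with hV
  set T := pull (pr₁ X (Over.mk π)) (le_refl (pr₁ X (Over.mk π) ⁻¹ᵁ B.1)) τ with hT
  have hVa : IsAffineOpen V := by
    have : IsAffineHom π := inferInstance
    have : IsAffineHom (pr₁ X (Over.mk π)) := MorphismProperty.of_isPullback (P := @IsAffineHom)
      (IsPullback.of_hasPullback X.hom (Over.mk π).hom).flip this
    exact B.2.preimage (pr₁ X (Over.mk π))
  have hD : (⊤ : J.subscheme.Opens) ≤ J.subschemeι ⁻¹ᵁ V := fun z _ => H.subschemeι_mem _ n z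
  have hD' : J.subschemeι ⁻¹ᵁ V = ⊤ := top_le_iff.mp hD
  let ρ := pull J.subschemeι hD
  have hρ : Function.Surjective ρ := by
    intro f
    obtain ⟨g, hg⟩ := J.subschemeι_app_surjective ⟨V, hVa⟩ (fres le_top f)
    refine ⟨g, ?_⟩
    change pull _ _ g = _
    rw [pull_eq_fres_app, hg, fres_fres, fres_self]
  have hker : ∀ f, ρ f = 0 ↔ ∃ g, f = T ^ n * g := by
    intro f
    have h1 : ρ f = 0 ↔ f ∈ J.ideal ⟨V, hVa⟩ := by
      rw [mem_ideal_iff_app]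
      change pull _ _ f = 0 ↔ _
      rw [pull_eq_fres_app]
      refine ⟨fun h => ?_, fun h => by rw [h, fres_zero]⟩
      have := congrArg (fres (V := J.subschemeι ⁻¹ᵁ V) le_top) h
      rwa [fres_fres, fres_self, fres_zero] at this
    rw [h1, H.comap_ideal (Over.mk π) n (V := ⟨V, hVa⟩) le_rfl, Ideal.mem_span_singleton, fres_self]
    rfl
  let : Module K Γ(J.subscheme, ⊤) := Module.compHom _ ((Scheme.ΓSpecIso (.of K)).inv ≫
    (J.subschemeι ≫ pr₂ X (Over.mk π)).appTop).hom
  let i : K →+* Γ((Over.mk π).left, ⊤) := (Scheme.ΓSpecIso (.of K)).inv.hom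
  have hi : Function.Bijective i := (Scheme.ΓSpecIso (.of K)).symm.commRingCatIsoToRingEquiv.bijective
  have hsmul : ∀ (a : K) (f : Γ(J.subscheme, ⊤)), a • f =
      ρ (pull (pr₂ X (Over.mk π)) (le_preimage_top (V := V) _) (i a)) * f := by
    intro a f
    refine congrArg (· * f) ?_
    change (J.subschemeι ≫ pr₂ X (Over.mk π)).app ⊤ (i a) = pull _ _ (pull _ _ (i a))
    exact (fres_self _).symm.trans ((pull_eq_fres_app _ le_rfl (i a)).symm.trans
      (pull_pull _ _ _ _ (i a)).symm)
  let e : (Fin n → K) →ₗ[K] Γ(J.subscheme, ⊤) :=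
    { toFun := fun c => ρ (poly (pr₂ X (Over.mk π)) (le_preimage_top (V := V) _)
        (fres le_rfl T) fun j => i (c j))
      map_add' := fun c d => by
        rw [← map_add]
        congr 1
        simp only [poly, Pi.add_apply, map_add, add_mul, Finset.sum_add_distrib]
      map_smul' := fun a c => by
        rw [RingHom.id_apply, hsmul, ← map_mul]
        congr 1
        simp only [poly, Pi.smul_apply, smul_eq_mul, map_mul, Finset.mul_sum, mul_assoc] }
  have hN : (⊤ : (Over.mk π).left.Opens) ≤ sec x (Over.mk π) ⁻¹ᵁ V := fun y _ => C.mem y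
  have he : Function.Bijective e := by
    refine ⟨(injective_iff_map_eq_zero e).mpr fun c hc => ?_, fun f => ?_⟩
    · obtain ⟨g, hg⟩ := (hker _).mp hc
      funext j
      refine hi.1 ((C.eq_zero_of_poly_eq (le_preimage_top _) hN le_rfl (fun j => i (c j)) g ?_ j).trans
        (map_zero i).symm)
      rw [hg, fres_self]
    · obtain ⟨f, rfl⟩ := hρ f
      obtain ⟨c, r, hc⟩ := C.exists_poly (le_preimage_top _) hN le_rfl n f
      choose c' hc' using fun j => hi.2 (c j)
      refine ⟨c', ?_⟩
      change ρ _ = ρ f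
      rw [← sub_eq_zero, ← map_sub, hker]
      refine ⟨-r, ?_⟩
      simp only [hc']
      rw [hc, fres_self]
      ring
  have h1 := (LinearEquiv.ofBijective e he).finrank_eq
  rw [Module.finrank_fin_fun] at h1
  exact h1.symm

theorem curveCoord [IsAlgClosed k] [IsProper X.hom] (S : Over (Spec (.of k))) (n : ℕ) :
    CurveCoord n X S ((x.left.ker ^ n).comap (pr₁ X S)) (sec x S)
    (pr₁ X S ⁻¹ᵁ A) (pr₁ X S ⁻¹ᵁ B.1) (pull (pr₁ X S) (le_refl (pr₁ X S ⁻¹ᵁ B.1)) τ) where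
  toSectionCoord := H.sectionCoord S
  exists_const := exists_constFn_eq (x := x) S
  exists_geomPt := exists_geomPt S
  exists_fib_mem := H.exists_fib_mem S
  mem_ideal := H.mem_comap_ideal_iff S n
  degree s := by
    rw [← Scheme.IdealSheafData.comap_comp, GeomPt.fib, prodMap_fst]
    exact H.degOver_eq (s.pt ≫ S.hom) n

end LocalCoord

end
end PicardLefschetz

/-! ### From the given local coordinate `t` to an affine neighbourhood -/

namespace PicardLefschetz
noncomputable section

variable {k : Type u} [Field k] {X : Over (Spec (.of k))} {x : Over.mk (𝟙 (Spec (.of k))) ⟶ X}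

theorem isClosedImmersion_left [IsProper X.hom] : IsClosedImmersion x.left := by
  have h : x.left ≫ X.hom = 𝟙 _ := Over.w x
  exact isClosedImmersion_of_comp_eq_id X.hom x.left h

theorem exists_localCoord [IsIntegral X.left] [IsProper X.hom]
    [SmoothOfRelativeDimension 1 X.hom] {U : X.left.Opens}
    (hU : x.left (IsLocalRing.closedPoint k) ∈ U) {t : Γ(X.left, U)}
    (ht : IsUniformizer (x.left (IsLocalRing.closedPoint k)) U hU t) :
    ∃ (A : X.left.Opens) (B : X.left.affineOpens) (hB : B.1 ≤ U), LocalCoord x A B (fres hB t) := by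
  have := isClosedImmersion_left (x := x)
  have := LocallyOfFiniteType.isLocallyNoetherian X.hom
  have hx : IsClosed (Set.range x.left) := x.left.isClosedEmbedding.isClosed_range
  obtain ⟨B, hB, hm, he⟩ := exists_affine_ker_eq_span hU ht
  let A : X.left.Opens := ⟨(Set.range x.left)ᶜ, hx.isOpen_compl⟩
  have hA (z : X.left) : z ∈ A ↔ z ≠ x.left (IsLocalRing.closedPoint k) := by
    refine ⟨fun h e => h ⟨_, e.symm⟩, ?_⟩
    rintro h ⟨y, rfl⟩
    exact h (congrArg _ (Subsingleton.elim (α := PrimeSpectrum k) y _))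
  exact ⟨A, B, hB, he, uniformizer_ne_zero X.hom (Over.w x) hm he, hm, hA,
    isUnit_fres_inf hx he fun h => (hA _).mp h rfl⟩

/-- The points of `X × S` over `x` are exactly those of the section, and neighbourhoods of these may
be shrunk into the preimage of `B`. -/
theorem LocalCoord.hasCoordinates_iff {A : X.left.Opens} {B : X.left.affineOpens}
    {U : X.left.Opens} {t : Γ(X.left, U)} {hB : B.1 ≤ U} (H : LocalCoord x A B (fres hB t))
    {S : Over (Spec (.of k))} {n : ℕ} {ξ : LocalModel n X S} {a b : Fin n → Γ(S.left, ⊤)} :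
    ξ.HasCoordinates (x.left (IsLocalRing.closedPoint k)) U t a b ↔
      ξ.IsCoord (sec x S) (pull (pr₁ X S) (le_refl (pr₁ X S ⁻¹ᵁ B.1)) (fres hB t)) ⊤ a b := by
  have hT {V : (prod X S).Opens} (hV : V ≤ pr₁ X S ⁻¹ᵁ U) :
      fres hV ((pr₁ X S).app U t) = pull (pr₁ X S) hV t := by
    rw [← pull_eq_app, fres_pull]
  have hsum {V : (prod X S).Opens} (τ : Γ(prod X S, V)) (c : Fin n → Γ(S.left, ⊤)) :
      ∑ j, constFn X S V (c j) * τ ^ (j : ℕ) = poly (pr₂ X S) (le_preimage_top _) τ c := by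
    simp only [constFn_eq_pull, poly]
  have hp (y : S.left) : pr₁ X S (sec x S y) = x.left (IsLocalRing.closedPoint k) := by
    rw [← Scheme.Hom.comp_apply, sec_pr₁, Scheme.Hom.comp_apply,
      Subsingleton.elim (α := PrimeSpectrum k) (S.hom y) (IsLocalRing.closedPoint k)]
  constructor
  · intro h y _
    obtain ⟨V, hV, hz, l, q, e, w, h1, h2, h3, h4, h5, h6, h7⟩ := h _ (hp y)
    rw [hsum] at h3 h7
    have F : ξ.AdaptedFrame V _ l q e w _ _ := ⟨h1, h2, h3, h4, h5, h6, h7⟩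
    have hzB : sec x S y ∈ pr₁ X S ⁻¹ᵁ B.1 := by
      change pr₁ X S (sec x S y) ∈ B.1
      rw [hp]
      exact H.mem
    have F' := F.restrict (inf_le_left : V ⊓ pr₁ X S ⁻¹ᵁ B.1 ≤ V)
    rw [fres_poly, fres_poly, fres_fres, hT] at F'
    refine ⟨V ⊓ pr₁ X S ⁻¹ᵁ B.1, inf_le_right, le_preimage_top _, ⟨hz, hzB⟩,
      res _ inf_le_left l, res _ inf_le_left q, res _ inf_le_left e, res _ inf_le_left w, ?_⟩
    rw [fres_pull, pull_fres]
    exact F'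
  · intro h z hz
    obtain ⟨y, rfl⟩ := exists_sec_eq x hz
    obtain ⟨V, hV, hN, hy, l, q, e, w, F⟩ := h y trivial
    rw [fres_pull, pull_fres] at F
    have hV' : V ≤ pr₁ X S ⁻¹ᵁ U := fun z hz => hB (hV hz)
    rw [← hT hV', ← hsum, ← hsum] at F
    exact ⟨V, hV', hy, l, q, e, w, F.comp_l, F.form_q, F.h_q, F.h_e, F.h_w, F.form_w, F.eq⟩

end
end PicardLefschetz

namespace PicardLefschetz
noncomputable section

/-! ### Morphisms to affine schemes over a field -/

section

variable {R : CommRingCat.{u}} {S S' : Scheme.{u}}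

/-- Evaluation of functions at a point of `Spec R`, as a ring homomorphism. -/
def evalHom (P : S ⟶ Spec R) : R →+* Γ(S, ⊤) := ((Scheme.ΓSpecIso R).inv ≫ P.appTop).hom

theorem hom_ext_of_evalAt {P P' : S ⟶ Spec R} (h : ∀ r, evalAt P r = evalAt P' r) : P = P' := by
  refine ext_of_isAffine ?_
  rw [← cancel_epi (Scheme.ΓSpecIso R).inv]
  ext r
  exact h r

theorem evalAt_comp (f : S' ⟶ S) (P : S ⟶ Spec R) (r : R) :
    evalAt (f ≫ P) r = pull f (le_preimage_top _) (evalAt P r) := by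
  rw [evalAt, Scheme.Hom.comp_appTop]
  exact (pull_eq_app f _).symm

theorem evalAt_specMap {R' : CommRingCat.{u}} (f : R' ⟶ R) (P : S ⟶ Spec R) (r : R') :
    evalAt (P ≫ Spec.map f) r = evalAt P (f r) := by
  rw [evalAt, evalAt, Scheme.Hom.comp_appTop, ← CommRingCat.comp_apply, ← CommRingCat.comp_apply,
    ← Scheme.ΓSpecIso_inv_naturality_assoc]
  rfl

theorem evalAt_toSpecΓ (r : Γ(S, ⊤)) : evalAt S.toSpecΓ r = r := by
  rw [evalAt, ← CommRingCat.comp_apply, Scheme.toSpecΓ_appTop, Iso.inv_hom_id]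
  rfl

theorem evalAt_mem_idealAt_iff (P : S ⟶ Spec R) (r : R) (s : S) :
    evalAt P r ∈ idealAt ⊤ s trivial ↔ r ∈ (P s : PrimeSpectrum R).asIdeal := by
  have e : evalAt P r = pull P (le_preimage_top _) ((Scheme.ΓSpecIso R).inv r) :=
    (pull_eq_app P _).symm
  rw [e]
  refine (pull_mem_idealAt_iff P (le_preimage_top _) (TopologicalSpace.Opens.mem_top s)).trans ?_
  rw [mem_idealAt_iff, basicOpen_eq_of_affine]
  exact not_not

end

section

variable {k : Type u} [Field k] {R : Type u} [CommRing R] [Algebra k R] {S S' : Over (Spec (.of k))}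

/-- The spectrum of a `k`-algebra as a scheme over `k`. -/
abbrev overSpec (k : Type u) [Field k] (R : Type u) [CommRing R] [Algebra k R] :
    Over (Spec (.of k)) :=
  Over.mk (Spec.map (CommRingCat.ofHom (algebraMap k R)))

theorem evalAt_algebraMap (P : S ⟶ overSpec k R) (c : k) :
    evalAt (R := .of R) P.left (algebraMap k R c) = evalAt (R := .of k) S.hom c := by
  have h : P.left ≫ Spec.map (CommRingCat.ofHom (algebraMap k R)) = S.hom := Over.w P
  rw [← h, evalAt_specMap]
  rfl

theorem exists_hom_overSpec (g : R →+* Γ(S.left, ⊤))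
    (hg : ∀ c, g (algebraMap k R c) = evalAt (R := .of k) S.hom c) :
    ∃ P : S ⟶ overSpec k R, ∀ r, evalAt (R := .of R) P.left r = g r := by
  refine ⟨Over.homMk (S.left.toSpecΓ ≫ Spec.map (CommRingCat.ofHom g)) ?_, fun r => ?_⟩
  · refine hom_ext_of_evalAt fun c => ?_
    refine Eq.trans ?_ (hg c)
    change evalAt ((_ ≫ _) ≫ Spec.map _) _ = _
    rw [evalAt_specMap, evalAt_specMap, evalAt_toSpecΓ]
    rfl
  · change evalAt (_ ≫ _) _ = _
    rw [evalAt_specMap, evalAt_toSpecΓ]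
    rfl

theorem hom_overSpec_ext {σ : Type*} {P P' : S ⟶ overSpec k R} (q : MvPolynomial σ k →+* R)
    (hq : Function.Surjective q) (hC : ∀ c, q (MvPolynomial.C c) = algebraMap k R c)
    (h : ∀ i, evalAt (R := .of R) P.left (q (MvPolynomial.X i)) =
      evalAt (R := .of R) P'.left (q (MvPolynomial.X i))) : P = P' := by
  refine Over.OverMorphism.ext (hom_ext_of_evalAt (R := .of R) fun r => ?_)
  obtain ⟨p, rfl⟩ := hq r
  have : (evalHom (R := .of R) P.left).comp q = (evalHom (R := .of R) P'.left).comp q := by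
    refine MvPolynomial.ringHom_ext (fun c => ?_) h
    change evalAt (R := .of R) P.left (q (MvPolynomial.C c)) =
      evalAt (R := .of R) P'.left (q (MvPolynomial.C c))
    rw [hC, evalAt_algebraMap, evalAt_algebraMap]
  exact RingHom.congr_fun this p

end

end
end PicardLefschetz

/-! ### The functor of points of the fibre over `n x` -/

namespace PicardLefschetz
noncomputable section

/-- The functions `α`, `β` identify the `S`-points of `Z` with the solutions of the equations
`∑_{i + j = k} a_i b_j = 0`, where `1 ≤ k < n`. -/
structure IsSolutionSpace {B₀ : Scheme.{u}} {n : ℕ} (Z : Over B₀)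
    (α β : ∀ {S : Over B₀}, (S ⟶ Z) → Fin n → Γ(S.left, ⊤)) : Prop where
  ext : ∀ {S} (P P' : S ⟶ Z), α P = α P' → β P = β P' → P = P'
  conv_eq_zero : ∀ {S} (P : S ⟶ Z) (k : ℕ), 1 ≤ k → k < n → conv (α P) (β P) k = 0
  exists_eq : ∀ {S : Over B₀} (a b : Fin n → Γ(S.left, ⊤)),
    (∀ k : ℕ, 1 ≤ k → k < n → conv a b k = 0) → ∃ P : S ⟶ Z, α P = a ∧ β P = b
  left_comp : ∀ {S S' : Over B₀} (f : S' ⟶ S) (P : S ⟶ Z),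
    α (f ≫ P) = fun i => pull f.left (le_preimage_top _) (α P i)
  right_comp : ∀ {S S' : Over B₀} (f : S' ⟶ S) (P : S ⟶ Z),
    β (f ≫ P) = fun i => pull f.left (le_preimage_top _) (β P i)

theorem preimage_prodMap_pr₁ {B₀ : Scheme.{u}} {X S S' : Over B₀} (f : S' ⟶ S) (U : X.left.Opens) :
    pr₁ X S' ⁻¹ᵁ U = prodMap X f ⁻¹ᵁ (pr₁ X S ⁻¹ᵁ U) := by
  rw [← prodMap_fst X f]
  rfl

theorem pull_prodMap_pr₁ {B₀ : Scheme.{u}} {X S S' : Over B₀} (f : S' ⟶ S) (U : X.left.Opens)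
    (h : pr₁ X S' ⁻¹ᵁ U ≤ prodMap X f ⁻¹ᵁ (pr₁ X S ⁻¹ᵁ U)) (t : Γ(X.left, U)) :
    pull (pr₁ X S') (le_refl (pr₁ X S' ⁻¹ᵁ U)) t =
      pull (prodMap X f) h (pull (pr₁ X S) (le_refl (pr₁ X S ⁻¹ᵁ U)) t) := by
  rw [pull_pull]
  exact pull_congr (prodMap_fst X f).symm _ _ t

section

variable {k : Type u} [Field k] [IsAlgClosed k] {X : Over (Spec (.of k))} [IsIntegral X.left]
  [IsProper X.hom] {x : Over.mk (𝟙 (Spec (.of k))) ⟶ X} {A : X.left.Opens} {B : X.left.affineOpens}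
  {τ : Γ(X.left, B)} {n : ℕ} {Z : Over (Spec (.of k))}
  {α β : ∀ {S : Over (Spec (.of k))}, (S ⟶ Z) → Fin n → Γ(S.left, ⊤)}

theorem Fiber.exists_coord [NeZero n] (H : LocalCoord x A B τ) (hZ : IsSolutionSpace Z α β)
    {S : Over (Spec (.of k))} (ξ : Fiber n X x S) : ∃ P : S ⟶ Z,
      ξ.1.IsCoord (sec x S) (pull (pr₁ X S) (le_refl (pr₁ X S ⁻¹ᵁ B.1)) τ) ⊤ (α P) (β P) := by
  have := isClosedImmersion_left (x := x)
  have C := H.curveCoord S n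
  obtain ⟨lA, lB, K⟩ := C.exists_normalized ξ.2
  obtain ⟨a, b, hc⟩ := K.exists_isCoord C.toSectionCoord ⊤
  obtain ⟨d, hd⟩ := LocalModel.exists_isDet (ξ := ξ.1) C.exists_const
  obtain ⟨P, rfl, rfl⟩ := hZ.exists_eq a b fun _ => hc.conv_eq_zero C.toSectionCoord hd
  exact ⟨P, hc⟩

variable {Φ : ∀ S : Over (Spec (.of k)), Fiber n X x S → (S ⟶ Z)}

section

variable {S : Over (Spec (.of k))} (ξ : Fiber n X x S)
  (H : LocalCoord x A B τ)
  (hΦ : ξ.1.IsCoord (sec x S) (pull (pr₁ X S) (le_refl (pr₁ X S ⁻¹ᵁ B.1)) τ) ⊤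
    (α (Φ S ξ)) (β (Φ S ξ)))
include H hΦ

theorem Fiber.isCoord_iff {a b : Fin n → Γ(S.left, ⊤)} :
    ξ.1.IsCoord (sec x S) (pull (pr₁ X S) (le_refl (pr₁ X S ⁻¹ᵁ B.1)) τ) ⊤ a b ↔
      a = α (Φ S ξ) ∧ b = β (Φ S ξ) := by
  have := isClosedImmersion_left (x := x)
  have C := H.curveCoord S n
  obtain ⟨lA, lB, K⟩ := C.exists_normalized ξ.2
  refine ⟨fun h => K.isCoord_unique C.toSectionCoord h hΦ, ?_⟩
  rintro ⟨rfl, rfl⟩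
  exact hΦ

variable [NeZero n]

theorem Fiber.isDet_iff {d : Γ(S.left, ⊤)} :
    ξ.1.IsDet d ↔ d = α (Φ S ξ) 0 * β (Φ S ξ) 0 := by
  have := isClosedImmersion_left (x := x)
  have C := H.curveCoord S n
  refine ⟨fun h => hΦ.det_eq C.toSectionCoord h, ?_⟩
  rintro rfl
  obtain ⟨d, hd⟩ := LocalModel.exists_isDet (ξ := ξ.1) C.exists_const
  rwa [← hΦ.det_eq C.toSectionCoord hd]

theorem Fiber.defectFree_iff : ξ.1.DefectFree ↔ ∀ y : S.left,
    ¬ (α (Φ S ξ) 0 ∈ idealAt ⊤ y trivial ∧ β (Φ S ξ) 0 ∈ idealAt ⊤ y trivial ∧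
      conv (α (Φ S ξ)) (β (Φ S ξ)) n ∈ idealAt ⊤ y trivial) := by
  have := isClosedImmersion_left (x := x)
  have C := H.curveCoord S n
  obtain ⟨lA, lB, K⟩ := C.exists_normalized ξ.2
  exact LocalModel.defectFree_iff C.toSectionCoord K C.exists_geomPt hΦ
    ((Fiber.isDet_iff ξ H hΦ).mpr rfl)

theorem Fiber.isomorphic_std (hab : ∀ k : ℕ, 1 ≤ k → k < n → conv (α (Φ S ξ)) (β (Φ S ξ)) k = 0) :
    have := isClosedImmersion_left (x := x)
    ξ.1.Isomorphic ((H.curveCoord S n).std (α (Φ S ξ)) (β (Φ S ξ)) hab) := by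
  intro _
  have C := H.curveCoord S n
  obtain ⟨lA, lB, K⟩ := C.exists_normalized ξ.2
  exact C.isomorphic_std K hΦ hab ((Fiber.isDet_iff ξ H hΦ).mpr rfl)

end

/-- Every point is isomorphic to the standard one with its coordinates, so equal coordinates mean
isomorphic points. The standard models also give surjectivity and the existence of pullbacks, and
naturality follows from uniqueness of coordinates. Stating this for any solution space covers both
`eqScheme` and `plane`. -/
theorem represents_of_isCoord [NeZero n] (H : LocalCoord x A B τ) (hZ : IsSolutionSpace Z α β)
    (hΦ : ∀ S (ξ : Fiber n X x S),
      ξ.1.IsCoord (sec x S) (pull (pr₁ X S) (le_refl (pr₁ X S ⁻¹ᵁ B.1)) τ) ⊤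
        (α (Φ S ξ)) (β (Φ S ξ))) : Represents Φ := by
  have := isClosedImmersion_left (x := x)
  refine ⟨fun {S} ξ ξ' => ⟨fun h => ?_, fun h => ?_⟩, fun S P => ?_, fun {S S'} f ξ => ?_,
    fun {S S'} f ξ ξ' h => ?_⟩
  · have h1 := Fiber.isomorphic_std ξ H (hΦ S ξ) (hZ.conv_eq_zero _)
    have h2 := Fiber.isomorphic_std ξ' H (hΦ S ξ') (hZ.conv_eq_zero _)
    have h3 (P P' : S ⟶ Z) (e : P = P') :
      (H.curveCoord S n).std (α P) (β P) (hZ.conv_eq_zero P) =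
        (H.curveCoord S n).std (α P') (β P') (hZ.conv_eq_zero P') := by
      subst e
      rfl
    exact h1.trans (h3 _ _ h ▸ h2.symm)
  · obtain ⟨e1, e2⟩ := (Fiber.isCoord_iff ξ' H (hΦ S ξ')).mp (h.isCoord (hΦ S ξ))
    exact hZ.ext _ _ e1 e2
  · let ξ : Fiber n X x S := ⟨(H.curveCoord S n).std (α P) (β P) (hZ.conv_eq_zero P),
      fun V => (H.curveCoord S n).toFn_std_comp V⟩
    have h : ξ.1.IsCoord _ _ ⊤ (α P) (β P) := (H.curveCoord S n).isCoord_std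
    obtain ⟨e1, e2⟩ := (Fiber.isCoord_iff ξ H (hΦ S ξ)).mp h
    exact ⟨ξ, hZ.ext _ _ e1.symm e2.symm⟩
  · have h1 := Fiber.isomorphic_std ξ H (hΦ S ξ) (hZ.conv_eq_zero _)
    have hB := (preimage_prodMap_pr₁ f B.1).le
    exact ⟨⟨(H.curveCoord S' n).std _ _ (CurveCoord.conv_pull (f := f) (hZ.conv_eq_zero _)),
      fun V => (H.curveCoord S' n).toFn_std_comp V⟩,
      h1.isPullback ((H.curveCoord S n).isPullback_std (H.curveCoord S' n)
        (preimage_prodMap_pr₁ f A).le hB (pull_prodMap_pr₁ f B.1 hB τ) _)⟩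
  · have hB := (preimage_prodMap_pr₁ f B.1).le
    have h1 := h.isCoord hB (preimage_prodMap_pr₁ f B.1).ge (pull_prodMap_pr₁ f B.1 hB τ)
      (sec_prodMap x f) (hΦ S ξ)
    obtain ⟨e1, e2⟩ := (Fiber.isCoord_iff ξ' H (hΦ S' ξ')).mp h1
    refine hZ.ext _ _ ?_ ?_
    · rw [hZ.left_comp, ← e1]
    · rw [hZ.right_comp, ← e2]

theorem Fiber.act_eq (H : LocalCoord x A B τ)
    (hΦ : ∀ S (ξ : Fiber n X x S),
      ξ.1.IsCoord (sec x S) (pull (pr₁ X S) (le_refl (pr₁ X S ⁻¹ᵁ B.1)) τ) ⊤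
        (α (Φ S ξ)) (β (Φ S ξ))) {S : Over (Spec (.of k))} (ξ : Fiber n X x S) (c : Γ(S.left, ⊤)ˣ)
    (i : Fin n) : α (Φ S (ξ.act c)) i = (c : Γ(S.left, ⊤)) ^ 2 * α (Φ S ξ) i ∧
      β (Φ S (ξ.act c)) i = (c : Γ(S.left, ⊤)) ^ 2 * β (Φ S ξ) i := by
  obtain ⟨e1, e2⟩ := (Fiber.isCoord_iff (ξ.act c) H (hΦ S _)).mp ((hΦ S ξ).act c)
  exact ⟨(congrFun e1 i).symm, (congrFun e2 i).symm⟩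

end

end
end PicardLefschetz

/-! ### The coordinate schemes and the main theorem -/

namespace PicardLefschetz
noncomputable section

section

variable {k : Type u} [Field k] {n : ℕ}

/-- It suffices to test generators; `l = m + n` matches the two ranges of indices. -/
theorem map_eqIdeal_eq_zero_iff {R : Type*} [CommRing R] (f : Coord k n →+* R) :
    (∀ p ∈ eqIdeal k n, f p = 0) ↔ ∀ l : ℕ, 1 ≤ l → l < n →
      conv (fun i => f (MvPolynomial.X (.inl i))) (fun j => f (MvPolynomial.X (.inr j))) l = 0 := by
  have h (l : ℕ) (m : ℤ) (e : (l : ℤ) = m + n) :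
      f (convSum (fun i => MvPolynomial.X (.inl i)) (fun j => MvPolynomial.X (.inr j)) m) =
        conv (fun i => f (MvPolynomial.X (.inl i))) (fun j => f (MvPolynomial.X (.inr j))) l := by
    rw [map_convSum, convSum_eq_conv _ _ l m e]
  constructor
  · intro hf l h1 h2
    rw [← h l (l - n) (by ring)]
    exact hf _ (Ideal.subset_span ⟨l - n, ⟨by omega, by omega⟩, rfl⟩)
  · intro hf
    have : eqIdeal k n ≤ RingHom.ker f := by
      refine Ideal.span_le.mpr ?_
      rintro _ ⟨m, ⟨h1, h2⟩, rfl⟩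
      obtain ⟨l, hl⟩ := Int.eq_ofNat_of_zero_le (show 0 ≤ m + n by omega)
      exact (h l m hl.symm).trans (hf l (by omega) (by omega))
    exact fun p hp => this hp

theorem isSolutionSpace_eqScheme :
    IsSolutionSpace (eqScheme k n) (fun {_} P => coordA P) (fun {_} P => coordB P) where
  ext {S} P P' h1 h2 := by
    refine hom_overSpec_ext (Ideal.Quotient.mk (eqIdeal k n)) Ideal.Quotient.mk_surjective
      (fun c => rfl) ?_
    rintro (i | i)
    · exact congrFun h1 i
    · exact congrFun h2 i
  conv_eq_zero {S} P := by
    refine (map_eqIdeal_eq_zero_iff ((evalHom (R := .of (Coord k n ⧸ eqIdeal k n)) P.left).comp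
      (Ideal.Quotient.mk (eqIdeal k n)))).mp fun p hp => ?_
    rw [RingHom.comp_apply, Ideal.Quotient.eq_zero_iff_mem.mpr hp, map_zero]
  exists_eq {S} a b hab := by
    let f : Coord k n →+* Γ(S.left, ⊤) :=
      MvPolynomial.eval₂Hom (evalHom (R := .of k) S.hom) (Sum.elim a b)
    have hf : ∀ p ∈ eqIdeal k n, f p = 0 := by
      rw [map_eqIdeal_eq_zero_iff]
      simpa [f] using hab
    obtain ⟨P, hP⟩ := exists_hom_overSpec (k := k) (Ideal.Quotient.lift (eqIdeal k n) f hf)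
      fun c => (Ideal.Quotient.lift_mk _ _ _).trans (MvPolynomial.eval₂Hom_C _ _ c)
    refine ⟨P, funext fun i => ?_, funext fun i => ?_⟩
    · exact (hP _).trans ((Ideal.Quotient.lift_mk _ _ _).trans (MvPolynomial.eval₂Hom_X' _ _ _))
    · exact (hP _).trans ((Ideal.Quotient.lift_mk _ _ _).trans (MvPolynomial.eval₂Hom_X' _ _ _))
  left_comp f P := funext fun _ => evalAt_comp f.left P.left _
  right_comp f P := funext fun _ => evalAt_comp f.left P.left _

/-- The first coordinate function of an `S`-point of the plane, as a family. -/
def planeA {S : Over (Spec (.of k))} (P : S ⟶ plane k) (_ : Fin 1) : Γ(S.left, ⊤) := planeCoord P 0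

/-- The second coordinate function of an `S`-point of the plane, as a family. -/
def planeB {S : Over (Spec (.of k))} (P : S ⟶ plane k) (_ : Fin 1) : Γ(S.left, ⊤) := planeCoord P 1

theorem isSolutionSpace_plane :
    IsSolutionSpace (plane k) (fun {_} P => planeA P) (fun {_} P => planeB P) where
  ext {S} P P' h1 h2 := by
    refine hom_overSpec_ext (RingHom.id _) Function.surjective_id (fun c => rfl) fun i => ?_
    fin_cases i
    · exact congrFun h1 0
    · exact congrFun h2 0
  -- For `n = 1` there are no equations, since no `l` satisfies `1 ≤ l < 1`.
  conv_eq_zero P l h1 h2 := by omega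
  exists_eq {S} a b hab := by
    obtain ⟨P, hP⟩ := exists_hom_overSpec (k := k) (MvPolynomial.eval₂Hom (evalHom (R := .of k) S.hom)
      ![a 0, b 0]) (MvPolynomial.eval₂Hom_C _ _)
    refine ⟨P, funext fun i => ?_, funext fun i => ?_⟩
    · rw [Subsingleton.elim i 0]
      exact (hP _).trans (MvPolynomial.eval₂Hom_X' _ _ _)
    · rw [Subsingleton.elim i 0]
      exact (hP _).trans (MvPolynomial.eval₂Hom_X' _ _ _)
  left_comp f P := funext fun _ => evalAt_comp f.left P.left _
  right_comp f P := funext fun _ => evalAt_comp f.left P.left _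

/-- A point lies in the zero locus exactly when the three generators, pulled back to `S`, vanish at
`s`. The third one, of degree `m = 0`, is `conv` in degree `n`. -/
theorem mem_defectLocus_iff [NeZero n] {S : Over (Spec (.of k))} (P : S ⟶ eqScheme k n)
    (s : S.left) : P.left s ∈ defectLocus k n ↔ coordA P 0 ∈ idealAt ⊤ s trivial ∧
      coordB P 0 ∈ idealAt ⊤ s trivial ∧ conv (coordA P) (coordB P) n ∈ idealAt ⊤ s trivial := by
  have h : conv (coordA P) (coordB P) n = evalAt (R := .of (Coord k n ⧸ eqIdeal k n)) P.left
      (Ideal.Quotient.mk (eqIdeal k n) (convSum (fun i => MvPolynomial.X (.inl i))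
        (fun j => MvPolynomial.X (.inr j)) 0)) := by
    rw [convSum_eq_conv _ _ n 0 (by simp)]
    exact (map_conv ((evalHom (R := .of (Coord k n ⧸ eqIdeal k n)) P.left).comp
      (Ideal.Quotient.mk (eqIdeal k n))) _ _ n).symm
  have e (p : Coord k n) := evalAt_mem_idealAt_iff (R := .of (Coord k n ⧸ eqIdeal k n)) P.left
    (Ideal.Quotient.mk (eqIdeal k n) p) s
  rw [h]
  refine Iff.trans ?_ (and_congr (e _) (and_congr (e _) (e _))).symm
  rw [defectLocus, Set.image_insert_eq, Set.image_insert_eq, Set.image_singleton]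
  refine (PrimeSpectrum.mem_zeroLocus (P.left s : PrimeSpectrum (Coord k n ⧸ eqIdeal k n)) _).trans ?_
  rw [Set.insert_subset_iff, Set.insert_subset_iff, Set.singleton_subset_iff]
  rfl

end

end
end PicardLefschetz

theorem mainTheorem11 (k : Type u) [Field k] [IsAlgClosed k]
    (X : Over (Spec (.of k))) [IsIntegral X.left] [IsProper X.hom] [SmoothOfRelativeDimension 1 X.hom]
    (x : Over.mk (𝟙 (Spec (.of k))) ⟶ X)
    (U : X.left.Opens) (hU : x.left (IsLocalRing.closedPoint k) ∈ U) (t : Γ(X.left, U))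
    (ht : PicardLefschetz.IsUniformizer (x.left (IsLocalRing.closedPoint k)) U hU t) :
    (∀ (n : ℕ) [NeZero n],
      ∃ Φ : ∀ S : Over (Spec (.of k)),
          PicardLefschetz.Fiber n X x S → (S ⟶ PicardLefschetz.eqScheme k n),
        PicardLefschetz.Represents Φ ∧
        (∀ S (ξ : PicardLefschetz.Fiber n X x S) (a b : Fin n → Γ(S.left, ⊤)),
          ξ.1.HasCoordinates (x.left (IsLocalRing.closedPoint k)) U t a b ↔
            a = PicardLefschetz.coordA (Φ S ξ) ∧ b = PicardLefschetz.coordB (Φ S ξ)) ∧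
        (∀ S (ξ : PicardLefschetz.Fiber n X x S),
          ξ.1.DefectFree ↔ ∀ s : S.left, (Φ S ξ).left s ∉ PicardLefschetz.defectLocus k n) ∧
        (∀ S (ξ : PicardLefschetz.Fiber n X x S) (d : Γ(S.left, ⊤)),
          ξ.1.IsDet d ↔
            d = PicardLefschetz.coordA (Φ S ξ) 0 * PicardLefschetz.coordB (Φ S ξ) 0) ∧
        (∀ S (ξ : PicardLefschetz.Fiber n X x S) (c : Γ(S.left, ⊤)ˣ) (i : Fin n),
          PicardLefschetz.coordA (Φ S (ξ.act c)) i =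
            (c : Γ(S.left, ⊤)) ^ 2 * PicardLefschetz.coordA (Φ S ξ) i ∧
          PicardLefschetz.coordB (Φ S (ξ.act c)) i =
            (c : Γ(S.left, ⊤)) ^ 2 * PicardLefschetz.coordB (Φ S ξ) i)) ∧
    (∃ Ψ : ∀ S : Over (Spec (.of k)),
        PicardLefschetz.Fiber 1 X x S → (S ⟶ PicardLefschetz.plane k),
      PicardLefschetz.Represents Ψ ∧
      (∀ S (ξ : PicardLefschetz.Fiber 1 X x S) (a b : Fin 1 → Γ(S.left, ⊤)),
        ξ.1.HasCoordinates (x.left (IsLocalRing.closedPoint k)) U t a b ↔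
          a 0 = PicardLefschetz.planeCoord (Ψ S ξ) 0 ∧
          b 0 = PicardLefschetz.planeCoord (Ψ S ξ) 1) ∧
      (∀ S (ξ : PicardLefschetz.Fiber 1 X x S) (d : Γ(S.left, ⊤)),
        ξ.1.IsDet d ↔
          d = PicardLefschetz.planeCoord (Ψ S ξ) 0 * PicardLefschetz.planeCoord (Ψ S ξ) 1)) := by
  obtain ⟨A, B, hB, H⟩ := PicardLefschetz.exists_localCoord hU ht
  refine ⟨fun n _ => ?_, ?_⟩
  · choose Φ hΦ using fun S (ξ : PicardLefschetz.Fiber n X x S) =>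
      ξ.exists_coord H PicardLefschetz.isSolutionSpace_eqScheme
    refine ⟨Φ, PicardLefschetz.represents_of_isCoord H PicardLefschetz.isSolutionSpace_eqScheme hΦ,
      fun S ξ a b => H.hasCoordinates_iff.trans (ξ.isCoord_iff H (hΦ S ξ)),
      fun S ξ => (ξ.defectFree_iff H (hΦ S ξ)).trans
        (forall_congr' fun s => not_congr (PicardLefschetz.mem_defectLocus_iff (Φ S ξ) s).symm),
      fun S ξ d => ξ.isDet_iff H (hΦ S ξ), fun S ξ c i => PicardLefschetz.Fiber.act_eq (α := fun {_} P => PicardLefschetz.coordA P)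
        (β := fun {_} P => PicardLefschetz.coordB P) H hΦ ξ c i⟩
  · choose Ψ hΨ using fun S (ξ : PicardLefschetz.Fiber 1 X x S) =>
      ξ.exists_coord H PicardLefschetz.isSolutionSpace_plane
    refine ⟨Ψ, PicardLefschetz.represents_of_isCoord H PicardLefschetz.isSolutionSpace_plane hΨ,
      fun S ξ a b => ?_, fun S ξ d => ?_⟩
    · refine H.hasCoordinates_iff.trans ((PicardLefschetz.Fiber.isCoord_iff (Φ := Ψ)
        (α := fun {_} P => PicardLefschetz.planeA P)
        (β := fun {_} P => PicardLefschetz.planeB P) ξ H (hΨ S ξ)).trans ?_)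
      rw [funext_iff, funext_iff, Fin.forall_fin_one, Fin.forall_fin_one]
      rfl
    · exact PicardLefschetz.Fiber.isDet_iff (Φ := Ψ)
        (α := fun {_} P => PicardLefschetz.planeA P)
        (β := fun {_} P => PicardLefschetz.planeB P) ξ H (hΨ S ξ)
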